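/- Let $0\le r<s$ be integers, put $\hat r=2r+s$, $\hat s=2s+r$, $g=r+s-1$, and assume $\gcd(3,\hat r)=1$. Let $b_1,\dots,b_{r+s}\in\mathbb C$ be pairwise distinct, $k_s(x)=\prod_{i\le s}(x-b_i)$, $k_r(x)=\prod_{s<i\le s+r}(x-b_i)$, and let $$R=\mathbb C[x,y_{\hat r},y_{\hat s}]/\bigl(y_{\hat r}^2-y_{\hat s}k_r(x),\ y_{\hat r}y_{\hat s}-k_r(x)k_s(x),\ y_{\hat s}^2-y_{\hat r}k_s(x)\bigr).$$ Let $X$ be the compact Riemann surface obtained from the smooth affine curve $\operatorname{Spec}R$ by adding one point $\infty$, at which $x$ has a pole of order $3$. For affine points $P,Q$ let $$\Sigma(P,Q)=\frac{y_{\hat r,P}y_{\hat s,P}+y_{\hat r,P}y_{\hat s,Q}+y_{\hat r,Q}y_{\hat s,P}}{3(x_P-x_Q)\,y_{\hat r,P}y_{\hat s,P}}\,dx_P ,$$ and let $d_Q\Sigma(P,Q)$ be $dx_P\otimes dx_Q$ times the derivative, with respect to $x_Q$ along the curve, of the coefficient of $dx_P$ in $\Sigma(P,Q)$. Let $\hat\phi_0,\hat\phi_1,\dots$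 be the monomials $x^ay_{\hat r}$, $x^ay_{\hat s}$, $x^ay_{\hat r}y_{\hat s}$ ($a\ge 0$) in the order of increasing pole order at $\infty$, and $\nu^I_i=\hat\phi_{i-1}\,dx/(3y_{\hat r}y_{\hat s})$ for $1\le i\le g$. (1) For any two distinct affine points $P_1,P_2$, the form $\Pi_{P_1}^{P_2}=\Sigma(\cdot,P_1)-\Sigma(\cdot,P_2)$ is a differential of the third kind on $X$ (meromorphic with at most simple poles); its only poles are simple poles at $P_1$ and $P_2$, with residues $+1$ and $-1$ respectively. (2) The derivative defining $d_Q\Sigma(P,Q)$ exists whenever $x_P\neq x_Q$ and neither $P$ nor $Q$ is a branch point of $x$. There exist differentials of the second kind (meromorphic with all residues zero) $\nu^{II}_1,\dots,\nu^{II}_g$ on $X$, holomorphic outside $\infty$, with $$d_Q\Sigma(P,Q)-d_P\Sigma(Q,P)=\sum_{i=1}^g\bigl(\nu^I_i(Q)\otimes\nu^{II}_i(P)-\nu^I_i(P)\otimes\nu^{II}_i(Q)\bigr).\qquad(*)$$ For every such choice of $\nu^{II}_1,\dots,\nu^{II}_g$, the form $$\Omega(P_1,P_2)=d_{P_2}\Sigma(P_1,P_2)+\sum_{i=1}^g\nu^I_i(P_1)\otimes\nu^{II}_i(P_2)$$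 is a fundamental differential of the second kind on $X\times X$: it is symmetric, $\Omega(P_1,P_2)=\Omega(P_2,P_1)$; it extends holomorphically to all of $X\times X$ minus the diagonal; and near each point $(P,P)$ of the diagonal, for every local parameter $t$ of $X$ at $P$ (with $t_1,t_2$ its values at the two points), $$\Omega=\Bigl(\frac1{(t_1-t_2)^2}+\text{holomorphic}\Bigr)\,dt_1\otimes dt_2 .$$ Moreover there is $F\in R\otimes_{\mathbb C}R$ with $$\Omega(P_1,P_2)=\frac{F(P_1,P_2)\,dx_1\otimes dx_2}{9\,(x_1-x_2)^2\,y_{\hat r,P_1}y_{\hat s,P_1}y_{\hat r,P_2}y_{\hat s,P_2}} .$$ -/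

import Mathlib

open Filter Topology TensorProduct

noncomputable section

namespace TrigonalCurve

variable {r s : ℕ}

/-- `k_s(x) = (x - b_1) ⋯ (x - b_s)`. -/
def ks (b : Fin (s + r) → ℂ) : Polynomial ℂ :=
  ∏ i : Fin s, (Polynomial.X - Polynomial.C (b (Fin.castAdd r i)))

/-- `k_r(x) = (x - b_{s+1}) ⋯ (x - b_{s+r})`. -/
def kr (b : Fin (s + r) → ℂ) : Polynomial ℂ :=
  ∏ i : Fin r, (Polynomial.X - Polynomial.C (b (Fin.natAdd s i)))

/-! ### The affine ring and the affine curve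

The three variables are `X 0 = x`, `X 1 = y_{2r+s}` and `X 2 = y_{2s+r}`. -/

/-- The ideal generated by `y_r̂² - y_ŝ k_r(x)`, `y_r̂ y_ŝ - k_r(x) k_s(x)`, `y_ŝ² - y_r̂ k_s(x)`. -/
def relIdeal (b : Fin (s + r) → ℂ) : Ideal (MvPolynomial (Fin 3) ℂ) :=
  Ideal.span
    {MvPolynomial.X 1 ^ 2 - MvPolynomial.X 2 * Polynomial.aeval (MvPolynomial.X 0) (kr b),
     MvPolynomial.X 1 * MvPolynomial.X 2 -
       Polynomial.aeval (MvPolynomial.X 0) (kr b) * Polynomial.aeval (MvPolynomial.X 0) (ks b),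
     MvPolynomial.X 2 ^ 2 - MvPolynomial.X 1 * Polynomial.aeval (MvPolynomial.X 0) (ks b)}

/-- The affine ring `R = ℂ[x, y_r̂, y_ŝ] / (…)`. -/
abbrev CoordRing (b : Fin (s + r) → ℂ) : Type := MvPolynomial (Fin 3) ℂ ⧸ relIdeal b

/-- The points of the affine curve `X ∖ ∞ = Spec R`, as a subspace of `ℂ³`. -/
abbrev Affine (b : Fin (s + r) → ℂ) : Type :=
  {p : ℂ × ℂ × ℂ //
    p.2.1 ^ 2 = p.2.2 * (kr b).eval p.1 ∧
    p.2.1 * p.2.2 = (kr b).eval p.1 * (ks b).eval p.1 ∧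
    p.2.2 ^ 2 = p.2.1 * (ks b).eval p.1}

variable {b : Fin (s + r) → ℂ}

/-- The coordinate function `x`. -/
def Affine.x (P : Affine b) : ℂ := P.1.1

/-- The coordinate function `y_r̂`, `r̂ = 2r + s`. -/
def Affine.yr (P : Affine b) : ℂ := P.1.2.1

/-- The coordinate function `y_ŝ`, `ŝ = 2s + r`. -/
def Affine.ys (P : Affine b) : ℂ := P.1.2.2

/-- Evaluation of an element of `R` at a point of the affine curve. -/
def evalAt (P : Affine b) : CoordRing b →ₐ[ℂ] ℂ :=
  Ideal.Quotient.liftₐ (relIdeal b) (MvPolynomial.aeval ![P.x, P.yr, P.ys]) (by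
    intro a ha
    have hle : relIdeal b ≤
        RingHom.ker (MvPolynomial.aeval ![P.x, P.yr, P.ys] : MvPolynomial (Fin 3) ℂ →ₐ[ℂ] ℂ) := by
      have key : ∀ q : Polynomial ℂ,
          (MvPolynomial.aeval ![P.x, P.yr, P.ys] : MvPolynomial (Fin 3) ℂ →ₐ[ℂ] ℂ)
            (Polynomial.aeval (MvPolynomial.X 0) q) = q.eval P.x := by
        intro q
        rw [← Polynomial.aeval_algHom_apply]
        simp [Polynomial.aeval_def, Polynomial.eval₂_eq_eval_map]
      obtain ⟨h1, h2, h3⟩ := P.2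
      rw [relIdeal, Ideal.span_le]
      rintro f (rfl | rfl | rfl) <;>
        simp only [SetLike.mem_coe, RingHom.mem_ker, map_sub, map_mul, map_pow, key,
          MvPolynomial.aeval_X, sub_eq_zero]
      · exact h1
      · exact h2
      · exact h3
    exact hle ha)

/-- Evaluation of an element of `R ⊗ R` at a pair of points of the affine curve. -/
def evalAt₂ (P Q : Affine b) : CoordRing b ⊗[ℂ] CoordRing b →ₐ[ℂ] ℂ :=
  Algebra.TensorProduct.productMap (evalAt P) (evalAt Q)

/-! ### The compact Riemann surface and its meromorphic differentials -/

/-- The compact curve `X`: the affine curve together with the point `∞`. -/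
abbrev Curve (b : Fin (s + r) → ℂ) : Type := OnePoint (Affine b)

/-- `γ` is (the inverse of) a local parameter of the Riemann surface `X` at `p`, defined near
`t = 0`. At an affine point it is a holomorphic immersion into the smooth curve `Spec R ⊆ ℂ³`. The
covering `x : X → ℙ¹` has degree three and is totally ramified at `∞`, so there it is a meromorphic
map for which `x` has a pole of order exactly `3` at `t = 0` (`γ 0` is then irrelevant). -/
def IsLocalParam (p : Curve b) (γ : ℂ → Affine b) : Prop :=
  (∃ P : Affine b, p = (P : Curve b) ∧ γ 0 = P ∧
    AnalyticAt ℂ (fun t => (γ t).x) 0 ∧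
    AnalyticAt ℂ (fun t => (γ t).yr) 0 ∧
    AnalyticAt ℂ (fun t => (γ t).ys) 0 ∧
    (deriv (fun t => (γ t).x) 0 ≠ 0 ∨ deriv (fun t => (γ t).yr) 0 ≠ 0 ∨
      deriv (fun t => (γ t).ys) 0 ≠ 0)) ∨
  (p = OnePoint.infty ∧
    MeromorphicAt (fun t => (γ t).x) 0 ∧
    MeromorphicAt (fun t => (γ t).yr) 0 ∧
    MeromorphicAt (fun t => (γ t).ys) 0 ∧
    meromorphicOrderAt (fun t => (γ t).x) 0 = ((-3 : ℤ) : WithTop ℤ))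

/-- A differential `f dx` on `X` is given by its coefficient `f`; its pullback along a local
parametrization `γ` is `f(γ(t)) (x ∘ γ)'(t) dt`. -/
def pull (f : Affine b → ℂ) (γ : ℂ → Affine b) (t : ℂ) : ℂ :=
  f (γ t) * deriv (fun τ => (γ τ).x) t

/-- `f dx` is a meromorphic differential on the compact curve `X`. -/
def IsMeromorphicDiff (f : Affine b → ℂ) : Prop :=
  ∀ (p : Curve b) (γ : ℂ → Affine b), IsLocalParam p γ → MeromorphicAt (pull f γ) 0

/-- `f dx` is meromorphic at `p` without a pole at `p`. -/
def IsRegularAt (f : Affine b → ℂ) (p : Curve b) : Prop :=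
  ∀ γ : ℂ → Affine b, IsLocalParam p γ →
    MeromorphicAt (pull f γ) 0 ∧ 0 ≤ meromorphicOrderAt (pull f γ) 0

/-- `f dx` has a pole of order exactly one at `p`. -/
def HasSimplePoleAt (f : Affine b → ℂ) (p : Curve b) : Prop :=
  ∀ γ : ℂ → Affine b, IsLocalParam p γ →
    MeromorphicAt (pull f γ) 0 ∧ meromorphicOrderAt (pull f γ) 0 = ((-1 : ℤ) : WithTop ℤ)

/-- The residue of `f dx` at `p` is `c`: in a local parameter, `f dx - c dt / t` has a meromorphic
primitive in a punctured neighbourhood of `p`. -/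
def HasResidueAt (f : Affine b → ℂ) (p : Curve b) (c : ℂ) : Prop :=
  ∀ γ : ℂ → Affine b, IsLocalParam p γ →
    ∃ G : ℂ → ℂ, MeromorphicAt G 0 ∧ ∀ᶠ t in 𝓝[≠] (0 : ℂ), HasDerivAt G (pull f γ t - c / t) t

/-- Differentials of the second kind: meromorphic, with all residues zero. -/
def IsSecondKind (f : Affine b → ℂ) : Prop :=
  IsMeromorphicDiff f ∧ ∀ p : Curve b, HasResidueAt f p 0

/-- Differentials of the third kind: meromorphic, with at most simple poles. -/
def IsThirdKind (f : Affine b → ℂ) : Prop :=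
  IsMeromorphicDiff f ∧ ∀ (p : Curve b) (γ : ℂ → Affine b), IsLocalParam p γ →
    ((-1 : ℤ) : WithTop ℤ) ≤ meromorphicOrderAt (pull f γ) 0

/-! ### The form `Σ(P, Q)` -/

/-- The coefficient of `dx_P` in `Σ(P, Q)`. -/
def sigma (P Q : Affine b) : ℂ :=
  (P.yr * P.ys + P.yr * Q.ys + Q.yr * P.ys) / (3 * (P.x - Q.x) * (P.yr * P.ys))

/-- The coefficient of `Π_{P₁}^{P₂} = Σ(·, P₁) - Σ(·, P₂)`. -/
def thirdKind (P₁ P₂ : Affine b) (P : Affine b) : ℂ := sigma P P₁ - sigma P P₂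

/-- `d` is the derivative at `Q` with respect to `x` of the function `f` along the curve. -/
def HasXDerivAt (f : Affine b → ℂ) (Q : Affine b) (d : ℂ) : Prop :=
  Tendsto (fun Q' : Affine b => (f Q' - f Q) / (Q'.x - Q.x)) (𝓝[≠] Q) (𝓝 d)

/-- The derivative `∂f/∂x` along the curve. -/
def xDeriv (f : Affine b → ℂ) (Q : Affine b) : ℂ :=
  limUnder (𝓝[≠] Q) (fun Q' : Affine b => (f Q' - f Q) / (Q'.x - Q.x))

/-- The coefficient of `dx_P ⊗ dx_Q` in `d_Q Σ(P, Q)`. -/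
def dSigma (P Q : Affine b) : ℂ := xDeriv (fun Q' => sigma P Q') Q

/-- The dense open set of pairs of affine points, neither of them a branch point and with
`x_P ≠ x_Q`, on which the coefficients of all the bidifferentials below are defined. -/
def Generic (P Q : Affine b) : Prop :=
  P.yr * P.ys ≠ 0 ∧ Q.yr * Q.ys ≠ 0 ∧ P.x ≠ Q.x

/-! ### Differentials of the first kind -/

/-- The genus `r + s - 1`. -/
def genus (r s : ℕ) : ℕ := r + s - 1

/-- The weights (pole orders at `∞`) of the monomials `x^a y_r̂`, `x^a y_ŝ`, `x^a y_r̂ y_ŝ`, which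
are a basis of the functions in `R` that vanish at all the branch points. -/
def IsHatWeight (r s n : ℕ) : Prop :=
  ∃ a : ℕ, n = 3 * a + (2 * r + s) ∨ n = 3 * a + (2 * s + r) ∨
    n = 3 * a + ((2 * r + s) + (2 * s + r))

/-- `φ̂_i`, the `i`-th (`i = 0, 1, …`) of these monomials in the order of increasing weight. -/
def phiHat (b : Fin (s + r) → ℂ) (i : ℕ) : CoordRing b :=
  let n := Nat.nth (IsHatWeight r s) i
  Ideal.Quotient.mk (relIdeal b)
    (if n % 3 = (2 * r + s) % 3 then
      MvPolynomial.X 0 ^ ((n - (2 * r + s)) / 3) * MvPolynomial.X 1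
    else if n % 3 = (2 * s + r) % 3 then
      MvPolynomial.X 0 ^ ((n - (2 * s + r)) / 3) * MvPolynomial.X 2
    else
      MvPolynomial.X 0 ^ ((n - ((2 * r + s) + (2 * s + r))) / 3) *
        (MvPolynomial.X 1 * MvPolynomial.X 2))

/-- The coefficient of `ν^I_{i+1} = φ̂_i dx / (3 y_r̂ y_ŝ)`. -/
def nuI (i : Fin (genus r s)) (P : Affine b) : ℂ :=
  evalAt P (phiHat b i) / (3 * (P.yr * P.ys))

/-! ### Associated differentials of the second kind and the fundamental bidifferential -/

/-- `ν^{II}_1, …, ν^{II}_g` are differentials of the second kind, without poles outside `∞`, with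
`d_Q Σ(P,Q) - d_P Σ(Q,P) = ∑ (ν^I_i(Q) ⊗ ν^{II}_i(P) - ν^I_i(P) ⊗ ν^{II}_i(Q))`. -/
def IsAssociated (nuII : Fin (genus r s) → Affine b → ℂ) : Prop :=
  (∀ i, IsSecondKind (nuII i) ∧ ∀ P : Affine b, IsRegularAt (nuII i) (P : Curve b)) ∧
  ∀ P Q : Affine b, Generic P Q →
    dSigma P Q - dSigma Q P = ∑ i, (nuI i Q * nuII i P - nuI i P * nuII i Q)

/-- The coefficient of `dx₁ ⊗ dx₂` in `d_{P₂} Σ(P₁, P₂) + ∑ ν^I_i(P₁) ⊗ ν^{II}_i(P₂)`. -/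
def omega (nuII : Fin (genus r s) → Affine b → ℂ) (P₁ P₂ : Affine b) : ℂ :=
  dSigma P₁ P₂ + ∑ i, nuI i P₁ * nuII i P₂

/-- The pullback of `W(P₁, P₂) dx₁ ⊗ dx₂` along a pair of local parametrizations. -/
def pull₂ (W : Affine b → Affine b → ℂ) (γ₁ γ₂ : ℂ → Affine b) (t : ℂ × ℂ) : ℂ :=
  W (γ₁ t.1) (γ₂ t.2) * deriv (fun τ => (γ₁ τ).x) t.1 * deriv (fun τ => (γ₂ τ).x) t.2

/-- `W(P₁, P₂) dx₁ ⊗ dx₂` is a fundamental differential of the second kind on `X × X`: it is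
symmetric, holomorphic near every point of `X × X` off the diagonal, and of the form
`(1 / (t₁ - t₂)² + holomorphic) dt₁ ⊗ dt₂` near every point of the diagonal, `∞` included. -/
def IsFundamentalSecondKind (W : Affine b → Affine b → ℂ) : Prop :=
  (∀ P Q : Affine b, Generic P Q → W P Q = W Q P) ∧
  (∀ (p q : Curve b) (γ₁ γ₂ : ℂ → Affine b), p ≠ q → IsLocalParam p γ₁ → IsLocalParam q γ₂ →
    ∃ H : ℂ × ℂ → ℂ, AnalyticAt ℂ H (0, 0) ∧
      ∀ᶠ t in 𝓝 ((0, 0) : ℂ × ℂ), t.1 ≠ 0 → t.2 ≠ 0 → Generic (γ₁ t.1) (γ₂ t.2) →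
        pull₂ W γ₁ γ₂ t = H t) ∧
  (∀ (p : Curve b) (γ : ℂ → Affine b), IsLocalParam p γ →
    ∃ H : ℂ × ℂ → ℂ, AnalyticAt ℂ H (0, 0) ∧
      ∀ᶠ t in 𝓝 ((0, 0) : ℂ × ℂ), t.1 ≠ 0 → t.2 ≠ 0 → Generic (γ t.1) (γ t.2) →
        pull₂ W γ γ t = 1 / (t.1 - t.2) ^ 2 + H t)

end TrigonalCurve

end

/-!
The proof rests on explicit formulas on the curve `u² = v A`, `u v = A B`, `v² = u B`, where
`u = y_r̂`, `v = y_ŝ`, `A = k_r`, `B = k_s`.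

*Local parameters.* At an affine point `dx / u` and `dx / v` are holomorphic: off the branch points
`x` is a local coordinate, and over a root of `B` (or of `A`) the function `u` (or `v`) is one, with
`x - b_i` equal to its cube times a unit. At `∞` the functions `x`, `u`, `v` have poles of orders
`3`, `r̂`, `ŝ`. This is `exists_affineGerm` and `exists_inftyGerm`.

*Third kind.* One has `Σ(P, P₁) = φ dx / (x - x₁)` with `φ = (1 + v₁/v + u₁/u) / 3`. If `P₁` is not
a branch point, then `φ` is `1` at `P₁` and `0` at the other points over `x₁`; if it is one, then
`φ = 1/3` and `dx / (x - x₁)` has residue `3`. So the residue at `P₁` is `1`; at `∞` it is `-1`,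
which cancels in a difference (`tendsto_mul_pull_sigma`).

*Existence of the `ν^{II}_i`.* The derivative of `Σ(P, Q)` with respect to `x_Q` is computed in
`dSigma_eq`. The coefficient of `u_P v_Q` in the numerator of `d_Q Σ(P, Q) - d_P Σ(Q, P)` is a
polynomial in `x = x_P` and `z = x_Q`, bilinear in `A` and `B`, and divisible by `(x - z)²`; the
quotient has total degree at most `r + s - 2` (`antisymCoeff_mem`). In each of its monomials
`x^m z^n` either `x^m` or `z^n` belongs to a holomorphic differential, and the other factor is put
into a form `x^k dx / u` or `x^k dx / v` (`exists_algForm_of_mem_polySpan`). Such forms have a pole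
only at `∞`, and no residue there: as `3` divides neither `r̂` nor `ŝ`, exact forms reduce them to
holomorphic ones (`hasPrimitive_zpow`).

*Uniqueness.* Two choices of the `ν^{II}_i` differ by `δ_i` for which `∑ ν^I_i(Q) δ_i(P)` is
symmetric. As the `ν^I_i` are linearly independent, the `δ_i` are linear combinations of them
(`exists_eq_sum_nuI`), so every choice is of the explicit form above outside the branch points.
This gives the element `F` of `R ⊗ R`.

*Singularities of `Ω`.* The identity satisfied by the `ν^{II}_i` says precisely that `Ω` is
symmetric. Fix local parameters `t₁` and `t₂` at two points of the compact curve. Let `ε` be `1`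
on the diagonal and `0` off it. For `t₁` near `0` and `t₂` on a small circle, `Ω - ε / (t₁ - t₂)²`
extends analytically to `t₁ = 0`, with values in the continuous functions on the circle
(`exists_analytic_family`). For fixed `t₁ ≠ 0` it has only removable singularities in the disc
bounded by the circle: at `t₂ = 0` by symmetry, and at the points with `x_P = x_Q` because `Ω` is
there, up to a holomorphic term, the derivative in `t₂` of a function with at most a simple pole,
whose polar coefficient is `0` if `Q ≠ P` and `-1` if `Q = P`. The Cauchy integral over the circle
is therefore a holomorphic extension to a neighbourhood of `(0, 0)`
(`exists_analyticAt_cauchyIntegral`, `IsAssociated.exists_pull₂_eq`).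
-/

noncomputable section

namespace TrigonalCurve

/-! ### Removable singularities, residues and a Hartogs-type extension lemma -/

/-- `m` has a removable singularity at `x`: it agrees with an analytic function in a punctured
neighbourhood of `x`. -/
def Removable (m : ℂ → ℂ) (x : ℂ) : Prop :=
  ∃ g : ℂ → ℂ, AnalyticAt ℂ g x ∧ m =ᶠ[𝓝[≠] x] g

theorem _root_.AnalyticAt.removable {m : ℂ → ℂ} {x : ℂ} (h : AnalyticAt ℂ m x) : Removable m x :=
  ⟨m, h, EventuallyEq.rfl⟩

namespace Removable

variable {m n : ℂ → ℂ} {x : ℂ}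

theorem congr (h : Removable m x) (hn : n =ᶠ[𝓝[≠] x] m) : Removable n x := by
  obtain ⟨g, hg, e⟩ := h
  exact ⟨g, hg, hn.trans e⟩

theorem add (h : Removable m x) (h' : Removable n x) : Removable (fun t => m t + n t) x := by
  obtain ⟨g, hg, e⟩ := h
  obtain ⟨g', hg', e'⟩ := h'
  exact ⟨_, hg.add hg', e.add e'⟩

theorem sub (h : Removable m x) (h' : Removable n x) : Removable (fun t => m t - n t) x := by
  obtain ⟨g, hg, e⟩ := h
  obtain ⟨g', hg', e'⟩ := h'
  exact ⟨_, hg.sub hg', e.sub e'⟩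

theorem mul (h : Removable m x) (h' : Removable n x) : Removable (fun t => m t * n t) x := by
  obtain ⟨g, hg, e⟩ := h
  obtain ⟨g', hg', e'⟩ := h'
  exact ⟨_, hg.mul hg', e.mul e'⟩

theorem const (c : ℂ) : Removable (fun _ => c) x := analyticAt_const.removable

theorem meromorphicAt (h : Removable m x) : MeromorphicAt m x := by
  obtain ⟨g, hg, e⟩ := h
  exact hg.meromorphicAt.congr e.symm

theorem order_nonneg (h : Removable m x) : 0 ≤ meromorphicOrderAt m x := by
  obtain ⟨g, hg, e⟩ := h
  rw [meromorphicOrderAt_congr e]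
  exact hg.meromorphicOrderAt_nonneg

theorem of_tendsto {c : ℂ} (hm : MeromorphicAt m x) (h : Tendsto m (𝓝[≠] x) (𝓝 c)) :
    Removable m x := by
  refine ⟨Function.update m x c, ?_, ?_⟩
  · have h1 : MeromorphicAt (Function.update m x c) x := hm.update _ _
    refine h1.analyticAt ?_
    exact continuousAt_update_same.mpr h
  · filter_upwards [self_mem_nhdsWithin] with t ht
    rw [Function.update_of_ne ht]

theorem of_order_nonneg (hm : MeromorphicAt m x) (h : 0 ≤ meromorphicOrderAt m x) :
    Removable m x := by
  obtain ⟨c, hc⟩ := (tendsto_nhds_iff_meromorphicOrderAt_nonneg hm).2 h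
  exact of_tendsto hm hc

/-- A holomorphic function has a primitive near any point. -/
theorem exists_primitive (h : Removable m x) :
    ∃ G : ℂ → ℂ, MeromorphicAt G x ∧ ∀ᶠ t in 𝓝[≠] x, HasDerivAt G (m t) t := by
  obtain ⟨g, hg, e⟩ := h
  obtain ⟨ε, hε, hd⟩ := Metric.eventually_nhds_iff_ball.1
    (hg.eventually_analyticAt)
  have hdiff : DifferentiableOn ℂ g (Metric.ball x ε) := fun t ht =>
    (hd t ht).differentiableAt.differentiableWithinAt
  obtain ⟨G, hG⟩ := hdiff.isExactOn_ball
  have hball : Metric.ball x ε ∈ 𝓝 x := Metric.ball_mem_nhds x hε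
  refine ⟨G, ?_, ?_⟩
  · have : DifferentiableOn ℂ G (Metric.ball x ε) := fun t ht =>
      (hG t ht).differentiableAt.differentiableWithinAt
    exact (this.analyticAt hball).meromorphicAt
  · filter_upwards [e, nhdsWithin_le_nhds hball] with t ht htb
    rw [ht]
    exact hG t htb

end Removable

/-- If `t m(t) → c` then `m - c / t` is holomorphic at `0`. -/
theorem removable_sub_of_tendsto {m : ℂ → ℂ} {c : ℂ} (hm : MeromorphicAt m 0)
    (h : Tendsto (fun t => t * m t) (𝓝[≠] 0) (𝓝 c)) : Removable (fun t => m t - c / t) 0 := by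
  have h1 : Removable (fun t => t * m t) 0 :=
    .of_tendsto (MeromorphicAt.id 0 |>.mul hm) h
  obtain ⟨g, hg, e⟩ := h1
  have hg0 : g 0 = c :=
    tendsto_nhds_unique (hg.continuousAt.tendsto.mono_left nhdsWithin_le_nhds) (h.congr' e)
  refine ⟨dslope g 0, ?_, ?_⟩
  · obtain ⟨p, hp⟩ := hg
    exact (hp.has_fpower_series_dslope_fslope).analyticAt
  · filter_upwards [e, self_mem_nhdsWithin] with t ht (ht0 : t ≠ 0)
    rw [dslope_of_ne _ ht0, slope_def_field, ← ht, hg0]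
    field_simp
    ring

theorem neg_one_le_order_of_tendsto {m : ℂ → ℂ} {c : ℂ} (hm : MeromorphicAt m 0)
    (h : Tendsto (fun t => t * m t) (𝓝[≠] 0) (𝓝 c)) :
    ((-1 : ℤ) : WithTop ℤ) ≤ meromorphicOrderAt m 0 := by
  have h1 : 0 ≤ meromorphicOrderAt (id * m) 0 :=
    (tendsto_nhds_iff_meromorphicOrderAt_nonneg ((MeromorphicAt.id 0).mul hm)).1 ⟨c, h⟩
  rw [meromorphicOrderAt_mul (MeromorphicAt.id 0) hm, meromorphicOrderAt_id] at h1
  cases hh : meromorphicOrderAt m 0 with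
  | top => exact le_top
  | coe n =>
    rw [hh] at h1
    norm_cast at h1 ⊢
    have : (0 : ℤ) ≤ 1 + n := by exact_mod_cast h1
    omega

theorem order_eq_neg_one_of_tendsto {m : ℂ → ℂ} {c : ℂ} (hc : c ≠ 0) (hm : MeromorphicAt m 0)
    (h : Tendsto (fun t => t * m t) (𝓝[≠] 0) (𝓝 c)) :
    meromorphicOrderAt m 0 = ((-1 : ℤ) : WithTop ℤ) := by
  have h1 : meromorphicOrderAt (id * m) 0 = 0 :=
    (tendsto_ne_zero_iff_meromorphicOrderAt_eq_zero ((MeromorphicAt.id 0).mul hm)).1 ⟨c, hc, h⟩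
  rw [meromorphicOrderAt_mul (MeromorphicAt.id 0) hm, meromorphicOrderAt_id] at h1
  cases hh : meromorphicOrderAt m 0 with
  | top => simp [hh] at h1
  | coe n =>
    rw [hh] at h1
    have : 1 + n = 0 := by exact_mod_cast h1
    norm_cast
    omega

/-- The values of the analytic continuations of a function with removable singularities only. -/
theorem exists_analyticAt_of_removable {m : ℂ → ℂ} {s : Set ℂ} (h : ∀ x ∈ s, Removable m x) :
    ∃ G : ℂ → ℂ, (∀ x ∈ s, AnalyticAt ℂ G x) ∧ ∀ x ∈ s, ContinuousAt m x → G x = m x := by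
  refine ⟨fun x => limUnder (𝓝[≠] x) m, fun x hx => ?_, fun x _ hc => ?_⟩
  · obtain ⟨g, hg, e⟩ := h x hx
    refine hg.congr ?_
    have h1 : ∀ᶠ y in 𝓝[≠] x, ∀ᶠ t in 𝓝 y, m t = g t :=
      eventually_eventually_nhdsWithin.2 e |>.mp (by
        filter_upwards [self_mem_nhdsWithin] with y hy hy'
        rwa [(isOpen_compl_singleton.nhdsWithin_eq hy)] at hy')
    have h2 : ∀ᶠ y in 𝓝 x, ContinuousAt g y :=
      hg.eventually_analyticAt.mono fun y hy => hy.continuousAt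
    rw [eventually_nhdsWithin_iff] at h1
    filter_upwards [h1, h2] with y hy hgy
    have hlim : ∀ᶠ t in 𝓝[≠] y, m t = g t := by
      by_cases hyx : y = x
      · rw [hyx]; exact e
      · exact nhdsWithin_le_nhds (hy hyx)
    symm
    refine Tendsto.limUnder_eq (Tendsto.congr' ?_ (hgy.tendsto.mono_left nhdsWithin_le_nhds))
    exact hlim.mono fun t ht => ht.symm
  · exact (hc.tendsto.mono_left nhdsWithin_le_nhds).limUnder_eq

/-- The integral along the circle `|w| = ρ`, as a continuous functional. -/
def circleFunctional (ρ : ℝ) (hρ : 0 ≤ ρ) : C(Metric.sphere (0 : ℂ) ρ, ℂ) →L[ℂ] ℂ :=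
  LinearMap.mkContinuous
    { toFun := fun φ => ∫ θ in (0 : ℝ)..2 * Real.pi,
        deriv (circleMap 0 ρ) θ * φ ⟨circleMap 0 ρ θ, circleMap_mem_sphere 0 hρ θ⟩
      map_add' := fun φ ψ => by
        rw [← intervalIntegral.integral_add]
        · simp [mul_add]
        all_goals
          refine Continuous.intervalIntegrable ?_ _ _
          simp only [deriv_circleMap]
          fun_prop
      map_smul' := fun c φ => by
        simp only [ContinuousMap.smul_apply, smul_eq_mul, RingHom.id_apply]
        rw [← intervalIntegral.integral_const_mul]
        congr 1
        ext θ
        ring }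
    (ρ * |2 * Real.pi - 0|) (fun φ => by
      have := intervalIntegral.norm_integral_le_of_norm_le_const (a := 0) (b := 2 * Real.pi)
        (C := ρ * ‖φ‖) (f := fun θ =>
        deriv (circleMap 0 ρ) θ * φ ⟨circleMap 0 ρ θ, circleMap_mem_sphere 0 hρ θ⟩) (by
          intro θ _
          rw [norm_mul]
          have h2 : ‖deriv (circleMap 0 ρ) θ‖ = ρ := by
            simp [deriv_circleMap, abs_of_nonneg hρ]
          rw [h2]
          gcongr
          exact φ.norm_coe_le_norm _)
      refine this.trans (le_of_eq ?_)
      ring)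

theorem circleFunctional_apply {ρ : ℝ} (hρ : 0 ≤ ρ) (φ : C(Metric.sphere (0 : ℂ) ρ, ℂ)) :
    circleFunctional ρ hρ φ = ∫ θ in (0 : ℝ)..2 * Real.pi,
      deriv (circleMap 0 ρ) θ * φ ⟨circleMap 0 ρ θ, circleMap_mem_sphere 0 hρ θ⟩ := rfl

/-- Hartogs' principle on a bidisc: let `F t₁` be a family of functions on the circle `|t₂| = ρ`
which is analytic in `t₁`. Then the Cauchy integrals of `F t₁` form a jointly analytic function,
which is equal to `G t₂` as soon as `F t₁` extends to a holomorphic function `G` on the disc. -/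
theorem exists_analyticAt_cauchyIntegral {ρ : ℝ} (hρ : 0 < ρ)
    {F : ℂ → C(Metric.sphere (0 : ℂ) ρ, ℂ)} (hF : AnalyticAt ℂ F 0) :
    ∃ H : ℂ × ℂ → ℂ, AnalyticAt ℂ H (0, 0) ∧ ∀ t₁ t₂ : ℂ, ‖t₂‖ < ρ → ∀ G : ℂ → ℂ,
      (∀ x ∈ Metric.closedBall (0 : ℂ) ρ, AnalyticAt ℂ G x) →
      (∀ w : Metric.sphere (0 : ℂ) ρ, F t₁ w = G w) → H (t₁, t₂) = G t₂ := by
  let ι : C(Metric.sphere (0 : ℂ) ρ, ℂ) := ⟨fun w => (w : ℂ), continuous_subtype_val⟩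
  let K : ℂ → C(Metric.sphere (0 : ℂ) ρ, ℂ) := fun t => ι - algebraMap ℂ _ t
  have hunit : ∀ t : ℂ, ‖t‖ < ρ → IsUnit (K t) := by
    intro t ht
    rw [ContinuousMap.isUnit_iff_forall_ne_zero]
    intro w
    have hw : ‖(w : ℂ)‖ = ρ := by simp
    simp only [K, ι, ContinuousMap.sub_apply, ContinuousMap.coe_mk]
    intro h0
    have : (w : ℂ) = t := by simpa [sub_eq_zero] using h0
    rw [this] at hw
    exact ht.ne hw
  refine ⟨fun t => (2 * Real.pi * Complex.I)⁻¹ *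
    circleFunctional ρ hρ.le (Ring.inverse (K t.2) * F t.1), ?_, ?_⟩
  · have hK : AnalyticAt ℂ (fun t : ℂ × ℂ => Ring.inverse (K t.2)) (0, 0) := by
      have h0 : AnalyticAt ℂ Ring.inverse (K ((0, 0) : ℂ × ℂ).2) := by
        obtain ⟨z, hz⟩ := hunit 0 (by simp [hρ])
        show AnalyticAt ℂ Ring.inverse (K 0)
        rw [← hz]
        exact analyticAt_inverse z
      refine h0.fun_comp (f := fun t : ℂ × ℂ => K t.2) ?_
      refine analyticAt_const.sub ?_
      exact ((Algebra.linearMap ℂ C(Metric.sphere (0 : ℂ) ρ, ℂ)).toContinuousLinearMap.analyticAt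
        _).fun_comp analyticAt_snd
    have hF' : AnalyticAt ℂ (fun t : ℂ × ℂ => F t.1) (0, 0) :=
      AnalyticAt.fun_comp (g := F) (f := Prod.fst) hF analyticAt_fst
    exact analyticAt_const.mul (((circleFunctional ρ hρ.le).analyticAt _).fun_comp (hK.mul hF'))
  · intro t₁ t₂ ht G hG hFG
    have hd : DiffContOnCl ℂ G (Metric.ball 0 ρ) := by
      refine DifferentiableOn.diffContOnCl ?_
      rw [closure_ball _ hρ.ne']
      exact fun x hx => (hG x hx).differentiableAt.differentiableWithinAt
    have hint : circleFunctional ρ hρ.le (Ring.inverse (K t₂) * F t₁) =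
        ∮ w in C(0, ρ), (w - t₂)⁻¹ • G w := by
      rw [circleFunctional_apply, circleIntegral]
      refine intervalIntegral.integral_congr fun θ _ => ?_
      have h1 := Ring.inverse_mul_cancel _ (hunit t₂ ht)
      have h2 := DFunLike.congr_fun h1 ⟨circleMap 0 ρ θ, circleMap_mem_sphere 0 hρ.le θ⟩
      have h3 := eq_inv_of_mul_eq_one_left h2
      simp only [ContinuousMap.mul_apply, smul_eq_mul, hFG, h3]
      rfl
    rw [← hd.two_pi_i_inv_smul_circleIntegral_sub_inv_smul (w := t₂) (by simpa using ht),
      smul_eq_mul, ← hint]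

variable {r s : ℕ} {b : Fin (s + r) → ℂ}

/-! ### The monomials `φ̂_i` -/

theorem mod_three_ne_zero (h3 : Nat.Coprime 3 (2 * r + s)) : (2 * r + s) % 3 ≠ 0 := by
  rw [Nat.Prime.coprime_iff_not_dvd Nat.prime_three] at h3
  omega

theorem infinite_isHatWeight : (Set.ofPred (IsHatWeight r s)).Infinite :=
  Set.infinite_of_injective_forall_mem (f := fun a : ℕ => 3 * a + (2 * r + s))
    (fun a a' h => by simpa using h) fun a => ⟨a, Or.inl rfl⟩

open Classical in
/-- There are `g` monomials of weight at most `3 (r + s) - 4`. -/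
theorem count_isHatWeight (h3 : Nat.Coprime 3 (2 * r + s)) :
    Nat.count (IsHatWeight r s) (3 * (r + s) - 3) = genus r s := by
  have hm := mod_three_ne_zero h3
  have hset : (Finset.range (3 * (r + s) - 3)).filter (IsHatWeight r s) =
      (Finset.range ((2 * s + r - 1) / 3)).image (fun a => 3 * a + (2 * r + s)) ∪
        (Finset.range ((2 * r + s - 1) / 3)).image (fun a => 3 * a + (2 * s + r)) := by
    ext n
    simp only [Finset.mem_filter, Finset.mem_range, Finset.mem_union, Finset.mem_image,
      IsHatWeight]
    constructor
    · rintro ⟨hn, a, h | h | h⟩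
      · exact Or.inl ⟨a, by omega, h.symm⟩
      · exact Or.inr ⟨a, by omega, h.symm⟩
      · omega
    · rintro (⟨a, ha, rfl⟩ | ⟨a, ha, rfl⟩)
      · exact ⟨by omega, a, Or.inl rfl⟩
      · exact ⟨by omega, a, Or.inr (Or.inl rfl)⟩
  rw [Nat.count_eq_card_filter_range, hset, Finset.card_union_of_disjoint,
    Finset.card_image_of_injective _ (fun a a' h => by simpa using h),
    Finset.card_image_of_injective _ (fun a a' h => by simpa using h), Finset.card_range,
    Finset.card_range, genus]
  · have h1 : (2 * r + s) % 3 = 1 ∨ (2 * r + s) % 3 = 2 := by omega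
    rcases h1 with h1 | h1
    · have h2 : (2 * s + r) % 3 = 2 := by omega
      omega
    · have h2 : (2 * s + r) % 3 = 1 := by omega
      omega
  · rw [Finset.disjoint_left]
    simp only [Finset.mem_image, Finset.mem_range]
    rintro n ⟨a, -, rfl⟩ ⟨a', -, h⟩
    omega

/-- The weights of `φ̂_0, …, φ̂_{g-1}` are at most `3 (r + s) - 4`, so that these monomials are the
`x^a y_r̂` with `3 a + 4 ≤ ŝ` and the `x^a y_ŝ` with `3 a + 4 ≤ r̂`. -/
theorem nth_isHatWeight_cases (h3 : Nat.Coprime 3 (2 * r + s)) (i : Fin (genus r s)) :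
    (∃ a, 3 * a + 4 ≤ 2 * s + r ∧ Nat.nth (IsHatWeight r s) i = 3 * a + (2 * r + s)) ∨
      ∃ a, 3 * a + 4 ≤ 2 * r + s ∧ Nat.nth (IsHatWeight r s) i = 3 * a + (2 * s + r) := by
  classical
  have h1 : Nat.nth (IsHatWeight r s) i < 3 * (r + s) - 3 :=
    Nat.nth_lt_of_lt_count (by rw [count_isHatWeight h3]; exact i.2)
  obtain ⟨a, h | h | h⟩ := Nat.nth_mem_of_infinite (infinite_isHatWeight (r := r) (s := s)) i
  · exact Or.inl ⟨a, by omega, h⟩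
  · exact Or.inr ⟨a, by omega, h⟩
  · omega

theorem exists_nth_eq (h3 : Nat.Coprime 3 (2 * r + s)) {n : ℕ} (hn : IsHatWeight r s n)
    (hlt : n + 4 ≤ 3 * (r + s)) :
    ∃ i : Fin (genus r s), Nat.nth (IsHatWeight r s) i = n := by
  classical
  refine ⟨⟨Nat.count (IsHatWeight r s) n, ?_⟩, Nat.nth_count hn⟩
  rw [← count_isHatWeight h3]
  exact Nat.count_strict_mono hn (by omega)

theorem evalAt_mk (P : Affine b) (p : MvPolynomial (Fin 3) ℂ) :
    evalAt P (Ideal.Quotient.mk (relIdeal b) p) = MvPolynomial.aeval ![P.x, P.yr, P.ys] p := rfl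

theorem evalAt_phiHat_of_weight_r {i a : ℕ}
    (h : Nat.nth (IsHatWeight r s) i = 3 * a + (2 * r + s)) (P : Affine b) :
    evalAt P (phiHat b i) = P.x ^ a * P.yr := by
  have e : (3 * a + (2 * r + s) - (2 * r + s)) / 3 = a := by omega
  simp only [phiHat, h]
  rw [if_pos (by omega), evalAt_mk, e]
  simp

theorem evalAt_phiHat_of_weight_s (h3 : Nat.Coprime 3 (2 * r + s)) {i a : ℕ}
    (h : Nat.nth (IsHatWeight r s) i = 3 * a + (2 * s + r)) (P : Affine b) :
    evalAt P (phiHat b i) = P.x ^ a * P.ys := by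
  have hm := mod_three_ne_zero h3
  have e : (3 * a + (2 * s + r) - (2 * s + r)) / 3 = a := by omega
  simp only [phiHat, h]
  rw [if_neg (by omega), if_pos (by omega), evalAt_mk, e]
  simp

/-- `ν^I_i` is `x^a dx / (3 y_ŝ)` with `3 a + 4 ≤ ŝ` or `x^a dx / (3 y_r̂)` with `3 a + 4 ≤ r̂`. -/
theorem nuI_cases (h3 : Nat.Coprime 3 (2 * r + s)) (b : Fin (s + r) → ℂ) (i : Fin (genus r s)) :
    (∃ a, 3 * a + 4 ≤ 2 * s + r ∧
        ∀ P : Affine b, nuI i P = P.x ^ a * P.yr / (3 * (P.yr * P.ys))) ∨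
      ∃ a, 3 * a + 4 ≤ 2 * r + s ∧
        ∀ P : Affine b, nuI i P = P.x ^ a * P.ys / (3 * (P.yr * P.ys)) := by
  rcases nth_isHatWeight_cases h3 i with ⟨a, ha, h⟩ | ⟨a, ha, h⟩
  · exact Or.inl ⟨a, ha, fun P => by rw [nuI, evalAt_phiHat_of_weight_r h]⟩
  · exact Or.inr ⟨a, ha, fun P => by rw [nuI, evalAt_phiHat_of_weight_s h3 h]⟩

theorem exists_nuI_r (h3 : Nat.Coprime 3 (2 * r + s)) (b : Fin (s + r) → ℂ) {a : ℕ}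
    (ha : 3 * a + 4 ≤ 2 * s + r) :
    ∃ i : Fin (genus r s), ∀ P : Affine b, nuI i P = P.x ^ a * P.yr / (3 * (P.yr * P.ys)) := by
  obtain ⟨i, hi⟩ := exists_nth_eq h3 (n := 3 * a + (2 * r + s)) ⟨a, Or.inl rfl⟩ (by omega)
  exact ⟨i, fun P => by rw [nuI, evalAt_phiHat_of_weight_r hi]⟩

theorem exists_nuI_s (h3 : Nat.Coprime 3 (2 * r + s)) (b : Fin (s + r) → ℂ) {a : ℕ}
    (ha : 3 * a + 4 ≤ 2 * r + s) :
    ∃ i : Fin (genus r s), ∀ P : Affine b, nuI i P = P.x ^ a * P.ys / (3 * (P.yr * P.ys)) := by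
  obtain ⟨i, hi⟩ := exists_nth_eq h3 (n := 3 * a + (2 * s + r)) ⟨a, Or.inr (Or.inl rfl)⟩ (by omega)
  exact ⟨i, fun P => by rw [nuI, evalAt_phiHat_of_weight_s h3 hi]⟩

/-! ### Points of the affine curve -/

theorem Affine.ext_coords {P Q : Affine b} (hx : P.x = Q.x) (hr : P.yr = Q.yr)
    (hs : P.ys = Q.ys) : P = Q :=
  Subtype.ext (Prod.ext hx (Prod.ext hr hs))

theorem Affine.yr_sq (P : Affine b) : P.yr ^ 2 = P.ys * (kr b).eval P.x := P.2.1

theorem Affine.yr_mul_ys (P : Affine b) :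
    P.yr * P.ys = (kr b).eval P.x * (ks b).eval P.x := P.2.2.1

theorem Affine.ys_sq (P : Affine b) : P.ys ^ 2 = P.yr * (ks b).eval P.x := P.2.2.2

/-- The affine plane model `u³ = A² B` of a curve `u² = v A`, `u v = A B`, `v² = u B`. -/
theorem cube_eq {u v A B : ℂ} (h1 : u ^ 2 = v * A) (h2 : u * v = A * B) : u ^ 3 = A ^ 2 * B := by
  linear_combination u * h1 + A * h2

theorem Affine.yr_cube (P : Affine b) :
    P.yr ^ 3 = (kr b).eval P.x ^ 2 * (ks b).eval P.x := cube_eq P.yr_sq P.yr_mul_ys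

theorem Affine.continuous_x : Continuous (Affine.x : Affine b → ℂ) :=
  continuous_fst.comp continuous_subtype_val

theorem Affine.continuous_yr : Continuous (Affine.yr : Affine b → ℂ) :=
  (continuous_fst.comp continuous_snd).comp continuous_subtype_val

theorem Affine.continuous_ys : Continuous (Affine.ys : Affine b → ℂ) :=
  (continuous_snd.comp continuous_snd).comp continuous_subtype_val

theorem kr_eval_ne_zero {P : Affine b} (h : P.yr * P.ys ≠ 0) : (kr b).eval P.x ≠ 0 := by
  rw [P.yr_mul_ys] at h
  exact left_ne_zero_of_mul h

theorem ks_eval_ne_zero {P : Affine b} (h : P.yr * P.ys ≠ 0) : (ks b).eval P.x ≠ 0 := by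
  rw [P.yr_mul_ys] at h
  exact right_ne_zero_of_mul h

theorem prod_X_sub_C_eval_deriv_ne_zero {n : ℕ} {c : Fin n → ℂ} (hc : Function.Injective c) {x : ℂ}
    (hx : (∏ i, (Polynomial.X - Polynomial.C (c i))).eval x = 0) :
    (∏ i, (Polynomial.X - Polynomial.C (c i))).derivative.eval x ≠ 0 := by
  have hsep : (∏ i, (Polynomial.X - Polynomial.C (c i))).Separable :=
    Polynomial.separable_prod_X_sub_C_iff.2 hc
  have := hsep.aeval_derivative_ne_zero (x := x)
    (by rwa [Polynomial.coe_aeval_eq_eval])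
  rwa [Polynomial.coe_aeval_eq_eval] at this

theorem ks_simple_root (hb : Function.Injective b) {x : ℂ} (hx : (ks b).eval x = 0) :
    (ks b).derivative.eval x ≠ 0 :=
  prod_X_sub_C_eval_deriv_ne_zero (hb.comp (Fin.castAdd_injective s r)) hx

theorem kr_simple_root (hb : Function.Injective b) {x : ℂ} (hx : (kr b).eval x = 0) :
    (kr b).derivative.eval x ≠ 0 :=
  prod_X_sub_C_eval_deriv_ne_zero (hb.comp (Fin.natAdd_injective r s)) hx

theorem kr_ks_no_common_root (hb : Function.Injective b) {x : ℂ} (hr : (kr b).eval x = 0) :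
    (ks b).eval x ≠ 0 := by
  intro hs
  rw [kr, Polynomial.eval_prod, Finset.prod_eq_zero_iff] at hr
  rw [ks, Polynomial.eval_prod, Finset.prod_eq_zero_iff] at hs
  obtain ⟨i, -, hi⟩ := hr
  obtain ⟨j, -, hj⟩ := hs
  simp only [Polynomial.eval_sub, Polynomial.eval_X, Polynomial.eval_C, sub_eq_zero] at hi hj
  have := congrArg Fin.val (hb (hi.symm.trans hj))
  simp at this
  omega

theorem kr_monic : (kr b).Monic := Polynomial.monic_prod_of_monic _ _ fun _ _ =>
  Polynomial.monic_X_sub_C _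

theorem ks_monic : (ks b).Monic := Polynomial.monic_prod_of_monic _ _ fun _ _ =>
  Polynomial.monic_X_sub_C _

theorem kr_natDegree : (kr b).natDegree = r := by
  rw [kr, Polynomial.natDegree_prod_of_monic _ _ fun _ _ => Polynomial.monic_X_sub_C _]
  simp

theorem ks_natDegree : (ks b).natDegree = s := by
  rw [ks, Polynomial.natDegree_prod_of_monic _ _ fun _ _ => Polynomial.monic_X_sub_C _]
  simp

/-- There is a point of the curve over every `x` with `k_r(x) k_s(x) ≠ 0`; it can be chosen with
any prescribed cube root of `k_r(x)² k_s(x)` as its `y_r̂`. -/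
theorem exists_affine {x u : ℂ} (hA : (kr b).eval x ≠ 0)
    (hu : u ^ 3 = (kr b).eval x ^ 2 * (ks b).eval x) :
    ∃ P : Affine b, P.x = x ∧ P.yr = u ∧ P.ys = u ^ 2 / (kr b).eval x := by
  refine ⟨⟨(x, u, u ^ 2 / (kr b).eval x), ?_, ?_, ?_⟩, rfl, rfl, rfl⟩
  · simp only
    field_simp
  · simp only
    field_simp
    linear_combination hu
  · simp only
    field_simp
    linear_combination u * hu

/-! ### The derivative of `Σ(P, Q)` -/

/-- `3 k_r k_s` times the logarithmic derivative of `y_r̂` with respect to `x`. -/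
def logNumR (b : Fin (s + r) → ℂ) : Polynomial ℂ :=
  2 * (kr b).derivative * ks b + kr b * (ks b).derivative

/-- `3 k_r k_s` times the logarithmic derivative of `y_ŝ` with respect to `x`. -/
def logNumS (b : Fin (s + r) → ℂ) : Polynomial ℂ :=
  (kr b).derivative * ks b + 2 * kr b * (ks b).derivative

/-- The numerator of the coefficient of `d_Q Σ(P, Q)`. -/
def dSigmaNum (P Q : Affine b) : ℂ :=
  3 * (P.yr * P.ys) * (Q.yr * Q.ys) +
    P.yr * Q.ys * ((P.x - Q.x) * (logNumS b).eval Q.x + 3 * (kr b * ks b).eval Q.x) +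
    P.ys * Q.yr * ((P.x - Q.x) * (logNumR b).eval Q.x + 3 * (kr b * ks b).eval Q.x)

/-- Near a point which is not a branch point, the coordinate `x` separates points. -/
theorem eventually_x_ne {Q : Affine b} (hQ : Q.yr * Q.ys ≠ 0) :
    ∀ᶠ Q' in 𝓝[≠] Q, Q'.x ≠ Q.x := by
  have hu : Q.yr ≠ 0 := left_ne_zero_of_mul hQ
  have h1 : ∀ᶠ Q' in 𝓝 Q, Q'.yr ^ 2 + Q'.yr * Q.yr + Q.yr ^ 2 ≠ 0 := by
    have hc : Continuous fun Q' : Affine b => Q'.yr ^ 2 + Q'.yr * Q.yr + Q.yr ^ 2 := by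
      have := Affine.continuous_yr (b := b)
      fun_prop
    refine hc.continuousAt.eventually_ne ?_
    have : Q.yr ^ 2 + Q.yr * Q.yr + Q.yr ^ 2 = 3 * Q.yr ^ 2 := by ring
    rw [this]
    exact mul_ne_zero (by norm_num) (pow_ne_zero _ hu)
  filter_upwards [nhdsWithin_le_nhds h1, self_mem_nhdsWithin] with Q' h1 hne hx
  refine hne ?_
  have h3 : (Q'.yr - Q.yr) * (Q'.yr ^ 2 + Q'.yr * Q.yr + Q.yr ^ 2) = 0 := by
    have h4 := Q'.yr_cube
    rw [hx, ← Q.yr_cube] at h4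
    linear_combination h4
  have hr : Q'.yr = Q.yr := by
    rcases mul_eq_zero.1 h3 with h | h
    · exact sub_eq_zero.1 h
    · exact absurd h h1
  have hs : Q'.ys = Q.ys := by
    have h4 := Q'.yr_mul_ys
    rw [hx, ← Q.yr_mul_ys, hr] at h4
    exact mul_left_cancel₀ hu h4
  exact Affine.ext_coords hx hr hs

/-- Points which are not branch points are not isolated. -/
theorem nhdsNE_neBot {Q : Affine b} (hQ : Q.yr * Q.ys ≠ 0) : (𝓝[≠] Q).NeBot := by
  have hA := kr_eval_ne_zero hQ
  have hB := ks_eval_ne_zero hQ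
  let f : ℂ → ℂ := fun x => (kr b).eval x ^ 2 * (ks b).eval x
  have hfc : Continuous f := by fun_prop
  let U : ℂ → ℂ := fun x => Q.yr * (f x / f Q.x) ^ ((3 : ℕ) : ℂ)⁻¹
  have hf : f Q.x ≠ 0 := mul_ne_zero (pow_ne_zero _ hA) hB
  have hU0 : U Q.x = Q.yr := by simp [U, hf]
  have hUc : ContinuousAt U Q.x := by
    refine continuousAt_const.mul (ContinuousAt.cpow (by fun_prop) continuousAt_const ?_)
    rw [div_self hf]
    exact Complex.one_mem_slitPlane
  have hU3 : ∀ x, U x ^ 3 = f x := by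
    intro x
    simp only [U, mul_pow]
    rw [Complex.cpow_nat_inv_pow _ (by norm_num), Q.yr_cube]
    exact mul_div_cancel₀ _ hf
  have hex : ∀ x, ∃ P : Affine b, (kr b).eval x ≠ 0 →
      P.x = x ∧ P.yr = U x ∧ P.ys = U x ^ 2 / (kr b).eval x := by
    intro x
    by_cases h : (kr b).eval x = 0
    · exact ⟨Q, fun h' => absurd h h'⟩
    · obtain ⟨P, hP⟩ := exists_affine h (hU3 x)
      exact ⟨P, fun _ => hP⟩
  choose p hp using hex
  have hev : ∀ᶠ x in 𝓝 Q.x, (kr b).eval x ≠ 0 :=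
    ((kr b).continuous.continuousAt).eventually_ne hA
  have hp0 : p Q.x = Q := by
    obtain ⟨h1, h2, h3⟩ := hp Q.x hA
    refine Affine.ext_coords h1 (h2.trans hU0) (h3.trans ?_)
    rw [hU0, Q.yr_sq]
    field_simp
  have hpc : Tendsto p (𝓝 Q.x) (𝓝 Q) := by
    rw [tendsto_subtype_rng]
    have h2 : Tendsto (fun x => ((x, U x, U x ^ 2 / (kr b).eval x) : ℂ × ℂ × ℂ)) (𝓝 Q.x)
        (𝓝 (Q.x, U Q.x, U Q.x ^ 2 / (kr b).eval Q.x)) := by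
      refine tendsto_id.prodMk_nhds (hUc.tendsto.prodMk_nhds ?_)
      exact (hUc.tendsto.pow 2).div (kr b).continuous.continuousAt.tendsto hA
    have h3 : (Q.x, U Q.x, U Q.x ^ 2 / (kr b).eval Q.x) = (Q : ℂ × ℂ × ℂ) := by
      obtain ⟨h1, h2, h3⟩ := hp Q.x hA
      rw [← h3, ← h2, hp0]
      rfl
    rw [h3] at h2
    refine h2.congr' ?_
    filter_upwards [hev] with x hx
    obtain ⟨h1, h2, h3⟩ := hp x hx
    exact Prod.ext h1.symm (Prod.ext h2.symm h3.symm)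
  have hpne : Tendsto p (𝓝[≠] Q.x) (𝓝[≠] Q) := by
    refine tendsto_nhdsWithin_iff.2 ⟨hpc.mono_left nhdsWithin_le_nhds, ?_⟩
    filter_upwards [nhdsWithin_le_nhds hev, self_mem_nhdsWithin] with x hx hne heq
    refine hne ?_
    have h1 := (hp x hx).1
    have h2 : p x = Q := heq
    rw [h2] at h1
    exact h1.symm
  exact hpne.neBot

theorem hasXDerivAt_polynomial (p : Polynomial ℂ) {Q : Affine b} (hQ : Q.yr * Q.ys ≠ 0) :
    HasXDerivAt (fun Q' => p.eval Q'.x) Q (p.derivative.eval Q.x) := by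
  have h := (hasDerivAt_iff_tendsto_slope.1 (p.hasDerivAt Q.x))
  have hx : Tendsto (fun Q' : Affine b => Q'.x) (𝓝[≠] Q) (𝓝[≠] Q.x) :=
    tendsto_nhdsWithin_iff.2 ⟨(Affine.continuous_x.tendsto Q).mono_left nhdsWithin_le_nhds,
      eventually_x_ne hQ⟩
  refine (h.comp hx).congr fun Q' => ?_
  simp [slope_def_field]

theorem hasXDerivAt_yr {Q : Affine b} (hQ : Q.yr * Q.ys ≠ 0) :
    HasXDerivAt (fun Q' => Q'.yr) Q
      (Q.yr * (logNumR b).eval Q.x / (3 * (kr b * ks b).eval Q.x)) := by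
  have hA := kr_eval_ne_zero hQ
  have hB := ks_eval_ne_zero hQ
  have hu : Q.yr ≠ 0 := left_ne_zero_of_mul hQ
  have hp := hasXDerivAt_polynomial (kr b ^ 2 * ks b) hQ
  have hq : Tendsto (fun Q' : Affine b => Q'.yr ^ 2 + Q'.yr * Q.yr + Q.yr ^ 2) (𝓝[≠] Q)
      (𝓝 (3 * Q.yr ^ 2)) := by
    have hc : Continuous fun Q' : Affine b => Q'.yr ^ 2 + Q'.yr * Q.yr + Q.yr ^ 2 := by
      have := Affine.continuous_yr (b := b)
      fun_prop
    have := hc.tendsto Q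
    rw [show Q.yr ^ 2 + Q.yr * Q.yr + Q.yr ^ 2 = 3 * Q.yr ^ 2 by ring] at this
    exact this.mono_left nhdsWithin_le_nhds
  have h0 : 3 * Q.yr ^ 2 ≠ 0 := mul_ne_zero (by norm_num) (pow_ne_zero _ hu)
  have := hp.div hq h0
  have hval : (kr b ^ 2 * ks b).derivative.eval Q.x / (3 * Q.yr ^ 2) =
      Q.yr * (logNumR b).eval Q.x / (3 * (kr b * ks b).eval Q.x) := by
    have h3 := Q.yr_cube
    simp only [logNumR, Polynomial.derivative_mul, Polynomial.derivative_pow, Polynomial.eval_mul,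
      Polynomial.eval_add, Polynomial.eval_pow, Polynomial.eval_C, Polynomial.eval_ofNat] at h3 ⊢
    rw [div_eq_div_iff h0 (by simp [hA, hB])]
    have h4 : Q.yr * (2 * (kr b).derivative.eval Q.x * (ks b).eval Q.x +
        (kr b).eval Q.x * (ks b).derivative.eval Q.x) * (3 * Q.yr ^ 2) =
        3 * Q.yr ^ 3 * (2 * (kr b).derivative.eval Q.x * (ks b).eval Q.x +
        (kr b).eval Q.x * (ks b).derivative.eval Q.x) := by ring
    rw [h4, h3]
    simp
    ring
  rw [hval] at this
  refine this.congr' ?_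
  filter_upwards [hq.eventually_ne h0, eventually_x_ne hQ] with Q' h1 h2
  have h2 : Q'.x - Q.x ≠ 0 := sub_ne_zero.2 h2
  simp only [Polynomial.eval_mul, Polynomial.eval_pow, Pi.div_apply]
  rw [← Q.yr_cube, ← Q'.yr_cube, div_div, div_eq_div_iff (mul_ne_zero h2 h1) h2]
  ring

theorem hasXDerivAt_ys {Q : Affine b} (hQ : Q.yr * Q.ys ≠ 0) :
    HasXDerivAt (fun Q' => Q'.ys) Q
      (Q.ys * (logNumS b).eval Q.x / (3 * (kr b * ks b).eval Q.x)) := by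
  have hA := kr_eval_ne_zero hQ
  have hB := ks_eval_ne_zero hQ
  have hu : Q.yr ≠ 0 := left_ne_zero_of_mul hQ
  have hp := hasXDerivAt_polynomial (kr b * ks b) hQ
  have hyr := hasXDerivAt_yr hQ
  have hc : Tendsto (fun Q' : Affine b => Q'.yr) (𝓝[≠] Q) (𝓝 Q.yr) :=
    (Affine.continuous_yr.tendsto Q).mono_left nhdsWithin_le_nhds
  have := (hp.sub (hyr.const_mul Q.ys)).div hc hu
  have hval : ((kr b * ks b).derivative.eval Q.x -
      Q.ys * (Q.yr * (logNumR b).eval Q.x / (3 * (kr b * ks b).eval Q.x))) / Q.yr =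
      Q.ys * (logNumS b).eval Q.x / (3 * (kr b * ks b).eval Q.x) := by
    have h3 := Q.yr_mul_ys
    simp only [logNumR, logNumS, Polynomial.derivative_mul, Polynomial.eval_mul,
      Polynomial.eval_add, Polynomial.eval_ofNat]
    field_simp
    linear_combination (-3 * ((kr b).derivative.eval Q.x * (ks b).eval Q.x +
        (kr b).eval Q.x * (ks b).derivative.eval Q.x)) * h3
  rw [hval] at this
  refine this.congr' ?_
  filter_upwards [hc.eventually_ne hu, eventually_x_ne hQ] with Q' h1 h2
  have h2 : Q'.x - Q.x ≠ 0 := sub_ne_zero.2 h2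
  simp only [Polynomial.eval_mul, Pi.div_apply]
  rw [← Q.yr_mul_ys, ← Q'.yr_mul_ys]
  field_simp
  ring

theorem hasXDerivAt_sigma {P Q : Affine b} (h : Generic P Q) :
    HasXDerivAt (fun Q' => sigma P Q') Q
      (dSigmaNum P Q / (9 * (P.x - Q.x) ^ 2 * (P.yr * P.ys) * (Q.yr * Q.ys))) := by
  obtain ⟨hP, hQ, hne⟩ := h
  have hx : P.x - Q.x ≠ 0 := sub_ne_zero.2 hne
  have hAB : 3 * (kr b * ks b).eval Q.x ≠ 0 := by
    rw [Polynomial.eval_mul, ← Q.yr_mul_ys]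
    exact mul_ne_zero (by norm_num) hQ
  have hcx : Tendsto (fun Q' : Affine b => P.x - Q'.x) (𝓝[≠] Q) (𝓝 (P.x - Q.x)) :=
    ((continuous_const.sub Affine.continuous_x).tendsto Q).mono_left nhdsWithin_le_nhds
  have hn := ((hasXDerivAt_ys hQ).const_mul P.yr).add ((hasXDerivAt_yr hQ).mul_const P.ys)
  have := ((hn.mul_const (P.x - Q.x)).add_const
    (P.yr * P.ys + P.yr * Q.ys + Q.yr * P.ys)).div
    ((hcx.mul_const (P.x - Q.x)).const_mul (3 * (P.yr * P.ys)))
    (mul_ne_zero (mul_ne_zero (by norm_num) hP) (mul_ne_zero hx hx))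
  have hval : ((P.yr * (Q.ys * (logNumS b).eval Q.x / (3 * (kr b * ks b).eval Q.x)) +
      Q.yr * (logNumR b).eval Q.x / (3 * (kr b * ks b).eval Q.x) * P.ys) * (P.x - Q.x) +
      (P.yr * P.ys + P.yr * Q.ys + Q.yr * P.ys)) /
      (3 * (P.yr * P.ys) * ((P.x - Q.x) * (P.x - Q.x))) =
      dSigmaNum P Q / (9 * (P.x - Q.x) ^ 2 * (P.yr * P.ys) * (Q.yr * Q.ys)) := by
    have hPr := left_ne_zero_of_mul hP
    have hPs := right_ne_zero_of_mul hP
    have hQr := left_ne_zero_of_mul hQ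
    have hQs := right_ne_zero_of_mul hQ
    have hAB' : (kr b * ks b).eval Q.x = Q.yr * Q.ys := by
      rw [Polynomial.eval_mul, Q.yr_mul_ys]
    simp only [dSigmaNum, hAB']
    field_simp
    ring
  rw [hval] at this
  refine this.congr' ?_
  filter_upwards [hcx.eventually_ne hx, eventually_x_ne hQ] with Q' h1 h2
  have h2 : Q'.x - Q.x ≠ 0 := sub_ne_zero.2 h2
  have hPr := left_ne_zero_of_mul hP
  have hPs := right_ne_zero_of_mul hP
  simp only [sigma, Pi.div_apply]
  field_simp
  ring

theorem dSigma_eq {P Q : Affine b} (h : Generic P Q) :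
    dSigma P Q = dSigmaNum P Q / (9 * (P.x - Q.x) ^ 2 * (P.yr * P.ys) * (Q.yr * Q.ys)) := by
  have := nhdsNE_neBot h.2.1
  exact (hasXDerivAt_sigma h).limUnder_eq

theorem hasXDerivAt_dSigma {P Q : Affine b} (h : Generic P Q) :
    HasXDerivAt (fun Q' => sigma P Q') Q (dSigma P Q) := by
  rw [dSigma_eq h]
  exact hasXDerivAt_sigma h

/-! ### The shape of a local parameter: germs at affine points and at `∞` -/

theorem AnalyticAt.eval_polynomial (p : Polynomial ℂ) {X : ℂ → ℂ} {t : ℂ} (hX : AnalyticAt ℂ X t) :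
    AnalyticAt ℂ (fun t => p.eval (X t)) t := by
  have := hX.aeval_polynomial p
  simpa only [Polynomial.coe_aeval_eq_eval] using this

theorem MeromorphicAt.eval_polynomial (p : Polynomial ℂ) {X : ℂ → ℂ} {t : ℂ}
    (hX : MeromorphicAt X t) : MeromorphicAt (fun t => p.eval (X t)) t := by
  simp only [Polynomial.eval_eq_sum_range]
  refine MeromorphicAt.fun_sum fun i _ => ?_
  exact (MeromorphicAt.const _ _).mul (hX.pow i)

theorem exists_eq_sub_mul_of_eq_zero {U : ℂ → ℂ} {x : ℂ} (hU : AnalyticAt ℂ U x) (h0 : U x = 0) :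
    ∃ k : ℂ → ℂ, AnalyticAt ℂ k x ∧ k x = deriv U x ∧ ∀ t, U t = (t - x) * k t := by
  obtain ⟨p, hp⟩ := hU
  refine ⟨dslope U x, (hp.has_fpower_series_dslope_fslope).analyticAt, dslope_same _ _, ?_⟩
  intro t
  have := sub_smul_dslope U x t
  rw [h0] at this
  simpa using this.symm

theorem exists_eq_mul_of_eq_zero {U : ℂ → ℂ} (hU : AnalyticAt ℂ U 0) (h0 : U 0 = 0) :
    ∃ k : ℂ → ℂ, AnalyticAt ℂ k 0 ∧ k 0 = deriv U 0 ∧ ∀ t, U t = t * k t := by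
  simpa using exists_eq_sub_mul_of_eq_zero hU h0

theorem deriv_eq_of_eventuallyEq_pow {X g : ℂ → ℂ} {c : ℂ} {n : ℕ} (hg : AnalyticAt ℂ g 0)
    (h : ∀ᶠ t in 𝓝 (0 : ℂ), X t = c + t ^ (n + 1) * g t) :
    ∀ᶠ t in 𝓝 (0 : ℂ), deriv X t = t ^ n * ((n + 1) * g t + t * deriv g t) := by
  filter_upwards [h.eventually_nhds, hg.eventually_analyticAt] with t ht hgt
  have h1 : HasDerivAt (fun t => c + t ^ (n + 1) * g t)
      ((((n + 1 : ℕ) : ℂ) * t ^ n) * g t + t ^ (n + 1) * deriv g t) t :=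
    (((hasDerivAt_pow (n + 1) t).mul hgt.differentiableAt.hasDerivAt)).const_add c
  rw [EventuallyEq.deriv_eq ht, h1.deriv]
  push_cast
  ring

/-- The shape of a local parameter at an affine point: `X'/U` and `X'/V` are holomorphic, and the
logarithmic derivative of `X - X(0)` has a simple pole with residue `e`, the ramification index. -/
structure AffineGerm (X U V : ℂ → ℂ) (e : ℂ) : Prop where
  eventually_ne : ∀ᶠ t in 𝓝[≠] (0 : ℂ), U t ≠ 0 ∧ V t ≠ 0 ∧ deriv X t ≠ 0 ∧ X t ≠ X 0
  removable_U : Removable (fun t => deriv X t / U t) 0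
  removable_V : Removable (fun t => deriv X t / V t) 0
  tendsto : Tendsto (fun t => t * deriv X t / (X t - X 0)) (𝓝[≠] 0) (𝓝 e)

theorem AffineGerm.swap {X U V : ℂ → ℂ} {e : ℂ} (h : AffineGerm X U V e) : AffineGerm X V U e :=
  ⟨h.1.mono fun _ ht => ⟨ht.2.1, ht.1, ht.2.2⟩, h.3, h.2, h.4⟩

/-- At a branch point with `B = 0`, `U` is a local parameter and `X - X(0)` is `U³` times a unit. -/
theorem affineGerm_of_branch {A B : Polynomial ℂ} {X U V : ℂ → ℂ} (hX : AnalyticAt ℂ X 0)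
    (hU : AnalyticAt ℂ U 0) (h1 : ∀ t, U t ^ 2 = V t * A.eval (X t))
    (h2 : ∀ t, U t * V t = A.eval (X t) * B.eval (X t))
    (him : deriv X 0 ≠ 0 ∨ deriv U 0 ≠ 0 ∨ deriv V 0 ≠ 0)
    (hB : B.eval (X 0) = 0) (hB' : B.derivative.eval (X 0) ≠ 0) (hA : A.eval (X 0) ≠ 0) :
    AffineGerm X U V 3 := by
  obtain ⟨B₁, hB₁⟩ : (Polynomial.X - Polynomial.C (X 0)) ∣ B := Polynomial.dvd_iff_isRoot.2 hB
  have hB₁0 : B₁.eval (X 0) ≠ 0 := by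
    rw [hB₁] at hB'
    simpa [Polynomial.derivative_mul] using hB'
  have hU0 : U 0 = 0 := by
    have := cube_eq (h1 0) (h2 0)
    rw [hB, mul_zero] at this
    exact pow_eq_zero_iff (by norm_num) |>.1 this
  obtain ⟨k, hk, hk0, hUk⟩ := exists_eq_mul_of_eq_zero hU hU0
  have hAX := AnalyticAt.eval_polynomial A hX
  have hBX := AnalyticAt.eval_polynomial B₁ hX
  have hAne := hAX.continuousAt.eventually_ne hA
  have hBne := hBX.continuousAt.eventually_ne hB₁0
  have hden : A.eval (X 0) ^ 2 * B₁.eval (X 0) ≠ 0 := mul_ne_zero (pow_ne_zero _ hA) hB₁0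
  have hg : AnalyticAt ℂ (fun t => k t ^ 3 / (A.eval (X t) ^ 2 * B₁.eval (X t))) 0 :=
    (hk.pow 3).div ((hAX.pow 2).mul hBX) hden
  set g : ℂ → ℂ := fun t => k t ^ 3 / (A.eval (X t) ^ 2 * B₁.eval (X t)) with hgdef
  have hXg : ∀ᶠ t in 𝓝 (0 : ℂ), X t = X 0 + t ^ (2 + 1) * g t := by
    filter_upwards [hAne, hBne] with t ha hb
    have h := cube_eq (h1 t) (h2 t)
    rw [hB₁, Polynomial.eval_mul, Polynomial.eval_sub, Polynomial.eval_X, Polynomial.eval_C,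
      hUk] at h
    simp only [hgdef]
    field_simp
    linear_combination -h
  have hV : ∀ᶠ t in 𝓝 (0 : ℂ), V t = 0 + t ^ (1 + 1) * (k t ^ 2 / A.eval (X t)) := by
    filter_upwards [hAne] with t ha
    have h := h1 t
    rw [hUk] at h
    field_simp
    linear_combination -h
  have hX' := deriv_eq_of_eventuallyEq_pow hg hXg
  have hV' := deriv_eq_of_eventuallyEq_pow ((hk.pow 2).div hAX hA) hV
  have hk0' : k 0 ≠ 0 := by
    rw [hk0]
    have e1 := hX'.self_of_nhds
    have e2 := hV'.self_of_nhds
    rcases him with h | h | h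
    · simp [e1] at h
    · exact h
    · simp [e2] at h
  have hg0 : g 0 ≠ 0 := div_ne_zero (pow_ne_zero _ hk0') hden
  have hj : AnalyticAt ℂ (fun t => ((2 : ℕ) + 1) * g t + t * deriv g t) 0 :=
    (analyticAt_const.mul hg).add (analyticAt_id.mul hg.deriv)
  have hj0 : (((2 : ℕ) : ℂ) + 1) * g 0 + 0 * deriv g 0 ≠ 0 := by
    rw [zero_mul, add_zero]
    exact mul_ne_zero (by norm_num) hg0
  have hkne := hk.continuousAt.eventually_ne hk0'
  have hgne := hg.continuousAt.eventually_ne hg0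
  have hjne := hj.continuousAt.eventually_ne hj0
  refine ⟨?_, ?_, ?_, ?_⟩
  · filter_upwards [nhdsWithin_le_nhds hX', nhdsWithin_le_nhds hXg, nhdsWithin_le_nhds hV,
      nhdsWithin_le_nhds hkne, nhdsWithin_le_nhds hgne, nhdsWithin_le_nhds hjne,
      nhdsWithin_le_nhds hAne, self_mem_nhdsWithin] with t e1 e2 e3 n1 n2 n3 n4 (n0 : t ≠ 0)
    refine ⟨?_, ?_, ?_, ?_⟩
    · rw [hUk]; exact mul_ne_zero n0 n1
    · rw [e3, zero_add]
      exact mul_ne_zero (pow_ne_zero _ n0) (div_ne_zero (pow_ne_zero _ n1) n4)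
    · rw [e1]; exact mul_ne_zero (pow_ne_zero _ n0) n3
    · rw [e2]
      simpa using ⟨n0, n2⟩
  · refine ⟨fun t => t * (((2 : ℕ) + 1) * g t + t * deriv g t) / k t,
      (analyticAt_id.mul hj).div hk hk0', ?_⟩
    filter_upwards [nhdsWithin_le_nhds hX', nhdsWithin_le_nhds hkne, self_mem_nhdsWithin] with
      t e1 n1 (n0 : t ≠ 0)
    rw [e1, hUk]
    field_simp
  · refine ⟨fun t => (((2 : ℕ) + 1) * g t + t * deriv g t) * A.eval (X t) / k t ^ 2,
      (hj.mul hAX).div (hk.pow 2) (pow_ne_zero _ hk0'), ?_⟩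
    filter_upwards [nhdsWithin_le_nhds hX', nhdsWithin_le_nhds hV, nhdsWithin_le_nhds hkne,
      nhdsWithin_le_nhds hAne, self_mem_nhdsWithin] with t e1 e2 n1 n2 (n0 : t ≠ 0)
    rw [e1, e2]
    field_simp
    ring
  · have hlim : Tendsto (fun t => (((2 : ℕ) + 1) * g t + t * deriv g t) / g t) (𝓝[≠] 0) (𝓝 3) := by
      have := (hj.div hg hg0).continuousAt.tendsto.mono_left (nhdsWithin_le_nhds (s := {0}ᶜ))
      have e : ((((2 : ℕ) : ℂ) + 1) * g 0 + 0 * deriv g 0) / g 0 = 3 := by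
        field_simp
        push_cast
        ring
      rwa [Pi.div_apply, e] at this
    refine hlim.congr' ?_
    filter_upwards [nhdsWithin_le_nhds hX', nhdsWithin_le_nhds hXg, nhdsWithin_le_nhds hgne,
      self_mem_nhdsWithin] with t e1 e2 n1 (n0 : t ≠ 0)
    have e3 : X t - X 0 = t ^ 3 * g t := by rw [e2]; ring
    rw [e1, e3]
    field_simp

/-- Away from the branch points, `X` is a local parameter. -/
theorem affineGerm_of_not_branch {A B : Polynomial ℂ} {X U V : ℂ → ℂ} (hX : AnalyticAt ℂ X 0)
    (hU : AnalyticAt ℂ U 0) (hV : AnalyticAt ℂ V 0) (h1 : ∀ t, U t ^ 2 = V t * A.eval (X t))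
    (h2 : ∀ t, U t * V t = A.eval (X t) * B.eval (X t))
    (him : deriv X 0 ≠ 0 ∨ deriv U 0 ≠ 0 ∨ deriv V 0 ≠ 0) (hUV : U 0 * V 0 ≠ 0) :
    AffineGerm X U V 1 := by
  have hU0 := left_ne_zero_of_mul hUV
  have hV0 := right_ne_zero_of_mul hUV
  have hA0 : A.eval (X 0) ≠ 0 := by
    rw [h2] at hUV
    exact left_ne_zero_of_mul hUV
  have hX0 : deriv X 0 ≠ 0 := by
    intro hX0
    have dX : HasDerivAt X 0 0 := by
      have := hX.differentiableAt.hasDerivAt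
      rwa [hX0] at this
    have dU := hU.differentiableAt.hasDerivAt
    have dV := hV.differentiableAt.hasDerivAt
    have e1 : (fun t => U t ^ 3) = fun t => (A ^ 2 * B).eval (X t) := by
      funext t
      simp [cube_eq (h1 t) (h2 t)]
    have e2 : (fun t => U t ^ 2) = fun t => V t * A.eval (X t) := funext h1
    have d1 : HasDerivAt (fun t => U t ^ 3) _ 0 := dU.pow 3
    have d2 : HasDerivAt (fun t => (A ^ 2 * B).eval (X t)) _ 0 :=
      ((A ^ 2 * B).hasDerivAt (X 0)).comp 0 dX
    have hU' : deriv U 0 = 0 := by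
      rw [e1] at d1
      have := d1.unique d2
      simpa [hU0] using this
    have d3 : HasDerivAt (fun t => U t ^ 2) _ 0 := dU.pow 2
    rw [e2] at d3
    have d4 : HasDerivAt (fun t => V t * A.eval (X t)) _ 0 :=
      dV.mul ((A.hasDerivAt (X 0)).comp 0 dX)
    have hV' : deriv V 0 = 0 := by
      have := d3.unique d4
      simpa [hU', hA0] using this
    rcases him with h | h | h
    · exact h hX0
    · exact h hU'
    · exact h hV'
  obtain ⟨q, hq, hq0, hXq⟩ := exists_eq_mul_of_eq_zero (U := fun t => X t - X 0)
    (hX.sub analyticAt_const) (sub_self _)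
  have hq0' : q 0 ≠ 0 := by
    rw [hq0, deriv_sub_const]
    exact hX0
  refine ⟨?_, ?_, ?_, ?_⟩
  · filter_upwards [nhdsWithin_le_nhds (hU.continuousAt.eventually_ne hU0),
      nhdsWithin_le_nhds (hV.continuousAt.eventually_ne hV0),
      nhdsWithin_le_nhds (hX.deriv.continuousAt.eventually_ne hX0),
      nhdsWithin_le_nhds (hq.continuousAt.eventually_ne hq0'), self_mem_nhdsWithin] with
      t n1 n2 n3 n4 (n0 : t ≠ 0)
    refine ⟨n1, n2, n3, ?_⟩
    rw [← sub_ne_zero, hXq]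
    exact mul_ne_zero n0 n4
  · exact (hX.deriv.div hU hU0).removable
  · exact (hX.deriv.div hV hV0).removable
  · have hlim := (hX.deriv.div hq hq0').continuousAt.tendsto.mono_left
      (nhdsWithin_le_nhds (s := {0}ᶜ))
    have e : deriv X 0 / q 0 = 1 := by
      rw [hq0, deriv_sub_const, div_self hX0]
    rw [Pi.div_apply, e] at hlim
    refine hlim.congr' ?_
    filter_upwards [nhdsWithin_le_nhds (hq.continuousAt.eventually_ne hq0'),
      self_mem_nhdsWithin] with t n1 (n0 : t ≠ 0)
    rw [Pi.div_apply, hXq]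
    field_simp

/-- At `∞`, where `X = h / t³`, a cube root of `A(X)² B(X)` has the expected pole order. -/
theorem exists_eq_div_pow {A B : Polynomial ℂ} (hA : A.Monic) (hB : B.Monic) {X U h : ℂ → ℂ}
    (hU : MeromorphicAt U 0) (hh : AnalyticAt ℂ h 0) (hh0 : h 0 ≠ 0)
    (hX : ∀ᶠ t in 𝓝[≠] (0 : ℂ), X t = h t / t ^ 3)
    (hUX : ∀ t, U t ^ 3 = A.eval (X t) ^ 2 * B.eval (X t)) :
    ∃ k : ℂ → ℂ, AnalyticAt ℂ k 0 ∧ k 0 ≠ 0 ∧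
      ∀ᶠ t in 𝓝[≠] (0 : ℂ), U t = k t / t ^ (2 * A.natDegree + B.natDegree) := by
  set n := 2 * A.natDegree + B.natDegree with hn
  have hrev : ∀ (p : Polynomial ℂ) (x : ℂ), x ≠ 0 →
      p.eval x = p.reverse.eval x⁻¹ * x ^ p.natDegree := by
    intro p x hx
    let := invertibleOfNonzero hx
    have h2 := Polynomial.eval₂_reverse_mul_pow (RingHom.id ℂ) x p
    simpa [Polynomial.eval₂_id] using h2.symm
  have hz : AnalyticAt ℂ (fun t => t ^ 3 / h t) 0 := (analyticAt_id.pow 3).div hh hh0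
  let c : ℂ → ℂ := fun t => h t ^ n * (A.reverse.eval (t ^ 3 / h t) ^ 2 *
    B.reverse.eval (t ^ 3 / h t))
  have hc : AnalyticAt ℂ c 0 := (hh.pow n).mul
    (((AnalyticAt.eval_polynomial _ hz).pow 2).mul (AnalyticAt.eval_polynomial _ hz))
  have hc0 : c 0 ≠ 0 := by
    simp only [c]
    have : ∀ p : Polynomial ℂ, p.Monic → p.reverse.eval ((0 : ℂ) ^ 3 / h 0) = 1 := by
      intro p hp
      rw [zero_pow (by norm_num), zero_div, ← Polynomial.coeff_zero_eq_eval_zero,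
        Polynomial.coeff_zero_reverse, hp.leadingCoeff]
    rw [this A hA, this B hB]
    simpa using fun h => absurd h hh0
  have hm : MeromorphicAt (fun t => U t * t ^ n) 0 := hU.mul ((MeromorphicAt.id 0).pow n)
  have hcube : ∀ᶠ t in 𝓝[≠] (0 : ℂ), (U t * t ^ n) ^ 3 = c t := by
    filter_upwards [hX, nhdsWithin_le_nhds (hh.continuousAt.eventually_ne hh0),
      self_mem_nhdsWithin] with t e1 n1 (n0 : t ≠ 0)
    have hX0 : X t ≠ 0 := by rw [e1]; exact div_ne_zero n1 (pow_ne_zero _ n0)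
    have ht : h t = X t * t ^ 3 := by rw [e1]; field_simp
    rw [mul_pow, hUX, hrev A _ hX0, hrev B _ hX0]
    simp only [c, hn, show t ^ 3 / h t = (X t)⁻¹ by rw [e1, inv_div]]
    rw [ht]
    ring
  have hord : meromorphicOrderAt (fun t => U t * t ^ n) 0 = 0 := by
    have h1 : meromorphicOrderAt ((fun t => U t * t ^ n) ^ 3) 0 = 0 := by
      rw [meromorphicOrderAt_congr
        (show (fun t => U t * t ^ n) ^ 3 =ᶠ[𝓝[≠] 0] c from hcube)]
      exact (tendsto_ne_zero_iff_meromorphicOrderAt_eq_zero hc.meromorphicAt).1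
        ⟨c 0, hc0, hc.continuousAt.tendsto.mono_left nhdsWithin_le_nhds⟩
    rw [meromorphicOrderAt_pow hm] at h1
    cases hh : meromorphicOrderAt (fun t => U t * t ^ n) 0 with
    | top => rw [hh] at h1; exact absurd h1 (by decide)
    | coe m =>
      rw [hh] at h1
      have h2 : ((3 * m : ℤ) : WithTop ℤ) = ((0 : ℤ) : WithTop ℤ) := by
        rw [WithTop.coe_mul]
        exact h1
      have h3 := WithTop.coe_injective h2
      norm_cast
      omega
  obtain ⟨k, hk, e⟩ := Removable.of_order_nonneg hm hord.ge
  obtain ⟨d, hd, hlim⟩ := (tendsto_ne_zero_iff_meromorphicOrderAt_eq_zero hm).2 hord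
  refine ⟨k, hk, ?_, ?_⟩
  · rw [tendsto_nhds_unique (hk.continuousAt.tendsto.mono_left nhdsWithin_le_nhds)
      (hlim.congr' e)]
    exact hd
  · filter_upwards [e, self_mem_nhdsWithin] with t et (n0 : t ≠ 0)
    rw [← et]
    field_simp

/-! ### Local parameters of the compact curve -/

/-- The shape of a local parameter at `∞`: pole orders `3`, `r̂`, `ŝ` and `4` of `x`, `y_r̂`, `y_ŝ`
and `dx`. -/
structure InftyGerm (r s : ℕ) (X U V h k l j : ℂ → ℂ) : Prop where
  analytic_h : AnalyticAt ℂ h 0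
  analytic_k : AnalyticAt ℂ k 0
  analytic_l : AnalyticAt ℂ l 0
  analytic_j : AnalyticAt ℂ j 0
  h_ne : h 0 ≠ 0
  k_ne : k 0 ≠ 0
  l_ne : l 0 ≠ 0
  j_eq : j 0 = -3 * h 0
  eventually_eq : ∀ᶠ t in 𝓝[≠] (0 : ℂ), X t = h t / t ^ 3 ∧ U t = k t / t ^ (2 * r + s) ∧
    V t = l t / t ^ (2 * s + r) ∧ deriv X t = j t / t ^ 4
  eventually_ne : ∀ᶠ t in 𝓝[≠] (0 : ℂ), t ≠ 0 ∧ h t ≠ 0 ∧ k t ≠ 0 ∧ l t ≠ 0 ∧ j t ≠ 0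

theorem exists_inftyGerm {γ : ℂ → Affine b}
    (hX : MeromorphicAt (fun t => (γ t).x) 0) (hU : MeromorphicAt (fun t => (γ t).yr) 0)
    (hV : MeromorphicAt (fun t => (γ t).ys) 0)
    (hord : meromorphicOrderAt (fun t => (γ t).x) 0 = ((-3 : ℤ) : WithTop ℤ)) :
    ∃ h k l j,
      InftyGerm r s (fun t => (γ t).x) (fun t => (γ t).yr) (fun t => (γ t).ys) h k l j := by
  obtain ⟨h, hh, hh0, e⟩ := (meromorphicOrderAt_eq_int_iff hX).1 hord
  have e1 : ∀ᶠ t in 𝓝[≠] (0 : ℂ), (γ t).x = h t / t ^ 3 := by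
    filter_upwards [e] with t ht
    rw [ht, sub_zero, smul_eq_mul, zpow_neg, div_eq_inv_mul]
    rfl
  obtain ⟨k, hk, hk0, e2⟩ := exists_eq_div_pow (kr_monic (b := b)) (ks_monic (b := b)) hU hh hh0 e1
    (fun t => (γ t).yr_cube)
  obtain ⟨l, hl, hl0, e3⟩ := exists_eq_div_pow (ks_monic (b := b)) (kr_monic (b := b)) hV hh hh0 e1
    (fun t => cube_eq (γ t).ys_sq (by rw [mul_comm, (γ t).yr_mul_ys, mul_comm]))
  rw [kr_natDegree, ks_natDegree] at e2 e3
  have hj : AnalyticAt ℂ (fun t => -3 * h t + t * deriv h t) 0 :=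
    (analyticAt_const.mul hh).add (analyticAt_id.mul hh.deriv)
  refine ⟨h, k, l, fun t => -3 * h t + t * deriv h t, hh, hk, hl, hj, hh0, hk0, hl0, by simp,
    ?_, ?_⟩
  · have e4 := eventually_eventually_nhdsWithin.2 e1
    filter_upwards [e1, e2, e3, e4, self_mem_nhdsWithin,
      nhdsWithin_le_nhds hh.eventually_analyticAt] with t h1 h2 h3 h4 (n0 : t ≠ 0) ha
    refine ⟨h1, h2, h3, ?_⟩
    rw [isOpen_compl_singleton.nhdsWithin_eq n0] at h4
    have hd : HasDerivAt (fun t => h t / t ^ 3) _ t :=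
      ha.differentiableAt.hasDerivAt.div (hasDerivAt_pow 3 t) (pow_ne_zero _ n0)
    rw [EventuallyEq.deriv_eq h4, hd.deriv]
    field_simp
    push_cast
    ring
  · filter_upwards [self_mem_nhdsWithin,
      nhdsWithin_le_nhds (hh.continuousAt.eventually_ne hh0),
      nhdsWithin_le_nhds (hk.continuousAt.eventually_ne hk0),
      nhdsWithin_le_nhds (hl.continuousAt.eventually_ne hl0),
      nhdsWithin_le_nhds (hj.continuousAt.eventually_ne (y := 0) (by simpa using hh0))] with
      t n0 n1 n2 n3 n4 using ⟨n0, n1, n2, n3, n4⟩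

/-- A local parameter at an affine point. The ramification index `e` is `1` or `3`, and `3` only at
the points with `y_r̂ = y_ŝ = 0`. -/
theorem exists_affineGerm (hb : Function.Injective b) {P : Affine b} {γ : ℂ → Affine b}
    (hγ : IsLocalParam (P : Curve b) γ) :
    γ 0 = P ∧ AnalyticAt ℂ (fun t => (γ t).x) 0 ∧ AnalyticAt ℂ (fun t => (γ t).yr) 0 ∧
    AnalyticAt ℂ (fun t => (γ t).ys) 0 ∧
    ((AffineGerm (fun t => (γ t).x) (fun t => (γ t).yr) (fun t => (γ t).ys) 1 ∧
      P.yr * P.ys ≠ 0) ∨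
    (AffineGerm (fun t => (γ t).x) (fun t => (γ t).yr) (fun t => (γ t).ys) 3 ∧
      P.yr = 0 ∧ P.ys = 0)) := by
  rcases hγ with ⟨P', hP, h0, hX, hU, hV, him⟩ | ⟨h, -⟩
  swap
  · exact absurd h (OnePoint.coe_ne_infty P)
  obtain rfl : P = P' := OnePoint.coe_injective hP
  refine ⟨h0, hX, hU, hV, ?_⟩
  by_cases hUV : P.yr * P.ys ≠ 0
  · left
    refine ⟨(affineGerm_of_not_branch hX hU hV (fun t => (γ t).yr_sq) (fun t => (γ t).yr_mul_ys)
      him ?_), hUV⟩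
    simpa only [h0] using hUV
  · right
    push Not at hUV
    have hz : P.yr = 0 ∧ P.ys = 0 := by
      have e1 := P.yr_sq
      have e2 := P.ys_sq
      rcases mul_eq_zero.1 hUV with h | h
      · rw [h] at e2
        exact ⟨h, by simpa using e2⟩
      · rw [h] at e1
        exact ⟨by simpa using e1, h⟩
    refine ⟨?_, hz⟩
    have h2 := P.yr_mul_ys
    rw [hUV] at h2
    rcases mul_eq_zero.1 h2.symm with hA | hB
    · refine (affineGerm_of_branch (A := ks b) (B := kr b) hX hV (fun t => (γ t).ys_sq)
        (fun t => by rw [mul_comm, (γ t).yr_mul_ys, mul_comm]) (by tauto) ?_ ?_ ?_).swap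
      · simpa only [h0] using hA
      · simpa only [h0] using kr_simple_root hb hA
      · simpa only [h0] using kr_ks_no_common_root hb hA
    · refine affineGerm_of_branch (A := kr b) (B := ks b) hX hU (fun t => (γ t).yr_sq)
        (fun t => (γ t).yr_mul_ys) him ?_ ?_ ?_
      · simpa only [h0] using hB
      · simpa only [h0] using ks_simple_root hb hB
      · simp only [h0]
        exact fun hA => kr_ks_no_common_root hb hA hB

/-- The two kinds of local parameters. -/
theorem IsLocalParam.cases {p : Curve b} {γ : ℂ → Affine b} (hγ : IsLocalParam p γ) :
    (∃ P : Affine b, p = P) ∨ (p = OnePoint.infty ∧ ∃ h k l j,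
      InftyGerm r s (fun t => (γ t).x) (fun t => (γ t).yr) (fun t => (γ t).ys) h k l j) := by
  rcases hγ with ⟨P, hP, -⟩ | ⟨hp, h1, h2, h3, h4⟩
  · exact Or.inl ⟨P, hP⟩
  · exact Or.inr ⟨hp, exists_inftyGerm h1 h2 h3 h4⟩

theorem IsLocalParam.meromorphicAt {p : Curve b} {γ : ℂ → Affine b} (hγ : IsLocalParam p γ) :
    MeromorphicAt (fun t => (γ t).x) 0 ∧ MeromorphicAt (fun t => (γ t).yr) 0 ∧
      MeromorphicAt (fun t => (γ t).ys) 0 := by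
  rcases hγ with ⟨P, hP, -, h1, h2, h3, -⟩ | ⟨hp, h1, h2, h3, -⟩
  · exact ⟨h1.meromorphicAt, h2.meromorphicAt, h3.meromorphicAt⟩
  · exact ⟨h1, h2, h3⟩

/-- A local parameter stays away from the branch points, and `x` is a local coordinate, in a
punctured neighbourhood. -/
theorem IsLocalParam.eventually_ne (hb : Function.Injective b) {p : Curve b} {γ : ℂ → Affine b}
    (hγ : IsLocalParam p γ) :
    ∀ᶠ t in 𝓝[≠] (0 : ℂ), (γ t).yr * (γ t).ys ≠ 0 ∧ deriv (fun t => (γ t).x) t ≠ 0 := by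
  rcases hγ.cases with ⟨P, rfl⟩ | ⟨-, h, k, l, j, H⟩
  · obtain ⟨-, -, -, -, h | h⟩ := exists_affineGerm hb hγ <;>
    exact h.1.eventually_ne.mono fun t ht => ⟨mul_ne_zero ht.1 ht.2.1, ht.2.2.1⟩
  · filter_upwards [H.eventually_eq, H.eventually_ne] with t ⟨_, e2, e3, e4⟩ ⟨n0, _, n2, n3, n4⟩
    rw [e2, e3, e4]
    exact ⟨mul_ne_zero (div_ne_zero n2 (pow_ne_zero _ n0)) (div_ne_zero n3 (pow_ne_zero _ n0)),
      div_ne_zero n4 (pow_ne_zero _ n0)⟩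

theorem IsLocalParam.eventually_analyticAt {p : Curve b} {γ : ℂ → Affine b}
    (hγ : IsLocalParam p γ) :
    ∀ᶠ t in 𝓝[≠] (0 : ℂ), AnalyticAt ℂ (fun t => (γ t).x) t ∧
      AnalyticAt ℂ (fun t => (γ t).yr) t ∧ AnalyticAt ℂ (fun t => (γ t).ys) t := by
  obtain ⟨h1, h2, h3⟩ := hγ.meromorphicAt
  filter_upwards [h1.eventually_analyticAt, h2.eventually_analyticAt,
    h3.eventually_analyticAt] with t a b c using ⟨a, b, c⟩

/-- `c` is the `x`-coordinate of `p`. -/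
def IsXCoord (p : Curve b) (c : ℂ) : Prop := ∃ P : Affine b, p = P ∧ P.x = c

theorem IsLocalParam.eventually_x_ne (hb : Function.Injective b) {p : Curve b} {γ : ℂ → Affine b}
    (hγ : IsLocalParam p γ) (c : ℂ) : ∀ᶠ t in 𝓝[≠] (0 : ℂ), (γ t).x ≠ c := by
  rcases hγ.cases with ⟨P, rfl⟩ | ⟨-, h, k, l, j, H⟩
  · obtain ⟨h0, hX, -, -, h⟩ := exists_affineGerm hb hγ
    by_cases hc : (γ 0).x = c
    · rcases h with h | h <;>
      exact h.1.eventually_ne.mono fun t ht => hc ▸ ht.2.2.2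
    · exact nhdsWithin_le_nhds (hX.continuousAt.eventually_ne hc)
  · have hlim : ∀ᶠ t in 𝓝 (0 : ℂ), h t - c * t ^ 3 ≠ 0 := by
      refine ContinuousAt.eventually_ne (H.analytic_h.continuousAt.sub (by fun_prop)) ?_
      simpa using H.h_ne
    filter_upwards [H.eventually_eq, H.eventually_ne, nhdsWithin_le_nhds hlim] with
      t ⟨e1, _, _, _⟩ ⟨n0, _⟩ n1
    rw [e1]
    intro e
    rw [div_eq_iff (pow_ne_zero _ n0)] at e
    exact n1 (by rw [e]; ring)

/-! ### Behaviour of `dx` and of the differentials of the first kind -/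

/-- A normalizing factor `ζ` for the coordinate `x` at a point of the compact curve, together with
`η = ζ x`. It is `1` at the affine points and `1 / x` at `∞`, so that `η - ζ c ≠ 0` at each point
whose `x`-coordinate differs from `c`. -/
theorem IsLocalParam.exists_normalization (hrs : r < s) (hb : Function.Injective b) {p : Curve b}
    {γ : ℂ → Affine b} (hγ : IsLocalParam p γ) :
    ∃ ζ η : ℂ → ℂ, AnalyticAt ℂ ζ 0 ∧ AnalyticAt ℂ η 0 ∧
      (∀ᶠ t in 𝓝[≠] (0 : ℂ), ζ t ≠ 0 ∧ η t = ζ t * (γ t).x) ∧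
      (∀ c, ¬ IsXCoord p c → η 0 - ζ 0 * c ≠ 0) ∧
      Removable (fun t => deriv (fun t => (γ t).x) t * ζ t ^ 2) 0 ∧
      Removable (fun t => deriv (fun t => (γ t).x) t / (γ t).yr * ζ t) 0 ∧
      Removable (fun t => deriv (fun t => (γ t).x) t / (γ t).ys * ζ t) 0 := by
  rcases hγ.cases with ⟨P, rfl⟩ | ⟨-, h, k, l, j, H⟩
  · obtain ⟨h0, hX, hU, hV, h⟩ := exists_affineGerm hb hγ
    refine ⟨fun _ => 1, fun t => (γ t).x, analyticAt_const, hX, by simp, ?_, ?_, ?_, ?_⟩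
    · intro c hc h
      refine hc ⟨P, rfl, ?_⟩
      simpa [h0, sub_eq_zero] using h
    · exact hX.deriv.removable.mul (.const _)
    · rcases h with h | h <;> exact h.1.removable_U.mul (.const _)
    · rcases h with h | h <;> exact h.1.removable_V.mul (.const _)
  · have hζ : AnalyticAt ℂ (fun t => t ^ 3 / h t) 0 := (analyticAt_id.pow 3).div H.analytic_h H.h_ne
    refine ⟨fun t => t ^ 3 / h t, fun _ => 1, hζ, analyticAt_const, ?_, ?_, ?_, ?_, ?_⟩
    · filter_upwards [H.eventually_eq, H.eventually_ne] with t ⟨e1, _⟩ ⟨n0, n1, _⟩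
      rw [e1]
      refine ⟨div_ne_zero (pow_ne_zero _ n0) n1, ?_⟩
      field_simp
    · intro c _
      simp
    · refine ⟨fun t => t ^ 2 * j t / h t ^ 2, ((analyticAt_id.pow 2).mul H.analytic_j).div
        (H.analytic_h.pow 2) (pow_ne_zero _ H.h_ne), ?_⟩
      filter_upwards [H.eventually_eq, H.eventually_ne] with t ⟨_, _, _, e4⟩ ⟨n0, n1, _⟩
      rw [e4]
      field_simp
    · refine ⟨fun t => t ^ (2 * r + s - 1) * j t / (k t * h t),
        ((analyticAt_id.pow _).mul H.analytic_j).div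
        (H.analytic_k.mul H.analytic_h) (mul_ne_zero H.k_ne H.h_ne), ?_⟩
      filter_upwards [H.eventually_eq, H.eventually_ne] with t ⟨_, e2, _, e4⟩ ⟨n0, n1, n2, _⟩
      rw [e4, e2]
      obtain ⟨m, hm⟩ : ∃ m, 2 * r + s = m + 1 := ⟨2 * r + s - 1, by omega⟩
      rw [hm, Nat.add_sub_cancel]
      field_simp
      ring
    · refine ⟨fun t => t ^ (2 * s + r - 1) * j t / (l t * h t),
        ((analyticAt_id.pow _).mul H.analytic_j).div
        (H.analytic_l.mul H.analytic_h) (mul_ne_zero H.l_ne H.h_ne), ?_⟩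
      filter_upwards [H.eventually_eq, H.eventually_ne] with t ⟨_, _, e3, e4⟩ ⟨n0, n1, n2, n3, _⟩
      rw [e4, e3]
      obtain ⟨m, hm⟩ : ∃ m, 2 * s + r = m + 1 := ⟨2 * s + r - 1, by omega⟩
      rw [hm, Nat.add_sub_cancel]
      field_simp
      ring

/-- The differentials `ν^I_i` are holomorphic on the compact curve. -/
theorem nuI_removable (h3 : Nat.Coprime 3 (2 * r + s)) (hb : Function.Injective b)
    (i : Fin (genus r s)) {p : Curve b} {γ : ℂ → Affine b} (hγ : IsLocalParam p γ) :
    Removable (fun t => nuI i (γ t) * deriv (fun t => (γ t).x) t) 0 := by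
  have hne := hγ.eventually_ne hb
  rcases hγ.cases with ⟨P, rfl⟩ | ⟨-, h, k, l, j, H⟩
  · obtain ⟨h0, hX, hU, hV, h⟩ := exists_affineGerm hb hγ
    have h : ∃ e, AffineGerm (fun t => (γ t).x) (fun t => (γ t).yr) (fun t => (γ t).ys) e := by
      rcases h with h | h <;> exact ⟨_, h.1⟩
    obtain ⟨e, h⟩ := h
    rcases nuI_cases h3 b i with ⟨a, -, ha⟩ | ⟨a, -, ha⟩
    · refine (((hX.pow a).removable.mul h.removable_V).mul (.const 3⁻¹)).congr ?_
      filter_upwards [hne] with t ⟨ht, _⟩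
      have := left_ne_zero_of_mul ht
      have := right_ne_zero_of_mul ht
      simp only [ha, Pi.pow_apply]
      field_simp
    · refine (((hX.pow a).removable.mul h.removable_U).mul (.const 3⁻¹)).congr ?_
      filter_upwards [hne] with t ⟨ht, _⟩
      have := left_ne_zero_of_mul ht
      have := right_ne_zero_of_mul ht
      simp only [ha, Pi.pow_apply]
      field_simp
  · rcases nuI_cases h3 b i with ⟨a, hle, ha⟩ | ⟨a, hle, ha⟩
    · refine ⟨fun t => h t ^ a * j t * t ^ (2 * s + r - (3 * a + 4)) / (3 * l t),
        (((H.analytic_h.pow a).mul H.analytic_j).mul (analyticAt_id.pow _)).div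
          (analyticAt_const.mul H.analytic_l) (mul_ne_zero (by norm_num) H.l_ne), ?_⟩
      filter_upwards [H.eventually_eq, H.eventually_ne, hne] with
        t ⟨e1, e2, e3, e4⟩ ⟨n0, n1, n2, n3, n4⟩ ⟨ht, _⟩
      have hu := left_ne_zero_of_mul ht
      have hv := right_ne_zero_of_mul ht
      obtain ⟨m, hm⟩ : ∃ m, 2 * s + r = 3 * a + 4 + m := ⟨2 * s + r - (3 * a + 4), by omega⟩
      have : (γ t).x ^ a * (γ t).yr / (3 * ((γ t).yr * (γ t).ys)) =
          (γ t).x ^ a / (3 * (γ t).ys) := by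
        field_simp
      rw [ha, e4, this, e1, e3, hm, Nat.add_sub_cancel_left, div_pow, ← pow_mul, pow_add, pow_add]
      field_simp
    · refine ⟨fun t => h t ^ a * j t * t ^ (2 * r + s - (3 * a + 4)) / (3 * k t),
        (((H.analytic_h.pow a).mul H.analytic_j).mul (analyticAt_id.pow _)).div
          (analyticAt_const.mul H.analytic_k) (mul_ne_zero (by norm_num) H.k_ne), ?_⟩
      filter_upwards [H.eventually_eq, H.eventually_ne, hne] with
        t ⟨e1, e2, e3, e4⟩ ⟨n0, n1, n2, n3, n4⟩ ⟨ht, _⟩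
      have hu := left_ne_zero_of_mul ht
      have hv := right_ne_zero_of_mul ht
      obtain ⟨m, hm⟩ : ∃ m, 2 * r + s = 3 * a + 4 + m := ⟨2 * r + s - (3 * a + 4), by omega⟩
      have : (γ t).x ^ a * (γ t).ys / (3 * ((γ t).yr * (γ t).ys)) =
          (γ t).x ^ a / (3 * (γ t).yr) := by
        field_simp
      rw [ha, e4, this, e1, e2, hm, Nat.add_sub_cancel_left, div_pow, ← pow_mul, pow_add, pow_add]
      field_simp

/-! ### Local parameters separate points -/

theorem eventually_injective_of_deriv_ne_zero {f : ℂ → ℂ} (hf : AnalyticAt ℂ f 0)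
    (h : deriv f 0 ≠ 0) :
    ∀ᶠ t in 𝓝 ((0, 0) : ℂ × ℂ), f t.1 = f t.2 → t.1 = t.2 := by
  have h1 := (hf.hasStrictDerivAt).isLittleO
  have h2 := h1.bound (c := ‖deriv f 0‖ / 2) (by positivity)
  filter_upwards [h2] with t ht hft
  by_contra hne
  rw [hft, sub_self, zero_sub, norm_neg] at ht
  have h3 : (0 : ℝ) < ‖t.1 - t.2‖ := norm_pos_iff.2 (sub_ne_zero.2 hne)
  have h4 : ‖(ContinuousLinearMap.toSpanSingleton ℂ (deriv f 0)) (t.1 - t.2)‖ =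
      ‖t.1 - t.2‖ * ‖deriv f 0‖ := by
    simp
  have h5 : (0 : ℝ) < ‖deriv f 0‖ := norm_pos_iff.2 h
  simp only [h4] at ht
  nlinarith

/-- Local parameters are injective near the origin. At `∞` this is where `3 ∤ r̂` enters: a
monomial in `x` and `y_r̂` has a simple zero there. -/
theorem IsLocalParam.eventually_injective (h3 : Nat.Coprime 3 (2 * r + s)) {p : Curve b}
    {γ : ℂ → Affine b} (hγ : IsLocalParam p γ) :
    ∀ᶠ t in 𝓝 ((0, 0) : ℂ × ℂ), t.1 ≠ 0 → t.2 ≠ 0 → γ t.1 = γ t.2 → t.1 = t.2 := by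
  have main : ∀ (f : ℂ → ℂ) (φ : Affine b → ℂ), AnalyticAt ℂ f 0 → deriv f 0 ≠ 0 →
      (∀ᶠ t in 𝓝[≠] (0 : ℂ), f t = φ (γ t)) →
      ∀ᶠ t in 𝓝 ((0, 0) : ℂ × ℂ), t.1 ≠ 0 → t.2 ≠ 0 → γ t.1 = γ t.2 → t.1 = t.2 := by
    intro f φ hf hf0 he
    rw [eventually_nhdsWithin_iff] at he
    have h1 : ∀ᶠ t in 𝓝 ((0, 0) : ℂ × ℂ), t.1 ≠ 0 → f t.1 = φ (γ t.1) :=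
      (continuous_fst.tendsto ((0, 0) : ℂ × ℂ)).eventually he
    have h2 : ∀ᶠ t in 𝓝 ((0, 0) : ℂ × ℂ), t.2 ≠ 0 → f t.2 = φ (γ t.2) :=
      (continuous_snd.tendsto ((0, 0) : ℂ × ℂ)).eventually he
    filter_upwards [h1, h2, eventually_injective_of_deriv_ne_zero hf hf0] with t e1 e2 e3 n1 n2 e
    exact e3 (by rw [e1 n1, e2 n2, e])
  have simple : ∀ g : ℂ → ℂ, AnalyticAt ℂ g 0 → g 0 ≠ 0 →
      AnalyticAt ℂ (fun t => t * g t) 0 ∧ deriv (fun t => t * g t) 0 ≠ 0 := by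
    intro g hg hg0
    refine ⟨analyticAt_id.mul hg, ?_⟩
    have hd : HasDerivAt (fun t => t * g t) (1 * g 0 + 0 * deriv g 0) 0 :=
      (hasDerivAt_id (0 : ℂ)).mul hg.differentiableAt.hasDerivAt
    rw [hd.deriv]
    simpa using hg0
  rcases hγ.cases with ⟨P, rfl⟩ | ⟨-, h, k, l, j, H⟩
  · rcases hγ with ⟨P', hP, h0, hX, hU, hV, him⟩ | ⟨h, -⟩
    · rcases him with h | h | h
      · exact main _ Affine.x hX h (Eventually.of_forall fun _ => rfl)
      · exact main _ Affine.yr hU h (Eventually.of_forall fun _ => rfl)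
      · exact main _ Affine.ys hV h (Eventually.of_forall fun _ => rfl)
    · exact absurd h (OnePoint.coe_ne_infty P)
  · have hm := mod_three_ne_zero h3
    have hcase : (∃ m, 2 * r + s = 3 * m + 1) ∨ ∃ m, 2 * r + s = 3 * m + 2 := by
      rcases (by omega : (2 * r + s) % 3 = 1 ∨ (2 * r + s) % 3 = 2) with h | h
      · exact Or.inl ⟨(2 * r + s) / 3, by omega⟩
      · exact Or.inr ⟨(2 * r + s) / 3, by omega⟩
    rcases hcase with ⟨m, hm⟩ | ⟨m, hm⟩
    · obtain ⟨a1, a2⟩ := simple (fun t => h t ^ m / k t)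
        ((H.analytic_h.pow m).div H.analytic_k H.k_ne)
        (div_ne_zero (pow_ne_zero _ H.h_ne) H.k_ne)
      refine main _ (fun P => P.x ^ m / P.yr) a1 a2 ?_
      filter_upwards [H.eventually_eq, H.eventually_ne] with t ⟨e1, e2, _⟩ ⟨n0, n1, n2, _⟩
      rw [e1, e2, hm, div_pow, ← pow_mul, pow_succ]
      field_simp
    · obtain ⟨a1, a2⟩ := simple (fun t => k t / h t ^ (m + 1))
        (H.analytic_k.div (H.analytic_h.pow _) (pow_ne_zero _ H.h_ne))
        (div_ne_zero H.k_ne (pow_ne_zero _ H.h_ne))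
      refine main _ (fun P => P.yr / P.x ^ (m + 1)) a1 a2 ?_
      filter_upwards [H.eventually_eq, H.eventually_ne] with t ⟨e1, e2, _⟩ ⟨n0, n1, n2, _⟩
      rw [e1, e2, hm, div_pow, ← pow_mul, show 3 * (m + 1) = 3 * m + 2 + 1 by ring]
      field_simp
      ring

/-- Local parameters at different points have disjoint images. -/
theorem eventually_ne_of_ne (hb : Function.Injective b) {p q : Curve b}
    {γ₁ γ₂ : ℂ → Affine b}
    (hpq : p ≠ q) (hγ₁ : IsLocalParam p γ₁) (hγ₂ : IsLocalParam q γ₂) :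
    ∀ᶠ t in 𝓝 ((0, 0) : ℂ × ℂ), t.1 ≠ 0 → t.2 ≠ 0 → γ₁ t.1 ≠ γ₂ t.2 := by
  have aff : ∀ (P : Affine b) (γ : ℂ → Affine b), IsLocalParam (P : Curve b) γ →
      ContinuousAt γ 0 ∧ γ 0 = P := by
    intro P γ h
    obtain ⟨h0, hX, hU, hV, -⟩ := exists_affineGerm hb h
    exact ⟨Topology.IsInducing.subtypeVal.continuousAt_iff.2
      (hX.continuousAt.prodMk (hU.continuousAt.prodMk hV.continuousAt)), h0⟩
  have mixed : ∀ (P : Affine b) (γ γ' : ℂ → Affine b), IsLocalParam (P : Curve b) γ →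
      IsLocalParam (OnePoint.infty : Curve b) γ' →
      ∀ᶠ t in 𝓝 ((0, 0) : ℂ × ℂ), t.2 ≠ 0 → γ t.1 ≠ γ' t.2 := by
    intro P γ γ' h h'
    obtain ⟨-, hX, -⟩ := exists_affineGerm hb h
    rcases h'.cases with ⟨P', hP'⟩ | ⟨-, h, k, l, j, H⟩
    · exact absurd hP'.symm (OnePoint.coe_ne_infty P')
    have he := H.eventually_eq
    rw [eventually_nhdsWithin_iff] at he
    have h1 : ∀ᶠ t in 𝓝 ((0, 0) : ℂ × ℂ), h t.2 - (γ t.1).x * t.2 ^ 3 ≠ 0 := by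
      refine ContinuousAt.eventually_ne ?_ (by simpa using H.h_ne)
      refine ContinuousAt.sub ?_ (ContinuousAt.mul ?_ (by fun_prop))
      · exact ContinuousAt.comp' (g := h) H.analytic_h.continuousAt continuousAt_snd
      · exact ContinuousAt.comp' (g := fun t => (γ t).x) hX.continuousAt continuousAt_fst
    have h2 : ∀ᶠ t in 𝓝 ((0, 0) : ℂ × ℂ), t.2 ≠ 0 → (γ' t.2).x = h t.2 / t.2 ^ 3 :=
      (continuous_snd.tendsto ((0, 0) : ℂ × ℂ)).eventually (he.mono fun t ht n => (ht n).1)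
    filter_upwards [h1, h2] with t n1 e1 n0 heq
    have e1 := e1 n0
    rw [← heq, eq_div_iff (pow_ne_zero _ n0)] at e1
    exact n1 (by rw [e1, sub_self])
  rcases hγ₁.cases with ⟨P, rfl⟩ | ⟨rfl, -⟩ <;> rcases hγ₂.cases with ⟨Q, rfl⟩ | ⟨rfl, -⟩
  · obtain ⟨c1, h1⟩ := aff P γ₁ hγ₁
    obtain ⟨c2, h2⟩ := aff Q γ₂ hγ₂
    have hne : γ₁ 0 ≠ γ₂ 0 := by
      rw [h1, h2]
      exact fun h => hpq (congrArg _ h)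
    have : ∀ᶠ t in 𝓝 ((0, 0) : ℂ × ℂ), γ₁ t.1 ≠ γ₂ t.2 := by
      have t1 : Tendsto (fun t : ℂ × ℂ => γ₁ t.1) (𝓝 (0, 0)) (𝓝 (γ₁ 0)) :=
        c1.tendsto.comp (continuous_fst.tendsto ((0, 0) : ℂ × ℂ))
      have t2 : Tendsto (fun t : ℂ × ℂ => γ₂ t.2) (𝓝 (0, 0)) (𝓝 (γ₂ 0)) :=
        c2.tendsto.comp (continuous_snd.tendsto ((0, 0) : ℂ × ℂ))
      exact (t1.prodMk_nhds t2).eventually (isClosed_diagonal.isOpen_compl.mem_nhds hne)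
    exact this.mono fun t ht _ _ => ht
  · exact (mixed P γ₁ γ₂ hγ₁ hγ₂).mono fun t ht _ n => ht n
  · have := (mixed Q γ₂ γ₁ hγ₂ hγ₁)
    have := (continuous_swap.tendsto ((0, 0) : ℂ × ℂ)).eventually this
    exact this.mono fun t ht n _ => (ht n).symm
  · exact absurd rfl hpq

/-! ### Differentials of the third kind -/

theorem Removable.tendsto_mul {m : ℂ → ℂ} (h : Removable m 0) :
    Tendsto (fun t => t * m t) (𝓝[≠] 0) (𝓝 0) := by
  obtain ⟨g, hg, e⟩ := h
  have h1 : Tendsto (fun t => t * g t) (𝓝[≠] 0) (𝓝 (0 * g 0)) :=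
    ((continuousAt_id.mul hg.continuousAt).tendsto).mono_left nhdsWithin_le_nhds
  rw [zero_mul] at h1
  refine h1.congr' ?_
  filter_upwards [e] with t ht
  rw [ht]

theorem meromorphicAt_pull_sigma {p : Curve b} {γ : ℂ → Affine b} (hγ : IsLocalParam p γ)
    (P₁ : Affine b) : MeromorphicAt (pull (fun P => sigma P P₁) γ) 0 := by
  obtain ⟨h1, h2, h3⟩ := hγ.meromorphicAt
  have h4 := h1.deriv
  unfold pull sigma
  fun_prop

/-- `Σ(P, P₁) = (1/3) (1 + y_ŝ(P₁)/y_ŝ(P) + y_r̂(P₁)/y_r̂(P)) dx / (x - x(P₁))`. -/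
theorem sigma_eq {P P₁ : Affine b} (hP : P.yr * P.ys ≠ 0) :
    sigma P P₁ = (1 + P₁.ys / P.ys + P₁.yr / P.yr) / 3 / (P.x - P₁.x) := by
  have hr := left_ne_zero_of_mul hP
  have hs := right_ne_zero_of_mul hP
  by_cases hx : P.x - P₁.x = 0
  · simp [sigma, hx]
  · rw [sigma]
    field_simp

/-- The values at a common `x` of the three sheets sum to zero. -/
theorem one_add_div_add_div_eq_zero {P P₁ : Affine b} (hP : P.yr * P.ys ≠ 0) (hx : P.x = P₁.x)
    (hne : P ≠ P₁) : 1 + P₁.ys / P.ys + P₁.yr / P.yr = 0 := by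
  have hr := left_ne_zero_of_mul hP
  have hs := right_ne_zero_of_mul hP
  have h1 := P.yr_mul_ys
  have h2 := P.yr_cube
  rw [hx] at h1 h2
  rw [← P₁.yr_mul_ys] at h1
  rw [← P₁.yr_cube] at h2
  have hne' : P.yr - P₁.yr ≠ 0 := by
    intro h
    have hr' : P.yr = P₁.yr := sub_eq_zero.1 h
    refine hne (Affine.ext_coords hx hr' ?_)
    rw [← hr'] at h1
    exact mul_left_cancel₀ hr h1
  have h3 : P.yr ^ 2 + P.yr * P₁.yr + P₁.yr ^ 2 = 0 := by
    refine mul_left_cancel₀ hne' ?_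
    linear_combination h2
  have hr1 : P₁.yr ≠ 0 := by
    intro h
    rw [h] at h3
    exact hr (by simpa using h3)
  have h4 : P₁.ys / P.ys = P.yr / P₁.yr := by
    rw [div_eq_div_iff hs hr1]
    linear_combination -h1
  rw [h4]
  field_simp
  linear_combination h3

/-- Off `P₁` and `∞`, the form `Σ(·, P₁)` is holomorphic; at `P₁` and `∞` it has simple poles with
residues `1` and `-1`. -/
theorem tendsto_mul_pull_sigma (hrs : r < s) (hb : Function.Injective b) {p : Curve b}
    {γ : ℂ → Affine b} (hγ : IsLocalParam p γ) (P₁ : Affine b) :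
    (p = P₁ → Tendsto (fun t => t * pull (fun P => sigma P P₁) γ t) (𝓝[≠] 0) (𝓝 1)) ∧
    (p = OnePoint.infty →
      Tendsto (fun t => t * pull (fun P => sigma P P₁) γ t) (𝓝[≠] 0) (𝓝 (-1))) ∧
    (p ≠ P₁ → p ≠ OnePoint.infty →
      Tendsto (fun t => t * pull (fun P => sigma P P₁) γ t) (𝓝[≠] 0) (𝓝 0)) := by
  have hne := hγ.eventually_ne hb
  have hfac : ∀ {c d : ℂ}, Tendsto (fun t => t * deriv (fun t => (γ t).x) t / ((γ t).x - P₁.x))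
      (𝓝[≠] 0) (𝓝 c) →
      Tendsto (fun t => (1 + P₁.ys / (γ t).ys + P₁.yr / (γ t).yr) / 3) (𝓝[≠] 0) (𝓝 d) →
      Tendsto (fun t => t * pull (fun P => sigma P P₁) γ t) (𝓝[≠] 0) (𝓝 (c * d)) := by
    intro c d h1 h2
    refine (h1.mul h2).congr' ?_
    filter_upwards [hne] with t ⟨ht, _⟩
    simp only [pull, sigma_eq ht]
    ring
  rcases hγ.cases with ⟨P, rfl⟩ | ⟨rfl, h, k, l, j, H⟩
  · refine ⟨?_, fun h => absurd h (OnePoint.coe_ne_infty P), ?_⟩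
    all_goals obtain ⟨h0, hX, hU, hV, h⟩ := exists_affineGerm hb hγ
    · rintro hP
      obtain rfl : P = P₁ := OnePoint.coe_injective hP
      rcases h with ⟨G, hP⟩ | ⟨G, hP⟩
      · have h1 := G.tendsto
        simp only [h0] at h1
        have h2 : Tendsto (fun t => (1 + P.ys / (γ t).ys + P.yr / (γ t).yr) / 3) (𝓝[≠] 0)
            (𝓝 ((1 + P.ys / P.ys + P.yr / P.yr) / 3)) := by
          have tU := hU.continuousAt.tendsto.mono_left (nhdsWithin_le_nhds (s := {0}ᶜ))
          have tV := hV.continuousAt.tendsto.mono_left (nhdsWithin_le_nhds (s := {0}ᶜ))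
          simp only [h0] at tU tV
          exact ((tendsto_const_nhds.add (tendsto_const_nhds.div tV (right_ne_zero_of_mul hP))).add
            (tendsto_const_nhds.div tU (left_ne_zero_of_mul hP))).div_const 3
        rw [div_self (left_ne_zero_of_mul hP), div_self (right_ne_zero_of_mul hP)] at h2
        convert! hfac h1 h2 using 2
        norm_num
      · have h1 := G.tendsto
        simp only [h0] at h1
        have h2 : Tendsto (fun t => (1 + P.ys / (γ t).ys + P.yr / (γ t).yr) / 3) (𝓝[≠] 0)
            (𝓝 (1 / 3)) := by
          simp [hP.1, hP.2]
        convert! hfac h1 h2 using 2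
        norm_num
    · intro hne' _
      have hne' : P ≠ P₁ := fun h => hne' (congrArg _ h)
      by_cases hx : P.x = P₁.x
      · have hP : P.yr * P.ys ≠ 0 := by
          rcases h with h | h
          · exact h.2
          · exfalso
            have e1 := P.yr_cube
            have e2 := cube_eq P.ys_sq (by rw [mul_comm, P.yr_mul_ys, mul_comm])
            have e3 := P₁.yr_cube
            have e4 := cube_eq P₁.ys_sq (by rw [mul_comm, P₁.yr_mul_ys, mul_comm])
            rw [h.2.1, hx, ← e3] at e1
            rw [h.2.2, hx, ← e4] at e2
            refine hne' (Affine.ext_coords hx (h.2.1.trans ?_) (h.2.2.trans ?_))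
            · exact (pow_eq_zero_iff (n := 3) (by norm_num) |>.1 (by rw [← e1]; norm_num)).symm
            · exact (pow_eq_zero_iff (n := 3) (by norm_num) |>.1 (by rw [← e2]; norm_num)).symm
        have hG : AffineGerm (fun t => (γ t).x) (fun t => (γ t).yr) (fun t => (γ t).ys) 1 := by
          rcases h with h | h
          · exact h.1
          · exact absurd h.2.1 (left_ne_zero_of_mul hP)
        have h1 := hG.tendsto
        simp only [h0, hx] at h1
        have h2 : Tendsto (fun t => (1 + P₁.ys / (γ t).ys + P₁.yr / (γ t).yr) / 3) (𝓝[≠] 0)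
            (𝓝 ((1 + P₁.ys / P.ys + P₁.yr / P.yr) / 3)) := by
          have tU := hU.continuousAt.tendsto.mono_left (nhdsWithin_le_nhds (s := {0}ᶜ))
          have tV := hV.continuousAt.tendsto.mono_left (nhdsWithin_le_nhds (s := {0}ᶜ))
          simp only [h0] at tU tV
          exact ((tendsto_const_nhds.add (tendsto_const_nhds.div tV (right_ne_zero_of_mul hP))).add
            (tendsto_const_nhds.div tU (left_ne_zero_of_mul hP))).div_const 3
        rw [one_add_div_add_div_eq_zero hP hx hne'] at h2
        convert! hfac h1 h2 using 2
        norm_num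
      · obtain ⟨e, G⟩ : ∃ e, AffineGerm (fun t => (γ t).x) (fun t => (γ t).yr)
            (fun t => (γ t).ys) e := by
          rcases h with h | h <;> exact ⟨_, h.1⟩
        have hx0 : (γ 0).x - P₁.x ≠ 0 := by
          rw [h0]
          exact sub_ne_zero.2 hx
        refine Removable.tendsto_mul ((((hX.deriv.removable.add
          (G.removable_V.mul (.const P₁.ys))).add (G.removable_U.mul (.const P₁.yr))).mul
          ((analyticAt_const (v := (1 / 3 : ℂ))).div (hX.sub analyticAt_const) hx0).removable).congr
            ?_)
        filter_upwards [hne] with t ⟨ht, _⟩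
        simp only [pull, sigma_eq ht, Pi.div_apply, Pi.sub_apply]
        ring
  · refine ⟨fun h => absurd h (OnePoint.infty_ne_coe P₁), fun _ => ?_, fun _ h => absurd rfl h⟩
    have h1 : Tendsto (fun t => t * deriv (fun t => (γ t).x) t / ((γ t).x - P₁.x))
        (𝓝[≠] 0) (𝓝 (-3)) := by
      have hden : h 0 - P₁.x * (0 : ℂ) ^ 3 ≠ 0 := by simpa using H.h_ne
      have hlim : ContinuousAt (fun t => j t / (h t - P₁.x * t ^ 3)) 0 :=
        H.analytic_j.continuousAt.div
          (H.analytic_h.continuousAt.sub (by fun_prop)) hden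
      have hlim := hlim.tendsto.mono_left (nhdsWithin_le_nhds (s := {0}ᶜ))
      have e : j 0 / (h 0 - P₁.x * (0 : ℂ) ^ 3) = -3 := by
        rw [H.j_eq]
        have := H.h_ne
        field_simp
        simp
      rw [e] at hlim
      refine hlim.congr' ?_
      filter_upwards [H.eventually_eq, H.eventually_ne] with t ⟨e1, _, _, e4⟩ ⟨n0, _⟩
      rw [e1, e4]
      have e5 : h t / t ^ 3 - P₁.x = (h t - P₁.x * t ^ 3) / t ^ 3 := by field_simp
      rw [e5, div_div_eq_mul_div]
      congr 1
      field_simp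
    have h2 : Tendsto (fun t => (1 + P₁.ys / (γ t).ys + P₁.yr / (γ t).yr) / 3) (𝓝[≠] 0)
        (𝓝 (1 / 3)) := by
      have hc : ContinuousAt (fun t => (1 + P₁.ys * t ^ (2 * s + r) / l t +
          P₁.yr * t ^ (2 * r + s) / k t) / 3) 0 := by
        refine ContinuousAt.div_const ((continuousAt_const.add ?_).add ?_) _
        · exact ContinuousAt.div (by fun_prop) H.analytic_l.continuousAt H.l_ne
        · exact ContinuousAt.div (by fun_prop) H.analytic_k.continuousAt H.k_ne
      have hc := hc.tendsto.mono_left (nhdsWithin_le_nhds (s := {0}ᶜ))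
      rw [zero_pow (by omega), zero_pow (by omega)] at hc
      simp only [mul_zero, zero_div, add_zero] at hc
      refine hc.congr' ?_
      filter_upwards [H.eventually_eq, H.eventually_ne] with
        t ⟨_, e2, e3, _⟩ ⟨n0, _, n2, n3, _⟩
      rw [e2, e3]
      field_simp
    convert! hfac h1 h2 using 2
    norm_num

theorem pull_thirdKind (P₁ P₂ : Affine b) (γ : ℂ → Affine b) (t : ℂ) :
    pull (thirdKind P₁ P₂) γ t =
      pull (fun P => sigma P P₁) γ t - pull (fun P => sigma P P₂) γ t := by
  simp only [pull, thirdKind]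
  ring

theorem meromorphicAt_pull_thirdKind {p : Curve b} {γ : ℂ → Affine b} (hγ : IsLocalParam p γ)
    (P₁ P₂ : Affine b) : MeromorphicAt (pull (thirdKind P₁ P₂) γ) 0 := by
  have e : pull (thirdKind P₁ P₂) γ =
      fun t => pull (fun P => sigma P P₁) γ t - pull (fun P => sigma P P₂) γ t :=
    funext (pull_thirdKind P₁ P₂ γ)
  rw [e]
  exact (meromorphicAt_pull_sigma hγ P₁).sub (meromorphicAt_pull_sigma hγ P₂)

theorem tendsto_mul_pull_thirdKind (hrs : r < s) (hb : Function.Injective b) {P₁ P₂ : Affine b}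
    (hne : P₁ ≠ P₂) {p : Curve b} {γ : ℂ → Affine b} (hγ : IsLocalParam p γ) :
    (p = P₁ → Tendsto (fun t => t * pull (thirdKind P₁ P₂) γ t) (𝓝[≠] 0) (𝓝 1)) ∧
    (p = P₂ → Tendsto (fun t => t * pull (thirdKind P₁ P₂) γ t) (𝓝[≠] 0) (𝓝 (-1))) ∧
    (p ≠ P₁ → p ≠ P₂ →
      Tendsto (fun t => t * pull (thirdKind P₁ P₂) γ t) (𝓝[≠] 0) (𝓝 0)) := by
  obtain ⟨a1, a2, a3⟩ := tendsto_mul_pull_sigma hrs hb hγ P₁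
  obtain ⟨b1, b2, b3⟩ := tendsto_mul_pull_sigma hrs hb hγ P₂
  have e : (fun t => t * pull (thirdKind P₁ P₂) γ t) = fun t =>
      t * pull (fun P => sigma P P₁) γ t - t * pull (fun P => sigma P P₂) γ t := by
    funext t
    rw [pull_thirdKind, mul_sub]
  have hne' : (P₁ : Curve b) ≠ P₂ := fun h => hne (OnePoint.coe_injective h)
  rw [e]
  refine ⟨?_, ?_, ?_⟩
  · rintro rfl
    simpa using (a1 rfl).sub (b3 hne' (OnePoint.coe_ne_infty P₁))
  · rintro rfl
    simpa using (a3 hne'.symm (OnePoint.coe_ne_infty P₂)).sub (b1 rfl)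
  · intro n1 n2
    by_cases hp : p = OnePoint.infty
    · simpa using (a2 hp).sub (b2 hp)
    · simpa using (a3 n1 hp).sub (b3 n2 hp)

theorem hasResidueAt_of_tendsto {f : Affine b → ℂ} {p : Curve b} {c : ℂ}
    (h : ∀ γ, IsLocalParam p γ → MeromorphicAt (pull f γ) 0 ∧
      Tendsto (fun t => t * pull f γ t) (𝓝[≠] 0) (𝓝 c)) : HasResidueAt f p c := fun γ hγ =>
  (removable_sub_of_tendsto (h γ hγ).1 (h γ hγ).2).exists_primitive

theorem thirdKind_spec (hrs : r < s) (hb : Function.Injective b) {P₁ P₂ : Affine b}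
    (hne : P₁ ≠ P₂) :
    IsThirdKind (thirdKind P₁ P₂) ∧
      (∀ p : Curve b, p ≠ (P₁ : Curve b) → p ≠ (P₂ : Curve b) →
        IsRegularAt (thirdKind P₁ P₂) p) ∧
      HasSimplePoleAt (thirdKind P₁ P₂) (P₁ : Curve b) ∧
      HasResidueAt (thirdKind P₁ P₂) (P₁ : Curve b) 1 ∧
      HasSimplePoleAt (thirdKind P₁ P₂) (P₂ : Curve b) ∧
      HasResidueAt (thirdKind P₁ P₂) (P₂ : Curve b) (-1) := by
  have hm : IsMeromorphicDiff (thirdKind P₁ P₂) := fun p γ hγ =>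
    meromorphicAt_pull_thirdKind hγ P₁ P₂
  have key : ∀ (p : Curve b) (γ : ℂ → Affine b), IsLocalParam p γ → _ := fun p γ hγ =>
    tendsto_mul_pull_thirdKind hrs hb hne hγ
  refine ⟨⟨hm, fun p γ hγ => ?_⟩, fun p n1 n2 γ hγ => ⟨hm p γ hγ, ?_⟩,
    fun γ hγ => ⟨hm _ γ hγ, ?_⟩, hasResidueAt_of_tendsto fun γ hγ => ⟨hm _ γ hγ, ?_⟩,
    fun γ hγ => ⟨hm _ γ hγ, ?_⟩, hasResidueAt_of_tendsto fun γ hγ => ⟨hm _ γ hγ, ?_⟩⟩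
  · by_cases n1 : p = P₁
    · exact neg_one_le_order_of_tendsto (hm p γ hγ) ((key p γ hγ).1 n1)
    · by_cases n2 : p = P₂
      · exact neg_one_le_order_of_tendsto (hm p γ hγ) ((key p γ hγ).2.1 n2)
      · exact neg_one_le_order_of_tendsto (hm p γ hγ) ((key p γ hγ).2.2 n1 n2)
  · have := removable_sub_of_tendsto (hm p γ hγ) ((key p γ hγ).2.2 n1 n2)
    simp only [zero_div, sub_zero] at this
    exact this.order_nonneg
  · exact order_eq_neg_one_of_tendsto one_ne_zero (hm _ γ hγ) ((key _ γ hγ).1 rfl)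
  · exact (key _ γ hγ).1 rfl
  · exact order_eq_neg_one_of_tendsto (by norm_num) (hm _ γ hγ) ((key _ γ hγ).2.1 rfl)
  · exact (key _ γ hγ).2.1 rfl

/-! ### Derivatives along a parametrization -/

theorem hasDerivAt_eval_comp (p : Polynomial ℂ) {X : ℂ → ℂ} {x' t : ℂ} (h : HasDerivAt X x' t) :
    HasDerivAt (fun t => p.eval (X t)) (p.derivative.eval (X t) * x') t :=
  (p.hasDerivAt (X t)).comp t h

theorem hasDerivAt_yr_comp {γ : ℂ → Affine b} {t : ℂ} (hX : AnalyticAt ℂ (fun t => (γ t).x) t)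
    (hU : AnalyticAt ℂ (fun t => (γ t).yr) t) (hne : (γ t).yr * (γ t).ys ≠ 0) :
    HasDerivAt (fun t => (γ t).yr) ((γ t).yr * (logNumR b).eval (γ t).x /
      (3 * ((γ t).yr * (γ t).ys)) * deriv (fun t => (γ t).x) t) t := by
  have dX := hX.differentiableAt.hasDerivAt
  have dU := hU.differentiableAt.hasDerivAt
  have hu := left_ne_zero_of_mul hne
  have hA := kr_eval_ne_zero hne
  have hB := ks_eval_ne_zero hne
  have e1 : (fun t => (γ t).yr ^ 3) = fun t => (kr b ^ 2 * ks b).eval (γ t).x := by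
    funext t
    simp [(γ t).yr_cube]
  have d1 : HasDerivAt (fun t => (γ t).yr ^ 3) _ t := dU.pow 3
  have d2 := hasDerivAt_eval_comp (kr b ^ 2 * ks b) dX
  rw [e1] at d1
  have h := d1.unique d2
  refine dU.congr_deriv (Eq.symm ?_)
  refine mul_left_cancel₀ (mul_ne_zero (by norm_num : (3 : ℂ) ≠ 0) (pow_ne_zero 2 hu)) ?_
  have h' : 3 * (γ t).yr ^ 2 * deriv (fun t => (γ t).yr) t =
      (kr b ^ 2 * ks b).derivative.eval (γ t).x * deriv (fun t => (γ t).x) t := by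
    simpa using h
  rw [h', (γ t).yr_mul_ys]
  have e3 := (γ t).yr_cube
  have e4 : 3 * (γ t).yr ^ 2 * ((γ t).yr * (logNumR b).eval (γ t).x /
      (3 * ((kr b).eval (γ t).x * (ks b).eval (γ t).x)) * deriv (fun t => (γ t).x) t) =
      (γ t).yr ^ 3 * ((logNumR b).eval (γ t).x /
      ((kr b).eval (γ t).x * (ks b).eval (γ t).x) * deriv (fun t => (γ t).x) t) := by
    field_simp
  rw [e4, e3]
  simp only [logNumR, Polynomial.derivative_mul, Polynomial.derivative_pow, Polynomial.eval_mul,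
    Polynomial.eval_add, Polynomial.eval_pow, Polynomial.eval_ofNat]
  field_simp
  simp
  ring

theorem hasDerivAt_ys_comp {γ : ℂ → Affine b} {t : ℂ} (hX : AnalyticAt ℂ (fun t => (γ t).x) t)
    (hU : AnalyticAt ℂ (fun t => (γ t).yr) t) (hV : AnalyticAt ℂ (fun t => (γ t).ys) t)
    (hne : (γ t).yr * (γ t).ys ≠ 0) :
    HasDerivAt (fun t => (γ t).ys) ((γ t).ys * (logNumS b).eval (γ t).x /
      (3 * ((γ t).yr * (γ t).ys)) * deriv (fun t => (γ t).x) t) t := by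
  have dX := hX.differentiableAt.hasDerivAt
  have dU := hasDerivAt_yr_comp hX hU hne
  have dV := hV.differentiableAt.hasDerivAt
  have hu := left_ne_zero_of_mul hne
  have hv := right_ne_zero_of_mul hne
  have e1 : (fun t => (γ t).yr * (γ t).ys) = fun t => (kr b * ks b).eval (γ t).x := by
    funext t
    simp [(γ t).yr_mul_ys]
  have d1 : HasDerivAt (fun t => (γ t).yr * (γ t).ys) _ t := dU.mul dV
  have d2 := hasDerivAt_eval_comp (kr b * ks b) dX
  rw [e1] at d1
  have h := d1.unique d2
  refine dV.congr_deriv (Eq.symm ?_)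
  refine mul_left_cancel₀ hu ?_
  simp only [logNumR, logNumS, Polynomial.derivative_mul, Polynomial.eval_mul,
    Polynomial.eval_add, Polynomial.eval_ofNat] at h ⊢
  field_simp at h ⊢
  linear_combination -h

/-! ### Differentials of the second kind with a pole at `∞` -/

/-- `m` has a meromorphic primitive in a punctured neighbourhood of `0`. -/
def HasPrimitive (m : ℂ → ℂ) : Prop :=
  ∃ G : ℂ → ℂ, MeromorphicAt G 0 ∧ ∀ᶠ t in 𝓝[≠] (0 : ℂ), HasDerivAt G (m t) t

theorem HasPrimitive.congr {m n : ℂ → ℂ} (h : HasPrimitive m) (e : n =ᶠ[𝓝[≠] 0] m) :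
    HasPrimitive n := by
  obtain ⟨G, hG, h⟩ := h
  exact ⟨G, hG, by filter_upwards [h, e] with t h1 h2 using h2 ▸ h1⟩

theorem HasPrimitive.add {m n : ℂ → ℂ} (h : HasPrimitive m) (h' : HasPrimitive n) :
    HasPrimitive fun t => m t + n t := by
  obtain ⟨G, hG, h⟩ := h
  obtain ⟨G', hG', h'⟩ := h'
  exact ⟨_, hG.add hG', by filter_upwards [h, h'] with t h1 h2 using h1.add h2⟩

theorem HasPrimitive.const_mul {m : ℂ → ℂ} (c : ℂ) (h : HasPrimitive m) :
    HasPrimitive fun t => c * m t := by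
  obtain ⟨G, hG, h⟩ := h
  exact ⟨fun t => c * G t, (MeromorphicAt.const c 0).mul hG, by
    filter_upwards [h] with t h1 using h1.const_mul c⟩

theorem HasPrimitive.sum {ι : Type*} (u : Finset ι) {f : ι → ℂ → ℂ}
    (h : ∀ i ∈ u, HasPrimitive (f i)) : HasPrimitive fun t => ∑ i ∈ u, f i t := by
  classical
  induction u using Finset.induction_on with
  | empty =>
    refine ⟨fun _ => 0, MeromorphicAt.const 0 0, Eventually.of_forall fun t => ?_⟩
    simpa using hasDerivAt_const t (0 : ℂ)
  | insert a u ha ih =>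
    simp only [Finset.sum_insert ha]
    exact (h a (by simp)).add (ih fun i hi => h i (by simp [hi]))

/-- Let `Y' = Y L(X) X' / M(X)`, so that `Y` behaves like `X ^ l` for large `X`, where `l` is the
leading coefficient of `L`. If `l` is not an integer then no form `X ^ j dX / Y` has a residue:
modulo the exact form `d(X ^ (j - n) M(X) / Y)` it is a combination of forms with a smaller
exponent, and eventually of holomorphic ones. -/
theorem hasPrimitive_zpow {M L : Polynomial ℂ} {n : ℕ} (hM : M.Monic) (hMn : M.natDegree = n + 1)
    (hL : L.natDegree ≤ n) (hl : ∀ k : ℤ, L.coeff n ≠ k) {X Y : ℂ → ℂ} (hX : MeromorphicAt X 0)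
    (hY : MeromorphicAt Y 0)
    (hgen : ∀ᶠ t in 𝓝[≠] (0 : ℂ), AnalyticAt ℂ X t ∧ X t ≠ 0 ∧ Y t ≠ 0 ∧ M.eval (X t) ≠ 0 ∧
      HasDerivAt Y (Y t * L.eval (X t) / M.eval (X t) * deriv X t) t)
    {J : ℤ} (hJ : ∀ j ≤ J, Removable (fun t => X t ^ j * (deriv X t / Y t)) 0) (j : ℤ) :
    HasPrimitive fun t => X t ^ j * (deriv X t / Y t) := by
  suffices H : ∀ N : ℕ, ∀ j ≤ J + N, HasPrimitive fun t => X t ^ j * (deriv X t / Y t) from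
    H (j - J).toNat j (by have := Int.self_le_toNat (j - J); omega)
  intro N
  induction N with
  | zero =>
    intro j hj
    exact (hJ j (by simpa using hj)).exists_primitive
  | succ N ih =>
    intro j hj
    by_cases hlt : j ≤ J + N
    · exact ih j hlt
    set k : ℤ := j - n with hk
    set q : Polynomial ℂ := Polynomial.C (k : ℂ) * M + Polynomial.X * M.derivative -
      Polynomial.X * L with hq
    have hqn : q.natDegree ≤ n + 1 := by
      refine (Polynomial.natDegree_sub_le_of_le (Polynomial.natDegree_add_le_of_le
        (Polynomial.natDegree_C_mul_le _ _) (Polynomial.natDegree_mul_le))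
        (Polynomial.natDegree_mul_le)).trans ?_
      have h1 := Polynomial.natDegree_derivative_le M
      have h2 : (Polynomial.X : Polynomial ℂ).natDegree = 1 := Polynomial.natDegree_X
      omega
    have hqc : q.coeff (n + 1) = (k + (n + 1 : ℤ) : ℤ) - L.coeff n := by
      have h1 : M.coeff (n + 1) = 1 := by rw [← hMn]; exact hM
      simp only [hq, Polynomial.coeff_sub, Polynomial.coeff_add, Polynomial.coeff_C_mul,
        Polynomial.coeff_X_mul, Polynomial.coeff_derivative, h1]
      push_cast
      ring
    have hq0 : q.coeff (n + 1) ≠ 0 := by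
      rw [hqc, sub_ne_zero]
      exact (hl _).symm
    have hexact : HasPrimitive fun t => X t ^ (k - 1) * q.eval (X t) * (deriv X t / Y t) := by
      refine ⟨fun t => X t ^ k * M.eval (X t) / Y t,
        ((hX.zpow k).mul (MeromorphicAt.eval_polynomial M hX)).div hY, ?_⟩
      filter_upwards [hgen] with t ⟨ha, hx, hy, hm, hd⟩
      have dX := ha.differentiableAt.hasDerivAt
      have d1 : HasDerivAt (fun t => X t ^ k) (k * X t ^ (k - 1) * deriv X t) t :=
        (hasDerivAt_zpow k (X t) (Or.inl hx)).comp t dX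
      have d2 := hasDerivAt_eval_comp M dX
      have d3 : HasDerivAt (fun t => X t ^ k * M.eval (X t) / Y t) _ t := (d1.mul d2).div hd hy
      convert d3 using 1
      have hz : X t ^ k = X t ^ (k - 1) * X t := by
        rw [← zpow_add_one₀ hx, sub_add_cancel]
      simp only [hq, Polynomial.eval_sub, Polynomial.eval_add, Polynomial.eval_mul,
        Polynomial.eval_C, Polynomial.eval_X, Pi.mul_apply, hz]
      field_simp
    have hsum : HasPrimitive fun t => ∑ i ∈ Finset.range (n + 1),
        q.coeff i * (X t ^ (k - 1 + i) * (deriv X t / Y t)) := by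
      refine HasPrimitive.sum _ fun i hi => (ih _ ?_).const_mul _
      have := Finset.mem_range.1 hi
      push_cast at hj
      omega
    refine ((hexact.add (hsum.const_mul (-1))).const_mul (q.coeff (n + 1))⁻¹).congr ?_
    filter_upwards [hgen] with t ⟨_, hx, _⟩
    rw [Polynomial.eval_eq_sum_range' (Nat.lt_succ_of_le hqn), Finset.sum_range_succ]
    have e1 : ∀ i : ℕ, X t ^ (k - 1 + i) = X t ^ (k - 1) * X t ^ i := fun i => by
      rw [zpow_add₀ hx, zpow_natCast]
    have e2 : X t ^ j = X t ^ (k - 1) * X t ^ (n + 1) := by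
      rw [← zpow_natCast, ← zpow_add₀ hx]
      congr 1
      push_cast
      omega
    have e3 : ∑ i ∈ Finset.range (n + 1), q.coeff i * (X t ^ (k - 1 + i) * (deriv X t / Y t)) =
        X t ^ (k - 1) * (∑ i ∈ Finset.range (n + 1), q.coeff i * X t ^ i) * (deriv X t / Y t) := by
      rw [Finset.mul_sum, Finset.sum_mul]
      refine Finset.sum_congr rfl fun i _ => ?_
      rw [e1]
      ring
    rw [e2, e3]
    field_simp
    ring

theorem natDegree_and_coeff_derivative_mul {A B : Polynomial ℂ} (hA : A.Monic) (hB : B.Monic)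
    {n : ℕ} (hn : A.natDegree + B.natDegree = n + 1) :
    (A.derivative * B).natDegree ≤ n ∧ (A.derivative * B).coeff n = A.natDegree := by
  rcases Nat.eq_zero_or_pos A.natDegree with h | h
  · have : A = 1 := hA.natDegree_eq_zero.1 h
    simp [this]
  · obtain ⟨m, hm⟩ : ∃ m, A.natDegree = m + 1 := ⟨A.natDegree - 1, by omega⟩
    have hd : A.derivative.natDegree ≤ m := by
      have := Polynomial.natDegree_derivative_le A
      omega
    have hnm : n = m + B.natDegree := by omega
    refine ⟨Polynomial.natDegree_mul_le.trans (by omega), ?_⟩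
    rw [hnm, Polynomial.coeff_mul_add_eq_of_natDegree_le hd le_rfl, Polynomial.coeff_derivative,
      ← hm, hA.coeff_natDegree, hB.coeff_natDegree, hm]
    push_cast
    ring

/-- The forms `(p(x) y_r̂ + q(x) y_ŝ) dx / (3 y_r̂ y_ŝ)`. -/
def algForm (p q : Polynomial ℂ) (P : Affine b) : ℂ :=
  (p.eval P.x * P.yr + q.eval P.x * P.ys) / (3 * (P.yr * P.ys))

theorem meromorphicAt_pull_algForm (p q : Polynomial ℂ) {c : Curve b} {γ : ℂ → Affine b}
    (hγ : IsLocalParam c γ) : MeromorphicAt (pull (algForm p q) γ) 0 := by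
  obtain ⟨h1, h2, h3⟩ := hγ.meromorphicAt
  have h4 := h1.deriv
  have h5 := MeromorphicAt.eval_polynomial p h1
  have h6 := MeromorphicAt.eval_polynomial q h1
  unfold pull algForm
  fun_prop

theorem pull_algForm_eq (p q : Polynomial ℂ) {γ : ℂ → Affine b} {t : ℂ}
    (ht : (γ t).yr * (γ t).ys ≠ 0) :
    pull (algForm p q) γ t = 3⁻¹ * (p.eval (γ t).x * (deriv (fun t => (γ t).x) t / (γ t).ys)) +
      3⁻¹ * (q.eval (γ t).x * (deriv (fun t => (γ t).x) t / (γ t).yr)) := by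
  have := left_ne_zero_of_mul ht
  have := right_ne_zero_of_mul ht
  simp only [pull, algForm]
  field_simp

theorem removable_pull_algForm (hb : Function.Injective b) (p q : Polynomial ℂ) {P : Affine b}
    {γ : ℂ → Affine b} (hγ : IsLocalParam (P : Curve b) γ) :
    Removable (pull (algForm p q) γ) 0 := by
  obtain ⟨-, hX, -, -, h⟩ := exists_affineGerm hb hγ
  obtain ⟨e, G⟩ : ∃ e, AffineGerm (fun t => (γ t).x) (fun t => (γ t).yr)
      (fun t => (γ t).ys) e := by
    rcases h with h | h <;> exact ⟨_, h.1⟩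
  refine ((((AnalyticAt.eval_polynomial p hX).removable.mul G.removable_V).mul (.const 3⁻¹)).add
    (((AnalyticAt.eval_polynomial q hX).removable.mul G.removable_U).mul (.const 3⁻¹))).congr ?_
  filter_upwards [hγ.eventually_ne hb] with t ⟨ht, _⟩
  rw [pull_algForm_eq p q ht]
  ring

theorem hasPrimitive_pull_algForm_infty (h3 : Nat.Coprime 3 (2 * r + s))
    (hb : Function.Injective b) (p q : Polynomial ℂ) {γ : ℂ → Affine b}
    (hγ : IsLocalParam (OnePoint.infty : Curve b) γ) : HasPrimitive (pull (algForm p q) γ) := by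
  have hmod := mod_three_ne_zero h3
  obtain ⟨n, hn⟩ : ∃ n, r + s = n + 1 := ⟨r + s - 1, by omega⟩
  have hne := hγ.eventually_ne hb
  obtain ⟨hX, hU, hV⟩ := hγ.meromorphicAt
  have hM : (kr b * ks b).Monic := kr_monic.mul ks_monic
  have hMn : (kr b * ks b).natDegree = n + 1 := by
    rw [kr_monic.natDegree_mul ks_monic, kr_natDegree, ks_natDegree, hn]
  obtain ⟨d1, c1⟩ := natDegree_and_coeff_derivative_mul (A := kr b) (B := ks b) kr_monic ks_monic
    (n := n) (by rw [kr_natDegree, ks_natDegree, hn])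
  obtain ⟨d2, c2⟩ := natDegree_and_coeff_derivative_mul (A := ks b) (B := kr b) ks_monic kr_monic
    (n := n) (by rw [kr_natDegree, ks_natDegree, add_comm, hn])
  rw [kr_natDegree] at c1
  rw [ks_natDegree] at c2
  have eR : Polynomial.C (1 / 3 : ℂ) * logNumR b = Polynomial.C (2 / 3) *
      ((kr b).derivative * ks b) + Polynomial.C (1 / 3) * ((ks b).derivative * kr b) := by
    have : (2 : Polynomial ℂ) = Polynomial.C 2 := rfl
    rw [logNumR, this, mul_add, ← mul_assoc, ← mul_assoc, ← Polynomial.C_mul,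
      show (1 / 3 : ℂ) * 2 = 2 / 3 by norm_num]
    ring
  have eS : Polynomial.C (1 / 3 : ℂ) * logNumS b = Polynomial.C (1 / 3) *
      ((kr b).derivative * ks b) + Polynomial.C (2 / 3) * ((ks b).derivative * kr b) := by
    have : (2 : Polynomial ℂ) = Polynomial.C 2 := rfl
    rw [logNumS, this, mul_add, ← mul_assoc, ← mul_assoc, ← mul_assoc, ← Polynomial.C_mul,
      show (1 / 3 : ℂ) * 2 = 2 / 3 by norm_num]
    ring
  have dR : (Polynomial.C (1 / 3 : ℂ) * logNumR b).natDegree ≤ n := by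
    rw [eR]
    exact Polynomial.natDegree_add_le_of_degree_le
      ((Polynomial.natDegree_C_mul_le _ _).trans d1) ((Polynomial.natDegree_C_mul_le _ _).trans d2)
  have dS : (Polynomial.C (1 / 3 : ℂ) * logNumS b).natDegree ≤ n := by
    rw [eS]
    exact Polynomial.natDegree_add_le_of_degree_le
      ((Polynomial.natDegree_C_mul_le _ _).trans d1) ((Polynomial.natDegree_C_mul_le _ _).trans d2)
  have cR : ∀ k : ℤ, (Polynomial.C (1 / 3 : ℂ) * logNumR b).coeff n ≠ k := by
    intro k hk
    rw [eR, Polynomial.coeff_add, Polynomial.coeff_C_mul, Polynomial.coeff_C_mul, c1, c2] at hk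
    have h : ((2 * r + s : ℕ) : ℂ) = ((3 * k : ℤ) : ℂ) := by
      push_cast
      linear_combination 3 * hk
    have h : ((2 * r + s : ℕ) : ℤ) = 3 * k := by exact_mod_cast h
    omega
  have cS : ∀ k : ℤ, (Polynomial.C (1 / 3 : ℂ) * logNumS b).coeff n ≠ k := by
    intro k hk
    rw [eS, Polynomial.coeff_add, Polynomial.coeff_C_mul, Polynomial.coeff_C_mul, c1, c2] at hk
    have h : ((2 * s + r : ℕ) : ℂ) = ((3 * k : ℤ) : ℂ) := by
      push_cast
      linear_combination 3 * hk
    have h : ((2 * s + r : ℕ) : ℤ) = 3 * k := by exact_mod_cast h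
    omega
  rcases hγ.cases with ⟨P, hP⟩ | ⟨-, h, k, l, j, H⟩
  · exact absurd hP.symm (OnePoint.coe_ne_infty P)
  -- `x^i dx / Y` is holomorphic at `∞` for `i ≤ -2`, where `dx` has a pole of order `4` only.
  have base : ∀ (e : ℕ) (Y g : ℂ → ℂ), AnalyticAt ℂ g 0 → g 0 ≠ 0 →
      (∀ᶠ t in 𝓝[≠] (0 : ℂ), Y t = g t / t ^ e) → ∀ i : ℤ, i ≤ -2 →
      Removable (fun t => (γ t).x ^ i * (deriv (fun t => (γ t).x) t / Y t)) 0 := by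
    intro e Y g hg hg0 hY i hi
    obtain ⟨m, rfl⟩ : ∃ m : ℕ, i = -(m + 2 : ℕ) := ⟨(-i - 2).toNat, by
      have := Int.toNat_of_nonneg (show 0 ≤ -i - 2 by omega)
      push_cast
      omega⟩
    refine ⟨fun t => t ^ (3 * m + 2 + e) * j t / (h t ^ (m + 2) * g t),
      ((analyticAt_id.pow _).mul H.analytic_j).div ((H.analytic_h.pow _).mul hg)
        (mul_ne_zero (pow_ne_zero _ H.h_ne) hg0), ?_⟩
    filter_upwards [H.eventually_eq, H.eventually_ne, hY,
      nhdsWithin_le_nhds (hg.continuousAt.eventually_ne hg0)] with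
      t ⟨e1, _, _, e4⟩ ⟨n0, n1, _⟩ e5 n5
    rw [zpow_neg, zpow_natCast, e4, e5, e1, div_pow, ← pow_mul, pow_add, pow_add,
      show 3 * (m + 2) = 3 * m + 6 by ring, pow_add]
    field_simp
    ring
  have gen : ∀ᶠ t in 𝓝[≠] (0 : ℂ), (AnalyticAt ℂ (fun t => (γ t).x) t ∧
      AnalyticAt ℂ (fun t => (γ t).yr) t ∧ AnalyticAt ℂ (fun t => (γ t).ys) t) ∧
      (γ t).yr * (γ t).ys ≠ 0 ∧ (γ t).x ≠ 0 := by
    filter_upwards [hγ.eventually_analyticAt, hne, hγ.eventually_x_ne hb 0] with t h1 h2 h4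
      using ⟨h1, h2.1, h4⟩
  have primU := hasPrimitive_zpow hM hMn dR cR hX hU (J := -2) (by
    filter_upwards [gen] with t ⟨⟨h1, h2, h4⟩, h5, h6⟩
    have hM0 : (kr b * ks b).eval (γ t).x ≠ 0 := by
      rw [Polynomial.eval_mul, ← (γ t).yr_mul_ys]
      exact h5
    refine ⟨h1, h6, left_ne_zero_of_mul h5, hM0, ?_⟩
    convert hasDerivAt_yr_comp h1 h2 h5 using 1
    rw [Polynomial.eval_mul, Polynomial.eval_mul, ← (γ t).yr_mul_ys, Polynomial.eval_C]
    field_simp) (base _ _ k H.analytic_k H.k_ne (H.eventually_eq.mono fun t ht => ht.2.1))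
  have primV := hasPrimitive_zpow hM hMn dS cS hX hV (J := -2) (by
    filter_upwards [gen] with t ⟨⟨h1, h2, h4⟩, h5, h6⟩
    have hM0 : (kr b * ks b).eval (γ t).x ≠ 0 := by
      rw [Polynomial.eval_mul, ← (γ t).yr_mul_ys]
      exact h5
    refine ⟨h1, h6, right_ne_zero_of_mul h5, hM0, ?_⟩
    convert hasDerivAt_ys_comp h1 h2 h4 h5 using 1
    rw [Polynomial.eval_mul, Polynomial.eval_mul, ← (γ t).yr_mul_ys, Polynomial.eval_C]
    field_simp) (base _ _ l H.analytic_l H.l_ne (H.eventually_eq.mono fun t ht => ht.2.2.1))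
  have poly : ∀ (p : Polynomial ℂ) (m : ℂ → ℂ),
      (∀ i : ℤ, HasPrimitive fun t => (γ t).x ^ i * m t) →
      HasPrimitive fun t => p.eval (γ t).x * m t := by
    intro p m hm
    have : (fun t => p.eval (γ t).x * m t) = fun t => ∑ i ∈ Finset.range (p.natDegree + 1),
        p.coeff i * ((γ t).x ^ (i : ℤ) * m t) := by
      funext t
      rw [Polynomial.eval_eq_sum_range, Finset.sum_mul]
      refine Finset.sum_congr rfl fun i _ => ?_
      rw [zpow_natCast, mul_assoc]
    rw [this]
    exact HasPrimitive.sum _ fun i _ => (hm i).const_mul _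
  refine (((poly p _ primV).const_mul 3⁻¹).add ((poly q _ primU).const_mul 3⁻¹)).congr ?_
  filter_upwards [hne] with t ⟨ht, _⟩
  exact pull_algForm_eq p q ht

/-- The forms `algForm p q` have a pole at `∞` only, and no residue there because `3` divides
neither `r̂` nor `ŝ`. -/
theorem algForm_spec (h3 : Nat.Coprime 3 (2 * r + s)) (hb : Function.Injective b)
    (p q : Polynomial ℂ) : IsSecondKind (algForm (b := b) p q) ∧
      ∀ P : Affine b, IsRegularAt (algForm p q) (P : Curve b) := by
  refine ⟨⟨fun c γ hγ => meromorphicAt_pull_algForm p q hγ, fun c γ hγ => ?_⟩, fun P γ hγ =>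
    ⟨meromorphicAt_pull_algForm p q hγ, (removable_pull_algForm hb p q hγ).order_nonneg⟩⟩
  simp only [zero_div, sub_zero]
  rcases hγ.cases with ⟨P, rfl⟩ | ⟨rfl, -⟩
  · exact (removable_pull_algForm hb p q hγ).exists_primitive
  · exact hasPrimitive_pull_algForm_infty h3 hb p q hγ

/-! ### The antisymmetric part of `d_Q Σ(P, Q)` -/

/-- The polynomial functions in two variables of total degree at most `d - 2` (and `0` if
`d < 2`). -/
def polySpan (d : ℕ) : Submodule ℂ (ℂ → ℂ → ℂ) :=
  Submodule.span ℂ {f | ∃ m n : ℕ, m + n + 2 ≤ d ∧ f = fun x z => x ^ m * z ^ n}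

/-- The multiples by `(x - z)²` of the elements of `polySpan d`. -/
def sqMulPolySpan (d : ℕ) : Submodule ℂ (ℂ → ℂ → ℂ) :=
  (polySpan d).map (LinearMap.mulLeft ℂ (fun x z => (x - z) ^ 2 : ℂ → ℂ → ℂ))

theorem mem_sqMulPolySpan {d : ℕ} {f : ℂ → ℂ → ℂ} :
    f ∈ sqMulPolySpan d ↔ ∃ E ∈ polySpan d, ∀ x z, f x z = (x - z) ^ 2 * E x z := by
  rw [sqMulPolySpan, Submodule.mem_map]
  constructor
  · rintro ⟨E, hE, rfl⟩
    exact ⟨E, hE, fun x z => rfl⟩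
  · rintro ⟨E, hE, h⟩
    exact ⟨E, hE, (funext fun x => funext fun z => h x z).symm⟩

/-- The coefficient of `y_r̂(P) y_ŝ(Q)` in the numerator of `d_Q Σ(P, Q) - d_P Σ(Q, P)`, as a
bilinear function of `A = k_r` and `B = k_s`. -/
def antisymCoeff : Polynomial ℂ →ₗ[ℂ] Polynomial ℂ →ₗ[ℂ] (ℂ → ℂ → ℂ) :=
  LinearMap.mk₂ ℂ (fun A B x z =>
    ((x - z) * (A.derivative.eval z * B.eval z + 2 * A.eval z * B.derivative.eval z) +
      3 * (A.eval z * B.eval z)) -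
    ((z - x) * (2 * A.derivative.eval x * B.eval x + A.eval x * B.derivative.eval x) +
      3 * (A.eval x * B.eval x)))
    (fun A A' B => by
      funext x z
      simp only [Polynomial.derivative_add, Polynomial.eval_add, Pi.add_apply]
      ring)
    (fun c A B => by
      funext x z
      simp only [Polynomial.derivative_smul, Polynomial.eval_smul, Pi.smul_apply, smul_eq_mul]
      ring)
    (fun A B B' => by
      funext x z
      simp only [Polynomial.derivative_add, Polynomial.eval_add, Pi.add_apply]
      ring)
    (fun c A B => by
      funext x z
      simp only [Polynomial.derivative_smul, Polynomial.eval_smul, Pi.smul_apply, smul_eq_mul]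
      ring)

theorem antisymCoeff_apply (A B : Polynomial ℂ) (x z : ℂ) : antisymCoeff A B x z =
    ((x - z) * (A.derivative.eval z * B.eval z + 2 * A.eval z * B.derivative.eval z) +
      3 * (A.eval z * B.eval z)) -
    ((z - x) * (2 * A.derivative.eval x * B.eval x + A.eval x * B.derivative.eval x) +
      3 * (A.eval x * B.eval x)) := rfl

theorem monomial_mem_polySpan {d m n : ℕ} (h : m + n + 2 ≤ d) :
    (fun x z : ℂ => x ^ m * z ^ n) ∈ polySpan d :=
  Submodule.subset_span ⟨m, n, h, rfl⟩

theorem antisymCoeff_monomial_mem {d i j : ℕ} (h : i + j ≤ d) :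
    antisymCoeff (Polynomial.X ^ i) (Polynomial.X ^ j) ∈ sqMulPolySpan d := by
  -- The value on monomials depends only on `i + j`, `i + 2 j` and `2 i + j`.
  have hmon : ∀ x z, antisymCoeff (Polynomial.X ^ i) (Polynomial.X ^ j) x z =
      (x - z) * ((i + 2 * j) * z ^ (i + j - 1) + (2 * i + j) * x ^ (i + j - 1)) -
        3 * (x ^ (i + j) - z ^ (i + j)) := by
    intro x z
    have h1 : ∀ w : ℂ, (i : ℂ) * w ^ (i - 1) * w ^ j = i * w ^ (i + j - 1) := by
      intro w
      rcases Nat.eq_zero_or_pos i with rfl | hi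
      · simp
      · rw [mul_assoc, ← pow_add]
        congr 2
        omega
    have h2 : ∀ w : ℂ, w ^ i * ((j : ℂ) * w ^ (j - 1)) = j * w ^ (i + j - 1) := by
      intro w
      rcases Nat.eq_zero_or_pos j with rfl | hj
      · simp
      · rw [mul_left_comm, ← pow_add]
        congr 2
        omega
    simp only [antisymCoeff_apply, Polynomial.derivative_X_pow, Polynomial.eval_mul,
      Polynomial.eval_pow, Polynomial.eval_X, Polynomial.eval_C]
    rw [pow_add, pow_add]
    linear_combination (x - z) * h1 z + 2 * (x - z) * h2 z + 2 * (x - z) * h1 x + (x - z) * h2 x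
  -- The quotient by `(x - z)²` is found with the geometric sums `g k = (x^k - z^k) / (x - z)`.
  rw [mem_sqMulPolySpan]
  rcases Nat.eq_zero_or_pos (i + j) with h0 | hpos
  · obtain ⟨rfl, rfl⟩ : i = 0 ∧ j = 0 := by omega
    refine ⟨0, Submodule.zero_mem _, fun x z => ?_⟩
    rw [hmon]
    simp
  obtain ⟨m, hm⟩ : ∃ m, i + j = m + 1 := ⟨i + j - 1, by omega⟩
  let g : ℕ → ℂ → ℂ → ℂ := fun k x z => ∑ l ∈ Finset.range k, x ^ l * z ^ (k - 1 - l)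
  have hg : ∀ k x z, g k x z * (x - z) = x ^ k - z ^ k := fun k x z =>
    (Commute.all x z).geom_sum₂_mul k
  refine ⟨((2 * i + j : ℕ) : ℂ) • g m - (3 : ℂ) • ∑ k ∈ Finset.range (m + 1),
    (fun x z => z ^ (m - k) * g k x z), ?_, fun x z => ?_⟩
  · have hmem : ∀ k ≤ m, (fun x z => z ^ (m - k) * g k x z) ∈ polySpan d := by
      intro k hk
      have e : (fun x z => z ^ (m - k) * g k x z) =
          ∑ l ∈ Finset.range k, fun x z : ℂ => x ^ l * z ^ (m - k + (k - 1 - l)) := by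
        funext x z
        simp only [g, Finset.sum_apply, Finset.mul_sum]
        refine Finset.sum_congr rfl fun l _ => ?_
        rw [pow_add]
        ring
      rw [e]
      refine Submodule.sum_mem _ fun l hl => monomial_mem_polySpan ?_
      have := Finset.mem_range.1 hl
      omega
    refine Submodule.sub_mem _ (Submodule.smul_mem _ _ ?_)
      (Submodule.smul_mem _ _ (Submodule.sum_mem _ fun k hk => hmem k ?_))
    · simpa using hmem m le_rfl
    · have := Finset.mem_range.1 hk
      omega
  · have hc : (i : ℂ) + j = m + 1 := by exact_mod_cast hm
    have hsum : (x - z) * ∑ k ∈ Finset.range (m + 1), z ^ (m - k) * g k x z =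
        g (m + 1) x z - (m + 1) * z ^ m := by
      have e1 : ∀ k ∈ Finset.range (m + 1),
          (x - z) * (z ^ (m - k) * g k x z) = x ^ k * z ^ (m + 1 - 1 - k) - z ^ m := by
        intro k hk
        have hk := Finset.mem_range.1 hk
        have e2 : z ^ m = z ^ (m - k) * z ^ k := by rw [← pow_add]; congr 1; omega
        rw [Nat.add_sub_cancel, e2]
        linear_combination z ^ (m - k) * hg k x z
      rw [Finset.mul_sum, Finset.sum_congr rfl e1, Finset.sum_sub_distrib]
      simp [g]
    rw [hmon, hm, Nat.add_sub_cancel]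
    simp only [Pi.sub_apply, Pi.smul_apply, smul_eq_mul, Finset.sum_apply]
    push_cast
    linear_combination (-(x - z) * (2 * i + j)) * hg m x z + 3 * (x - z) * hsum +
      3 * hg (m + 1) x z + 3 * (x - z) * z ^ m * hc

/-- The polynomial `antisymCoeff A B` is divisible by `(x - z)²`. -/
theorem antisymCoeff_mem {d : ℕ} {A B : Polynomial ℂ} (h : A.natDegree + B.natDegree ≤ d) :
    antisymCoeff A B ∈ sqMulPolySpan d := by
  have hA := A.as_sum_range_C_mul_X_pow
  have hB := B.as_sum_range_C_mul_X_pow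
  simp only [← Polynomial.smul_eq_C_mul] at hA hB
  rw [hA, map_sum, LinearMap.sum_apply]
  refine Submodule.sum_mem _ fun i hi => ?_
  rw [map_smul, LinearMap.smul_apply]
  refine Submodule.smul_mem _ _ ?_
  rw [hB, map_sum]
  refine Submodule.sum_mem _ fun j hj => ?_
  rw [map_smul]
  refine Submodule.smul_mem _ _ (antisymCoeff_monomial_mem ?_)
  have := Finset.mem_range.1 hi
  have := Finset.mem_range.1 hj
  omega

/-- The denominator `(x_P - x_Q)²` cancels in `d_Q Σ(P, Q) - d_P Σ(Q, P)`. -/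
theorem dSigma_sub_swap {E : ℂ → ℂ → ℂ}
    (hE : ∀ x z, antisymCoeff (kr b) (ks b) x z = (x - z) ^ 2 * E x z) {P Q : Affine b}
    (h : Generic P Q) : dSigma P Q - dSigma Q P =
      (P.yr * Q.ys * E P.x Q.x - P.ys * Q.yr * E Q.x P.x) /
        (9 * (P.yr * P.ys) * (Q.yr * Q.ys)) := by
  have hx : P.x - Q.x ≠ 0 := sub_ne_zero.2 h.2.2
  have e1 := hE P.x Q.x
  have e2 := hE Q.x P.x
  have hnum : dSigmaNum P Q - dSigmaNum Q P =
      P.yr * Q.ys * antisymCoeff (kr b) (ks b) P.x Q.x -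
        P.ys * Q.yr * antisymCoeff (kr b) (ks b) Q.x P.x := by
    simp only [dSigmaNum, antisymCoeff_apply, logNumR, logNumS, Polynomial.eval_add,
      Polynomial.eval_mul, Polynomial.eval_ofNat]
    ring
  rw [e1, e2] at hnum
  rw [dSigma_eq h, dSigma_eq ⟨h.2.1, h.1, h.2.2.symm⟩]
  have hP := h.1
  have hQ := h.2.1
  have e3 : dSigmaNum Q P / (9 * (Q.x - P.x) ^ 2 * (Q.yr * Q.ys) * (P.yr * P.ys)) =
      dSigmaNum Q P / (9 * (P.x - Q.x) ^ 2 * (P.yr * P.ys) * (Q.yr * Q.ys)) := by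
    congr 1
    ring
  rw [e3, ← sub_div, hnum, div_eq_div_iff]
  · ring
  · exact mul_ne_zero (mul_ne_zero (mul_ne_zero (by norm_num) (pow_ne_zero _ hx)) hP) hQ
  · exact mul_ne_zero (mul_ne_zero (by norm_num) hP) hQ

theorem algForm_add (p p' q q' : Polynomial ℂ) (P : Affine b) :
    algForm (p + p') (q + q') P = algForm p q P + algForm p' q' P := by
  simp only [algForm, Polynomial.eval_add]
  ring

theorem algForm_smul (c : ℂ) (p q : Polynomial ℂ) (P : Affine b) :
    algForm (c • p) (c • q) P = c * algForm p q P := by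
  simp only [algForm, Polynomial.eval_smul, smul_eq_mul]
  ring

/-- Every element of `polySpan (r + s)` is accounted for by holomorphic differentials: if
`m + n ≤ r + s - 2` then `x^m y_r̂ dx / (y_r̂ y_ŝ)` or `x^n y_ŝ dx / (y_r̂ y_ŝ)` is one, because
`3 (m + n) ≤ (ŝ - 3) + (r̂ - 3)` and `3` does not divide `r̂` and `ŝ`. -/
theorem exists_algForm_of_mem_polySpan (h3 : Nat.Coprime 3 (2 * r + s)) (b : Fin (s + r) → ℂ)
    {E : ℂ → ℂ → ℂ} (hE : E ∈ polySpan (r + s)) :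
    ∃ p q : Fin (genus r s) → Polynomial ℂ, ∀ P Q : Affine b,
      (P.yr * Q.ys * E P.x Q.x - P.ys * Q.yr * E Q.x P.x) /
        (9 * (P.yr * P.ys) * (Q.yr * Q.ys)) =
      ∑ i, (nuI i Q * algForm (p i) (q i) P - nuI i P * algForm (p i) (q i) Q) := by
  have hmod := mod_three_ne_zero h3
  have hsingle : ∀ (i : Fin (genus r s)) (p q : Polynomial ℂ) (P Q : Affine b),
      ∑ k, (nuI k Q * algForm (Pi.single (M := fun _ => Polynomial ℂ) i p k)
        (Pi.single (M := fun _ => Polynomial ℂ) i q k) P -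
        nuI k P * algForm (Pi.single (M := fun _ => Polynomial ℂ) i p k)
        (Pi.single (M := fun _ => Polynomial ℂ) i q k) Q) =
      nuI i Q * algForm p q P - nuI i P * algForm p q Q := by
    intro i p q P Q
    rw [Finset.sum_eq_single i]
    · simp
    · intro k _ hk
      simp [hk, algForm]
    · simp
  induction hE using Submodule.span_induction with
  | mem f hf =>
    obtain ⟨m, n, hmn, rfl⟩ := hf
    by_cases hn : 3 * n + 4 ≤ 2 * r + s
    · obtain ⟨i, hi⟩ := exists_nuI_s h3 b hn
      refine ⟨Pi.single i (Polynomial.X ^ m), Pi.single i 0, fun P Q => ?_⟩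
      rw [hsingle, hi, hi]
      simp only [algForm, Polynomial.eval_pow, Polynomial.eval_X, Polynomial.eval_zero]
      ring
    · have hm : 3 * m + 4 ≤ 2 * s + r := by omega
      obtain ⟨i, hi⟩ := exists_nuI_r h3 b hm
      refine ⟨Pi.single i 0, Pi.single i (-Polynomial.X ^ n), fun P Q => ?_⟩
      rw [hsingle, hi, hi]
      simp only [algForm, Polynomial.eval_pow, Polynomial.eval_X, Polynomial.eval_zero,
        Polynomial.eval_neg]
      ring
  | zero => exact ⟨0, 0, fun P Q => by simp [algForm]⟩
  | add f g _ _ hf hg =>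
    obtain ⟨p, q, h⟩ := hf
    obtain ⟨p', q', h'⟩ := hg
    refine ⟨p + p', q + q', fun P Q => ?_⟩
    have e : ∀ i, nuI i Q * algForm ((p + p') i) ((q + q') i) P -
        nuI i P * algForm ((p + p') i) ((q + q') i) Q =
        (nuI i Q * algForm (p i) (q i) P - nuI i P * algForm (p i) (q i) Q) +
        (nuI i Q * algForm (p' i) (q' i) P - nuI i P * algForm (p' i) (q' i) Q) := by
      intro i
      simp only [Pi.add_apply, algForm_add]
      ring
    rw [Finset.sum_congr rfl fun i _ => e i, Finset.sum_add_distrib, ← h, ← h', ← add_div]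
    congr 1
    simp only [Pi.add_apply]
    ring
  | smul c f _ hf =>
    obtain ⟨p, q, h⟩ := hf
    refine ⟨c • p, c • q, fun P Q => ?_⟩
    have e : ∀ i, nuI i Q * algForm ((c • p) i) ((c • q) i) P -
        nuI i P * algForm ((c • p) i) ((c • q) i) Q =
        c * (nuI i Q * algForm (p i) (q i) P - nuI i P * algForm (p i) (q i) Q) := by
      intro i
      simp only [Pi.smul_apply, algForm_smul]
      ring
    rw [Finset.sum_congr rfl fun i _ => e i, ← Finset.mul_sum, ← h, ← mul_div_assoc]
    congr 1
    simp only [Pi.smul_apply, smul_eq_mul]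
    ring

/-- Associated differentials of the second kind exist, with poles at `∞` only. -/
theorem exists_associated (h3 : Nat.Coprime 3 (2 * r + s)) (hb : Function.Injective b) :
    ∃ p q : Fin (genus r s) → Polynomial ℂ,
      IsAssociated (b := b) fun i => algForm (p i) (q i) := by
  obtain ⟨E, hE, hE'⟩ := mem_sqMulPolySpan.1 (antisymCoeff_mem (A := kr b) (B := ks b)
    (d := r + s) (by rw [kr_natDegree, ks_natDegree]))
  obtain ⟨p, q, h⟩ := exists_algForm_of_mem_polySpan h3 b hE
  refine ⟨p, q, fun i => algForm_spec h3 hb (p i) (q i), fun P Q hPQ => ?_⟩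
  rw [dSigma_sub_swap hE' hPQ, h]

/-! ### Uniqueness of the associated differentials, up to holomorphic ones -/

/-- Over each `x` which is not a branch value there are two points that separate the combinations
`c y_r̂ + d y_ŝ`: they differ by a primitive cube root of unity. -/
theorem exists_affine_separating {x : ℂ} (hA : (kr b).eval x ≠ 0) (hB : (ks b).eval x ≠ 0) :
    ∃ P Q : Affine b, P.x = x ∧ Q.x = x ∧ P.yr * P.ys ≠ 0 ∧ Q.yr * Q.ys ≠ 0 ∧
      ∀ c d : ℂ, c * P.yr + d * P.ys = 0 → c * Q.yr + d * Q.ys = 0 → c = 0 ∧ d = 0 := by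
  obtain ⟨u, hu⟩ := IsAlgClosed.exists_pow_nat_eq ((kr b).eval x ^ 2 * (ks b).eval x)
    (n := 3) (by norm_num)
  have hne : (kr b).eval x ^ 2 * (ks b).eval x ≠ 0 := mul_ne_zero (pow_ne_zero _ hA) hB
  have hu0 : u ≠ 0 := by
    rintro rfl
    exact hne (by rw [← hu]; norm_num)
  obtain ⟨w, hw⟩ := IsAlgClosed.exists_pow_nat_eq (-3 : ℂ) (n := 2) (by norm_num)
  -- `ω` is a primitive cube root of unity.
  set ω : ℂ := (-1 + w) / 2 with hω
  have hω1 : ω ^ 2 + ω + 1 = 0 := by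
    rw [hω]
    linear_combination (1 / 4 : ℂ) * hw
  have hω3 : ω ^ 3 = 1 := by linear_combination (ω - 1) * hω1
  have hω0 : ω ≠ 1 := by
    intro h
    rw [h] at hω1
    norm_num at hω1
  have hωz : ω ≠ 0 := by
    intro h
    rw [h] at hω3
    norm_num at hω3
  obtain ⟨P, p1, p2, p3⟩ := exists_affine hA hu
  obtain ⟨Q, q1, q2, q3⟩ := exists_affine (b := b) (u := ω * u) hA
    (by rw [mul_pow, hω3, one_mul, hu])
  refine ⟨P, Q, p1, q1, ?_, ?_, fun c d e1 e2 => ?_⟩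
  · rw [P.yr_mul_ys, p1]; exact mul_ne_zero hA hB
  · rw [Q.yr_mul_ys, q1]; exact mul_ne_zero hA hB
  · rw [p2, p3] at e1
    rw [q2, q3] at e2
    have hd : d * u ^ 2 / (kr b).eval x * (ω * (ω - 1)) = 0 := by
      linear_combination e2 - ω * e1
    have hd0 : d = 0 := by
      have := sub_ne_zero.2 hω0
      simpa [hu0, hA, hωz, this] using hd
    rw [hd0] at e1
    exact ⟨by simpa [hu0] using e1, hd0⟩

theorem infinite_regular_values (b : Fin (s + r) → ℂ) (T : Finset ℂ) :
    {x : ℂ | (kr b).eval x ≠ 0 ∧ (ks b).eval x ≠ 0 ∧ x ∉ T}.Infinite := by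
  refine ((kr b * ks b).roots.toFinset ∪ T : Finset ℂ).finite_toSet.infinite_compl.mono ?_
  intro x hx
  have h0 : kr b * ks b ≠ 0 := (kr_monic.mul ks_monic).ne_zero
  simp only [Set.mem_compl_iff, Finset.mem_coe, Finset.mem_union, Multiset.mem_toFinset,
    Polynomial.mem_roots h0, Polynomial.IsRoot.def, Polynomial.eval_mul, mul_eq_zero, not_or] at hx
  exact ⟨hx.1.1, hx.1.2, hx.2⟩

/-- The differentials `ν^I_i` are linearly independent, even outside a finite set. -/
theorem nuI_independent (h3 : Nat.Coprime 3 (2 * r + s))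
    (T : Finset ℂ) {c : Fin (genus r s) → ℂ}
    (hc : ∀ Q : Affine b, Q.yr * Q.ys ≠ 0 → Q.x ∉ T → ∑ i, c i * nuI i Q = 0) : c = 0 := by
  have hex : ∀ i : Fin (genus r s), ∃ ε : Bool, ∃ a : ℕ, Nat.nth (IsHatWeight r s) i =
      3 * a + if ε then 2 * r + s else 2 * s + r := by
    intro i
    rcases nth_isHatWeight_cases h3 i with ⟨a, -, h⟩ | ⟨a, -, h⟩
    · exact ⟨true, a, by simpa using h⟩
    · exact ⟨false, a, by simpa using h⟩
  choose ε a ha using hex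
  have hinj : ∀ i j, ε i = ε j → a i = a j → i = j := by
    intro i j h1 h2
    have h := ha i
    rw [h1, h2, ← ha j] at h
    exact Fin.ext (Nat.nth_injective infinite_isHatWeight h)
  -- The relation reads `p true (x) y_r̂ + p false (x) y_ŝ = 0`, and its monomials are distinct.
  let p : Bool → Polynomial ℂ := fun e =>
    ∑ i, if ε i = e then Polynomial.C (c i) * Polynomial.X ^ a i else 0
  have hcoeff : ∀ i, (p (ε i)).coeff (a i) = c i := by
    intro i
    simp only [p, Polynomial.finsetSum_coeff]
    rw [Finset.sum_eq_single i]
    · simp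
    · intro j _ hj
      by_cases he : ε j = ε i
      · rw [if_pos he, Polynomial.coeff_C_mul, Polynomial.coeff_X_pow, if_neg, mul_zero]
        exact fun h => hj (hinj j i he h.symm)
      · rw [if_neg he, Polynomial.coeff_zero]
    · simp
  have heval : ∀ Q : Affine b, Q.yr * Q.ys ≠ 0 → Q.x ∉ T →
      (p true).eval Q.x * Q.yr + (p false).eval Q.x * Q.ys = 0 := by
    intro Q hQ hT
    have h := hc Q hQ hT
    have e : ∀ i, c i * nuI i Q = ((if ε i = true then
        Polynomial.C (c i) * Polynomial.X ^ a i else 0 : Polynomial ℂ).eval Q.x * Q.yr +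
        (if ε i = false then Polynomial.C (c i) * Polynomial.X ^ a i else 0 :
          Polynomial ℂ).eval Q.x * Q.ys) * (3 * (Q.yr * Q.ys))⁻¹ := by
      intro i
      have h := ha i
      rw [nuI]
      cases hε : ε i with
      | true =>
        rw [evalAt_phiHat_of_weight_r (a := a i) (by simpa [hε] using h)]
        simp
        ring
      | false =>
        rw [evalAt_phiHat_of_weight_s h3 (a := a i) (by simpa [hε] using h)]
        simp
        ring
    rw [Finset.sum_congr rfl fun i _ => e i, ← Finset.sum_mul, Finset.sum_add_distrib,
      ← Finset.sum_mul, ← Finset.sum_mul, ← Polynomial.eval_finsetSum,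
      ← Polynomial.eval_finsetSum] at h
    rcases mul_eq_zero.1 h with h | h
    · exact h
    · exact absurd (inv_eq_zero.1 h) (mul_ne_zero (by norm_num) hQ)
  have hzero : ∀ x ∈ {x : ℂ | (kr b).eval x ≠ 0 ∧ (ks b).eval x ≠ 0 ∧ x ∉ T},
      (p true).eval x = 0 ∧ (p false).eval x = 0 := by
    rintro x ⟨hA, hB, hT⟩
    obtain ⟨P, Q, hP, hQ, nP, nQ, H⟩ := exists_affine_separating hA hB
    refine H _ _ ?_ ?_
    · have := heval P nP (hP ▸ hT)
      rwa [hP] at this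
    · have := heval Q nQ (hQ ▸ hT)
      rwa [hQ] at this
  have hp : ∀ e, p e = 0 := by
    intro e
    refine Polynomial.eq_zero_of_infinite_isRoot _
      ((infinite_regular_values b T).mono fun x hx => ?_)
    cases e
    · exact (hzero x hx).2
    · exact (hzero x hx).1
  funext i
  rw [← hcoeff i, hp]
  simp

theorem span_nuI_eq_top (h3 : Nat.Coprime 3 (2 * r + s)) (b : Fin (s + r) → ℂ) :
    Submodule.span ℂ {v : Fin (genus r s) → ℂ | ∃ Q : Affine b, Q.yr * Q.ys ≠ 0 ∧
      v = fun i => nuI i Q} = ⊤ := by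
  by_contra hne
  obtain ⟨f, hf, hker⟩ := Submodule.exists_le_ker_of_lt_top _ (lt_top_iff_ne_top.2 hne)
  refine hf ?_
  have happ : ∀ v : Fin (genus r s) → ℂ, f v = ∑ i, f (Pi.single i 1) * v i := by
    intro v
    conv_lhs => rw [pi_eq_sum_univ' v]
    rw [map_sum]
    refine Finset.sum_congr rfl fun i _ => ?_
    rw [map_smul, smul_eq_mul, mul_comm]
  have hc := nuI_independent h3 ∅ (c := fun i => f (Pi.single i 1)) (fun Q hQ _ => by
    rw [← happ]
    exact hker (Submodule.subset_span ⟨Q, hQ, rfl⟩))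
  ext v
  have := congrFun hc v
  simpa using this

/-- If `∑ ν^I_i(Q) δ_i(P)` is symmetric, the `δ_i` are linear combinations of the `ν^I_k`. -/
theorem exists_eq_sum_nuI (h3 : Nat.Coprime 3 (2 * r + s))
    {δ : Fin (genus r s) → Affine b → ℂ}
    (hδ : ∀ P Q : Affine b, Generic P Q → ∑ i, nuI i Q * δ i P = ∑ i, nuI i P * δ i Q) :
    ∃ c : Fin (genus r s) → Fin (genus r s) → ℂ, ∀ P : Affine b, P.yr * P.ys ≠ 0 →
      ∀ k, δ k P = ∑ i, c i k * nuI i P := by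
  have key : ∀ v : Fin (genus r s) → ℂ, ∃ (T : Finset ℂ) (c : Fin (genus r s) → ℂ),
      ∀ P : Affine b, P.yr * P.ys ≠ 0 → P.x ∉ T → ∑ i, v i * δ i P = ∑ k, c k * nuI k P := by
    intro v
    have hv : v ∈ Submodule.span ℂ {v : Fin (genus r s) → ℂ | ∃ Q : Affine b, Q.yr * Q.ys ≠ 0 ∧
      v = fun i => nuI i Q} := by
      rw [span_nuI_eq_top h3 b]
      trivial
    induction hv using Submodule.span_induction with
    | mem v hv =>
      obtain ⟨Q, hQ, rfl⟩ := hv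
      refine ⟨{Q.x}, fun k => δ k Q, fun P hP hx => ?_⟩
      rw [hδ P Q ⟨hP, hQ, by simpa using hx⟩]
      exact Finset.sum_congr rfl fun i _ => mul_comm _ _
    | zero => exact ⟨∅, 0, fun P _ _ => by simp⟩
    | add v w _ _ hv hw =>
      classical
      obtain ⟨T, c, h⟩ := hv
      obtain ⟨T', c', h'⟩ := hw
      refine ⟨T ∪ T', c + c', fun P hP hx => ?_⟩
      rw [Finset.mem_union, not_or] at hx
      simp only [Pi.add_apply, add_mul, Finset.sum_add_distrib, h P hP hx.1, h' P hP hx.2]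
    | smul a v _ hv =>
      obtain ⟨T, c, h⟩ := hv
      refine ⟨T, a • c, fun P hP hx => ?_⟩
      simp only [Pi.smul_apply, smul_eq_mul, mul_assoc, ← Finset.mul_sum, h P hP hx]
  classical
  choose T c hc using fun i : Fin (genus r s) => key (Pi.single i 1)
  have hc' : ∀ i (P : Affine b), P.yr * P.ys ≠ 0 → P.x ∉ Finset.univ.biUnion T →
      δ i P = ∑ k, c i k * nuI k P := by
    intro i P hP hx
    have hx : P.x ∉ T i := fun h => hx (Finset.mem_biUnion.2 ⟨i, Finset.mem_univ i, h⟩)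
    rw [← hc i P hP hx, Finset.sum_eq_single i]
    · simp
    · intro j _ hj
      simp [hj]
    · simp
  refine ⟨c, fun P hP => ?_⟩
  have hzero := nuI_independent h3 (insert P.x (Finset.univ.biUnion T))
    (c := fun k => δ k P - ∑ i, c i k * nuI i P) (fun Q hQ hx => by
    rw [Finset.mem_insert, not_or] at hx
    have h := hδ P Q ⟨hP, hQ, Ne.symm hx.1⟩
    have e : ∑ i, nuI i P * δ i Q = ∑ k, (∑ i, c i k * nuI i P) * nuI k Q := by
      simp only [hc' _ Q hQ hx.2, Finset.mul_sum, Finset.sum_mul]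
      rw [Finset.sum_comm]
      refine Finset.sum_congr rfl fun k _ => Finset.sum_congr rfl fun i _ => ?_
      ring
    rw [e] at h
    simp only [sub_mul, Finset.sum_sub_distrib, ← h]
    rw [sub_eq_zero]
    exact Finset.sum_congr rfl fun k _ => mul_comm _ _)
  intro k
  exact sub_eq_zero.1 (congrFun hzero k)

/-! ### The bidifferential as an element of `R ⊗ R` -/

/-- The coordinate functions `x`, `y_r̂`, `y_ŝ` in `R`. -/
def coord (b : Fin (s + r) → ℂ) (i : Fin 3) : CoordRing b :=
  Ideal.Quotient.mk (relIdeal b) (MvPolynomial.X i)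

theorem evalAt_coord_zero (P : Affine b) : evalAt P (coord b 0) = P.x := by
  simp [coord, evalAt_mk]

theorem evalAt_coord_one (P : Affine b) : evalAt P (coord b 1) = P.yr := by
  simp [coord, evalAt_mk]

theorem evalAt_coord_two (P : Affine b) : evalAt P (coord b 2) = P.ys := by
  simp [coord, evalAt_mk]

theorem evalAt_aeval (P : Affine b) (p : Polynomial ℂ) :
    evalAt P (Polynomial.aeval (coord b 0) p) = p.eval P.x := by
  rw [← Polynomial.aeval_algHom_apply, evalAt_coord_zero, Polynomial.coe_aeval_eq_eval]

theorem evalAt₂_tmul (P Q : Affine b) (u v : CoordRing b) :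
    evalAt₂ P Q (u ⊗ₜ v) = evalAt P u * evalAt Q v := by
  simp [evalAt₂]

/-- Outside the branch points, all associated differentials have the form of those of
`exists_associated`. -/
theorem exists_coordRing_of_isAssociated (h3 : Nat.Coprime 3 (2 * r + s))
    (hb : Function.Injective b) {nuII : Fin (genus r s) → Affine b → ℂ}
    (h : IsAssociated nuII) :
    ∃ G : Fin (genus r s) → CoordRing b, ∀ P : Affine b, P.yr * P.ys ≠ 0 →
      ∀ i, nuII i P = evalAt P (G i) / (3 * (P.yr * P.ys)) := by
  obtain ⟨p, q, h0⟩ := exists_associated h3 hb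
  obtain ⟨c, hc⟩ := exists_eq_sum_nuI h3 (δ := fun i P => nuII i P - algForm (p i) (q i) P) (by
    intro P Q hPQ
    have e1 := h.2 P Q hPQ
    rw [h0.2 P Q hPQ] at e1
    simp only [mul_sub, Finset.sum_sub_distrib] at e1 ⊢
    linear_combination -e1)
  refine ⟨fun k => Polynomial.aeval (coord b 0) (p k) * coord b 1 +
    Polynomial.aeval (coord b 0) (q k) * coord b 2 + ∑ i, c i k • phiHat b i, fun P hP k => ?_⟩
  have e := hc P hP k
  rw [sub_eq_iff_eq_add] at e
  rw [e]
  simp only [map_add, map_mul, map_sum, map_smul, evalAt_aeval, evalAt_coord_one,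
    evalAt_coord_two, algForm, nuI, smul_eq_mul, add_div, Finset.sum_div, mul_div_assoc]
  ring

theorem exists_tensor_of_isAssociated (h3 : Nat.Coprime 3 (2 * r + s))
    (hb : Function.Injective b) {nuII : Fin (genus r s) → Affine b → ℂ}
    (h : IsAssociated nuII) :
    ∃ F : CoordRing b ⊗[ℂ] CoordRing b, ∀ P₁ P₂ : Affine b, Generic P₁ P₂ →
      omega nuII P₁ P₂ =
        evalAt₂ P₁ P₂ F / (9 * (P₁.x - P₂.x) ^ 2 * P₁.yr * P₁.ys * P₂.yr * P₂.ys) := by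
  obtain ⟨G, hG⟩ := exists_coordRing_of_isAssociated h3 hb h
  let D : CoordRing b ⊗[ℂ] CoordRing b := coord b 0 ⊗ₜ 1 - 1 ⊗ₜ coord b 0
  let ev : Polynomial ℂ → CoordRing b ⊗[ℂ] CoordRing b := fun p =>
    1 ⊗ₜ Polynomial.aeval (coord b 0) p
  refine ⟨(3 : ℂ) • ((coord b 1 * coord b 2) ⊗ₜ (coord b 1 * coord b 2)) +
    (coord b 1 ⊗ₜ coord b 2) * (D * ev (logNumS b) + (3 : ℂ) • ev (kr b * ks b)) +
    (coord b 2 ⊗ₜ coord b 1) * (D * ev (logNumR b) + (3 : ℂ) • ev (kr b * ks b)) +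
    D * D * ∑ i : Fin (genus r s), phiHat b i ⊗ₜ G i, fun P Q hPQ => ?_⟩
  obtain ⟨hP, hQ, hx⟩ := id hPQ
  have hx : P.x - Q.x ≠ 0 := sub_ne_zero.2 hx
  have hD : evalAt₂ P Q D = P.x - Q.x := by
    simp [D, evalAt₂_tmul, evalAt_coord_zero]
  have hev : ∀ p, evalAt₂ P Q (ev p) = p.eval Q.x := fun p => by
    simp [ev, evalAt₂_tmul, evalAt_aeval]
  have hsum : ∑ i, nuI i P * nuII i Q = (∑ i : Fin (genus r s), evalAt P (phiHat b i) *
      evalAt Q (G i)) / (9 * (P.yr * P.ys) * (Q.yr * Q.ys)) := by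
    rw [Finset.sum_div]
    refine Finset.sum_congr rfl fun i _ => ?_
    rw [hG Q hQ, nuI, div_mul_div_comm]
    congr 1
    ring
  rw [omega, dSigma_eq hPQ, hsum]
  simp only [map_add, map_mul, map_smul, smul_eq_mul, hD, hev, evalAt₂_tmul, map_sum,
    evalAt_coord_one, evalAt_coord_two, dSigmaNum]
  have h1 := left_ne_zero_of_mul hP
  have h2 := right_ne_zero_of_mul hP
  have h4 := left_ne_zero_of_mul hQ
  have h5 := right_ne_zero_of_mul hQ
  field_simp

/-! ### The bidifferential along a pair of local parameters -/

theorem dSigma_analyticAt {γ : ℂ → Affine b} {τ : ℂ} {P : Affine b} (hP : P.yr * P.ys ≠ 0)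
    (hX : AnalyticAt ℂ (fun t => (γ t).x) τ) (hU : AnalyticAt ℂ (fun t => (γ t).yr) τ)
    (hV : AnalyticAt ℂ (fun t => (γ t).ys) τ) (hne : (γ τ).yr * (γ τ).ys ≠ 0)
    (hx : P.x ≠ (γ τ).x) : AnalyticAt ℂ (fun t => dSigma P (γ t)) τ := by
  have hS := AnalyticAt.eval_polynomial (logNumS b) hX
  have hR := AnalyticAt.eval_polynomial (logNumR b) hX
  have hAB := AnalyticAt.eval_polynomial (kr b * ks b) hX
  have h1 : AnalyticAt ℂ (fun t => dSigmaNum P (γ t) /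
      (9 * (P.x - (γ t).x) ^ 2 * (P.yr * P.ys) * ((γ t).yr * (γ t).ys))) τ := by
    refine AnalyticAt.fun_div ?_ (by fun_prop) ?_
    · unfold dSigmaNum
      fun_prop
    · exact mul_ne_zero (mul_ne_zero (mul_ne_zero (by norm_num)
        (pow_ne_zero _ (sub_ne_zero.2 hx))) hP) hne
  refine h1.congr ?_
  filter_upwards [(hU.continuousAt.mul hV.continuousAt).eventually_ne hne,
    hX.continuousAt.eventually_ne hx.symm] with t h2 h3
  exact (dSigma_eq ⟨hP, h2, h3.symm⟩).symm

/-- `d_Q Σ(P, Q)` is the differential of `Q ↦ Σ(P, Q)` along a parametrized curve. -/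
theorem hasDerivAt_sigma_comp {γ : ℂ → Affine b} {t : ℂ} {P : Affine b} (hP : P.yr * P.ys ≠ 0)
    (hX : AnalyticAt ℂ (fun t => (γ t).x) t) (hU : AnalyticAt ℂ (fun t => (γ t).yr) t)
    (hV : AnalyticAt ℂ (fun t => (γ t).ys) t) (hne : (γ t).yr * (γ t).ys ≠ 0)
    (hx : P.x ≠ (γ t).x) :
    HasDerivAt (fun t => sigma P (γ t)) (dSigma P (γ t) * deriv (fun t => (γ t).x) t) t := by
  have dX := hX.differentiableAt.hasDerivAt
  have dU := hasDerivAt_yr_comp hX hU hne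
  have dV := hasDerivAt_ys_comp hX hU hV hne
  have hx' : P.x - (γ t).x ≠ 0 := sub_ne_zero.2 hx
  have h1 := left_ne_zero_of_mul hP
  have h2 := right_ne_zero_of_mul hP
  have h3 := left_ne_zero_of_mul hne
  have h4 := right_ne_zero_of_mul hne
  have d : HasDerivAt (fun t => sigma P (γ t)) _ t :=
    (((dV.const_mul P.yr).const_add (P.yr * P.ys)).add (dU.mul_const P.ys)).div
      (((dX.const_sub P.x).const_mul 3).mul_const (P.yr * P.ys))
      (mul_ne_zero (mul_ne_zero (by norm_num) hx') hP)
  refine d.congr_deriv ?_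
  have hAB : (kr b * ks b).eval (γ t).x = (γ t).yr * (γ t).ys := by
    rw [Polynomial.eval_mul, (γ t).yr_mul_ys]
  rw [dSigma_eq ⟨hP, hne, hx⟩, dSigmaNum, hAB]
  simp only [Pi.add_apply]
  field_simp
  ring

/-- The singularity of `d_Q Σ(P, Q)` at the points `Q` over `x(P)`: no residue, and a double pole
whose coefficient vanishes unless `Q = P`. -/
theorem removable_dSigma_sub {γ : ℂ → Affine b} {τ : ℂ} {P : Affine b} (hP : P.yr * P.ys ≠ 0)
    (hX : AnalyticAt ℂ (fun t => (γ t).x) τ) (hU : AnalyticAt ℂ (fun t => (γ t).yr) τ)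
    (hV : AnalyticAt ℂ (fun t => (γ t).ys) τ) (hne : (γ τ).yr * (γ τ).ys ≠ 0)
    (hX' : deriv (fun t => (γ t).x) τ ≠ 0) (hx : P.x = (γ τ).x) :
    Removable (fun t => deriv (fun t => (γ t).x) τ * (dSigma P (γ t) *
      deriv (fun t => (γ t).x) t) -
      (1 + (γ τ).ys / P.ys + (γ τ).yr / P.yr) / 3 / (t - τ) ^ 2) τ := by
  have h1 := left_ne_zero_of_mul hP
  have h2 := right_ne_zero_of_mul hP
  obtain ⟨q, hq, hq0, hXq⟩ := exists_eq_sub_mul_of_eq_zero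
    (U := fun t => (γ t).x - (γ τ).x) (x := τ) (hX.sub analyticAt_const) (sub_self _)
  have hq0' : q τ = deriv (fun t => (γ t).x) τ := by rw [hq0, deriv_sub_const]
  have hqne : q τ ≠ 0 := hq0' ▸ hX'
  set κ := deriv (fun t => (γ t).x) τ with hκ
  set e := (1 + (γ τ).ys / P.ys + (γ τ).yr / P.yr) / 3 with he
  have hφ : AnalyticAt ℂ (fun t => κ * ((1 + (γ t).ys / P.ys + (γ t).yr / P.yr) / 3) / q t - e)
      τ := by
    refine AnalyticAt.sub (AnalyticAt.div ?_ hq hqne) analyticAt_const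
    have a1 := hU.div_const (c := P.yr)
    have a2 := hV.div_const (c := P.ys)
    exact analyticAt_const.mul (((analyticAt_const.add a2).add a1).div_const)
  obtain ⟨χ, hχ, -, hφχ⟩ := exists_eq_sub_mul_of_eq_zero hφ (by
    rw [hq0', ← he]
    field_simp
    ring)
  have hsigma : ∀ᶠ t in 𝓝 τ, t ≠ τ → κ * sigma P (γ t) = -e * (t - τ)⁻¹ - χ t := by
    filter_upwards [hq.continuousAt.eventually_ne hqne] with t hqt ht
    have ht' : t - τ ≠ 0 := sub_ne_zero.2 ht
    have e1 := hXq t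
    have e2 := hφχ t
    have e3 : P.x - (γ t).x = -((t - τ) * q t) := by rw [← e1, hx]; ring
    have e4 : sigma P (γ t) = ((1 + (γ t).ys / P.ys + (γ t).yr / P.yr) / 3) / (P.x - (γ t).x) := by
      have : P.x - (γ t).x ≠ 0 := by
        rw [e3]
        exact neg_ne_zero.2 (mul_ne_zero ht' hqt)
      rw [sigma]
      field_simp
    have e5 : χ t = (κ * ((1 + (γ t).ys / P.ys + (γ t).yr / P.yr) / 3) / q t - e) / (t - τ) := by
      rw [e2]
      field_simp
    rw [e4, e3, e5]
    field_simp
    ring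
  refine ⟨fun t => -deriv χ t, hχ.deriv.neg, ?_⟩
  have hsig : ∀ᶠ t in 𝓝[≠] τ, κ * sigma P (γ t) = -e * (t - τ)⁻¹ - χ t :=
    eventually_nhdsWithin_iff.2 hsigma
  filter_upwards [eventually_eventually_nhdsWithin.2 hsig, self_mem_nhdsWithin,
    nhdsWithin_le_nhds hχ.eventually_analyticAt, nhdsWithin_le_nhds hX.eventually_analyticAt,
    nhdsWithin_le_nhds hU.eventually_analyticAt, nhdsWithin_le_nhds hV.eventually_analyticAt,
    nhdsWithin_le_nhds (hq.continuousAt.eventually_ne hqne),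
    nhdsWithin_le_nhds ((hU.continuousAt.mul hV.continuousAt).eventually_ne hne)] with
    t hev (ht : t ≠ τ) aχ aX aU aV hqt hnet
  rw [isOpen_compl_singleton.nhdsWithin_eq ht] at hev
  have ht' : t - τ ≠ 0 := sub_ne_zero.2 ht
  have hxt : P.x ≠ (γ t).x := by
    rw [hx, ne_comm, ← sub_ne_zero, hXq]
    exact mul_ne_zero ht' hqt
  have d1 := (hasDerivAt_sigma_comp hP aX aU aV hnet hxt).const_mul κ
  have d2 : HasDerivAt (fun t => -e * (t - τ)⁻¹ - χ t) _ t :=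
    ((((hasDerivAt_id t).sub_const τ).inv ht').const_mul (-e)).sub aχ.differentiableAt.hasDerivAt
  have d3 := (d1.congr_of_eventuallyEq (f₁ := fun t => -e * (t - τ)⁻¹ - χ t)
    (by filter_upwards [hev] with y hy using hy.symm)).unique d2
  rw [d3]
  simp only [id]
  field_simp
  ring

/-- The form `P ↦ Ω(P, Q)` is holomorphic off the points over `x(Q)`, uniformly for `Q` in a
compact set: in a local parameter at any point of the compact curve, it extends to an analytic
family of continuous functions of `Q`. -/
theorem exists_analytic_family (hrs : r < s) (h3 : Nat.Coprime 3 (2 * r + s))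
    (hb : Function.Injective b) {p : Curve b} {γ : ℂ → Affine b} (hγ : IsLocalParam p γ)
    {K : Type*} [TopologicalSpace K] [CompactSpace K] {Q : K → Affine b} (hQ : Continuous Q)
    (hne : ∀ k, (Q k).yr * (Q k).ys ≠ 0) (hx : ∀ k, ¬ IsXCoord p (Q k).x)
    (β : Fin (genus r s) → C(K, ℂ)) :
    ∃ F : ℂ → C(K, ℂ), AnalyticAt ℂ F 0 ∧ ∀ᶠ t in 𝓝[≠] (0 : ℂ), ∀ k, (γ t).x ≠ (Q k).x ∧
      F t k = deriv (fun t => (γ t).x) t *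
        (dSigma (γ t) (Q k) + ∑ i, nuI i (γ t) * β i k) := by
  obtain ⟨ζ, η, hζ, hη, hζη, hcoord, ⟨m, hm, em⟩, ⟨mU, hmU, emU⟩, ⟨mV, hmV, emV⟩⟩ :=
    hγ.exists_normalization hrs hb
  choose n hn en using fun i => nuI_removable h3 hb i hγ
  have cx : Continuous fun k => (Q k).x := Affine.continuous_x.comp hQ
  have cu : Continuous fun k => (Q k).yr := Affine.continuous_yr.comp hQ
  have cv : Continuous fun k => (Q k).ys := Affine.continuous_ys.comp hQ
  have hu : ∀ k, (Q k).yr ≠ 0 := fun k => left_ne_zero_of_mul (hne k)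
  have hv : ∀ k, (Q k).ys ≠ 0 := fun k => right_ne_zero_of_mul (hne k)
  have cS : Continuous fun k => (logNumS b).eval (Q k).x := (logNumS b).continuous.comp cx
  have cR : Continuous fun k => (logNumR b).eval (Q k).x := (logNumR b).continuous.comp cx
  have cAB : Continuous fun k => (kr b * ks b).eval (Q k).x := (kr b * ks b).continuous.comp cx
  let ξ : C(K, ℂ) := ⟨_, cx⟩
  let c₁ : C(K, ℂ) := ⟨fun k => (logNumS b).eval (Q k).x / (Q k).yr, cS.div₀ cu hu⟩
  let c₂ : C(K, ℂ) := ⟨fun k => 3 * (kr b * ks b).eval (Q k).x / (Q k).yr,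
    (continuous_const.mul cAB).div₀ cu hu⟩
  let d₁ : C(K, ℂ) := ⟨fun k => (logNumR b).eval (Q k).x / (Q k).ys, cR.div₀ cv hv⟩
  let d₂ : C(K, ℂ) := ⟨fun k => 3 * (kr b * ks b).eval (Q k).x / (Q k).ys,
    (continuous_const.mul cAB).div₀ cv hv⟩
  -- `D t = ζ t (x(γ t) - x(Q))`, as a function of `Q`, is invertible for `t = 0`.
  let D : ℂ → C(K, ℂ) := fun t => η t • (1 : C(K, ℂ)) - ζ t • ξ
  have hD : AnalyticAt ℂ D 0 := (hη.smul analyticAt_const).sub (hζ.smul analyticAt_const)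
  have hDunit : IsUnit (D 0) := by
    rw [ContinuousMap.isUnit_iff_forall_ne_zero]
    intro k
    simpa [D, ξ] using hcoord _ (hx k)
  have hRan : AnalyticAt ℂ (fun t => Ring.inverse (D t)) 0 := by
    have h0 : AnalyticAt ℂ Ring.inverse (D 0) := by
      obtain ⟨z, hz⟩ := hDunit
      rw [← hz]
      exact analyticAt_inverse z
    exact h0.fun_comp hD
  have hDev : ∀ᶠ t in 𝓝 (0 : ℂ), IsUnit (D t) :=
    hD.continuousAt.eventually (Units.isOpen.mem_nhds hDunit)
  let R : ℂ → C(K, ℂ) := fun t => Ring.inverse (D t)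
  have hR : AnalyticAt ℂ R 0 := hRan
  refine ⟨fun t => (1 / 9 : ℂ) • ((3 * m t) • R t ^ 2 + mV t • (R t * c₁) +
    (mV t * ζ t) • (R t ^ 2 * c₂) + mU t • (R t * d₁) + (mU t * ζ t) • (R t ^ 2 * d₂)) +
    ∑ i, n i t • β i, ?_, ?_⟩
  · have hsum : AnalyticAt ℂ (fun t => ∑ i, n i t • β i) 0 :=
      Finset.analyticAt_fun_sum _ fun i _ => (hn i).fun_smul analyticAt_const
    fun_prop
  · filter_upwards [hζη, em, emU, emV, nhdsWithin_le_nhds hDev, hγ.eventually_ne hb,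
      eventually_all.2 en] with t ⟨hζ0, hηt⟩ e1 e2 e3 hDt ⟨hPne, _⟩ e4 k
    have hDk : D t k ≠ 0 := (ContinuousMap.isUnit_iff_forall_ne_zero _).1 hDt k
    have hDk' : D t k = ζ t * ((γ t).x - (Q k).x) := by
      simp only [D, ξ, ContinuousMap.sub_apply, ContinuousMap.smul_apply, ContinuousMap.one_apply,
        ContinuousMap.coe_mk, smul_eq_mul, hηt]
      ring
    have hxk : (γ t).x - (Q k).x ≠ 0 := by
      rw [hDk'] at hDk
      exact right_ne_zero_of_mul hDk
    have hRk : R t k = (ζ t * ((γ t).x - (Q k).x))⁻¹ := by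
      have h1 := DFunLike.congr_fun (Ring.inverse_mul_cancel _ hDt) k
      rw [← hDk']
      exact eq_inv_of_mul_eq_one_left h1
    refine ⟨sub_ne_zero.1 hxk, ?_⟩
    have hsum : (∑ i, n i t • β i) k =
        deriv (fun t => (γ t).x) t * ∑ i, nuI i (γ t) * β i k := by
      rw [ContinuousMap.sum_apply, Finset.mul_sum]
      refine Finset.sum_congr rfl fun i _ => ?_
      rw [ContinuousMap.smul_apply, smul_eq_mul, ← e4 i]
      ring
    rw [ContinuousMap.add_apply, hsum, mul_add, dSigma_eq ⟨hPne, hne k, sub_ne_zero.1 hxk⟩]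
    congr 1
    simp only [ContinuousMap.add_apply, ContinuousMap.smul_apply, ContinuousMap.mul_apply,
      ContinuousMap.pow_apply, smul_eq_mul, hRk, ← e1, ← e2, ← e3, dSigmaNum]
    have h1 := left_ne_zero_of_mul hPne
    have h2 := right_ne_zero_of_mul hPne
    have h4 := hu k
    have h5 := hv k
    simp only [c₁, c₂, d₁, d₂, ContinuousMap.coe_mk]
    field_simp
    ring

/-! ### The fundamental bidifferential -/

theorem IsLocalParam.eventually_not_isXCoord (hb : Function.Injective b) {p : Curve b}
    {γ : ℂ → Affine b} (hγ : IsLocalParam p γ) (q : Curve b) :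
    ∀ᶠ t in 𝓝[≠] (0 : ℂ), ¬ IsXCoord q (γ t).x := by
  by_cases hq : ∃ Q : Affine b, q = Q
  · obtain ⟨Q, rfl⟩ := hq
    filter_upwards [hγ.eventually_x_ne hb Q.x] with t ht ⟨Q', hQ', e⟩
    rw [OnePoint.coe_injective hQ'] at ht
    exact ht e.symm
  · exact Eventually.of_forall fun t ⟨Q, hQ, _⟩ => hq ⟨Q, hQ⟩

theorem IsAssociated.omega_symm {nuII : Fin (genus r s) → Affine b → ℂ}
    (h : IsAssociated nuII) {P Q : Affine b} (hPQ : Generic P Q) :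
    omega nuII P Q = omega nuII Q P := by
  have e := h.2 P Q hPQ
  rw [Finset.sum_sub_distrib] at e
  simp only [omega]
  linear_combination e

/-- `γ` is a regular parametrization of the unramified part of the affine curve near `τ`, and the
functions `nuII i` are holomorphic along it. -/
structure GoodAt (nuII : Fin (genus r s) → Affine b → ℂ) (γ : ℂ → Affine b) (τ : ℂ) : Prop where
  x : AnalyticAt ℂ (fun t => (γ t).x) τ
  yr : AnalyticAt ℂ (fun t => (γ t).yr) τ
  ys : AnalyticAt ℂ (fun t => (γ t).ys) τ
  not_branch : (γ τ).yr * (γ τ).ys ≠ 0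
  deriv_ne : deriv (fun t => (γ t).x) τ ≠ 0
  nuII : ∀ i, AnalyticAt ℂ (fun t => nuII i (γ t)) τ

theorem IsAssociated.eventually_goodAt (hb : Function.Injective b)
    {nuII : Fin (genus r s) → Affine b → ℂ} (h : IsAssociated nuII) {p : Curve b}
    {γ : ℂ → Affine b} (hγ : IsLocalParam p γ) : ∀ᶠ t in 𝓝[≠] (0 : ℂ), GoodAt nuII γ t := by
  have h1 : ∀ i, ∀ᶠ t in 𝓝[≠] (0 : ℂ), AnalyticAt ℂ (pull (nuII i) γ) t := fun i =>
    ((h.1 i).1.1 p γ hγ).eventually_analyticAt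
  filter_upwards [hγ.eventually_analyticAt, hγ.eventually_ne hb, eventually_all.2 h1] with
    t ⟨hX, hU, hV⟩ ⟨hne, hd⟩ hn
  refine ⟨hX, hU, hV, hne, hd, fun i => ?_⟩
  refine ((hn i).div hX.deriv hd).congr ?_
  filter_upwards [hX.deriv.continuousAt.eventually_ne hd] with y hy
  exact mul_div_cancel_right₀ _ hy

theorem GoodAt.analyticAt_omega {nuII : Fin (genus r s) → Affine b → ℂ} {γ : ℂ → Affine b} {τ : ℂ}
    (h : GoodAt nuII γ τ) {P : Affine b} (hP : P.yr * P.ys ≠ 0) (hx : P.x ≠ (γ τ).x) :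
    AnalyticAt ℂ (fun t => omega nuII P (γ t) * deriv (fun t => (γ t).x) t) τ := by
  refine AnalyticAt.fun_mul (AnalyticAt.fun_add ?_ ?_) h.x.deriv
  · exact dSigma_analyticAt hP h.x h.yr h.ys h.not_branch hx
  · exact Finset.analyticAt_fun_sum _ fun i _ => analyticAt_const.mul (h.nuII i)

theorem GoodAt.removable_omega_sub {nuII : Fin (genus r s) → Affine b → ℂ} {γ : ℂ → Affine b}
    {τ : ℂ} (h : GoodAt nuII γ τ) {P : Affine b} (hP : P.yr * P.ys ≠ 0) (hx : P.x = (γ τ).x) :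
    Removable (fun t => deriv (fun t => (γ t).x) τ *
      (omega nuII P (γ t) * deriv (fun t => (γ t).x) t) -
      (1 + (γ τ).ys / P.ys + (γ τ).yr / P.yr) / 3 / (t - τ) ^ 2) τ := by
  have h1 := removable_dSigma_sub hP h.x h.yr h.ys h.not_branch h.deriv_ne hx
  have h2 : AnalyticAt ℂ (fun t => deriv (fun t => (γ t).x) τ *
      ((∑ i, nuI i P * nuII i (γ t)) * deriv (fun t => (γ t).x) t)) τ :=
    analyticAt_const.mul (AnalyticAt.fun_mul
      (Finset.analyticAt_fun_sum _ fun i _ => analyticAt_const.mul (h.nuII i)) h.x.deriv)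
  refine (h1.add h2.removable).congr (Eventually.of_forall fun t => ?_)
  simp only [omega]
  ring

/-- By symmetry, `Ω(P, Q)` is holomorphic in `Q` at every point of the compact curve which is not
over `x(P)`. -/
theorem IsAssociated.removable_omega (hrs : r < s) (h3 : Nat.Coprime 3 (2 * r + s))
    (hb : Function.Injective b) {nuII : Fin (genus r s) → Affine b → ℂ} (h : IsAssociated nuII)
    {q : Curve b} {γ : ℂ → Affine b} (hγ : IsLocalParam q γ) {P : Affine b}
    (hP : P.yr * P.ys ≠ 0) (hx : ¬ IsXCoord q P.x) :
    Removable (fun t => omega nuII P (γ t) * deriv (fun t => (γ t).x) t) 0 := by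
  obtain ⟨F, hF, e⟩ := exists_analytic_family hrs h3 hb hγ (K := Unit) (Q := fun _ => P)
    continuous_const (fun _ => hP) (fun _ => hx) (fun i => .const Unit (nuII i P))
  refine ⟨fun t => F t (), ?_, ?_⟩
  · exact ((ContinuousMap.evalCLM ℂ ()).analyticAt _).fun_comp hF
  · filter_upwards [e, hγ.eventually_ne hb] with t ht ⟨hn, _⟩
    rw [(ht ()).2, h.omega_symm ⟨hP, hn, (ht ()).1.symm⟩, omega, mul_comm]
    rfl

/-- The local structure of `Ω` at a pair of points of the compact curve. The singular part is
`ε / (t₁ - t₂)²`, where `ε` is `1` on the diagonal and `0` off the diagonal. The rest is the Cauchy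
integral of its values on a circle in the `t₂`-plane: these are analytic in `t₁`, and for each
`t₁ ≠ 0` they extend to a holomorphic function of `t₂` in the disc. -/
theorem IsAssociated.exists_pull₂_eq (hrs : r < s) (h3 : Nat.Coprime 3 (2 * r + s))
    (hb : Function.Injective b) {nuII : Fin (genus r s) → Affine b → ℂ} (h : IsAssociated nuII)
    {p q : Curve b} {γ₁ γ₂ : ℂ → Affine b} (hγ₁ : IsLocalParam p γ₁) (hγ₂ : IsLocalParam q γ₂)
    {ε : ℂ} (hε : ε = 0 ∨ γ₁ = γ₂)
    (hsep : ∀ᶠ t in 𝓝 ((0, 0) : ℂ × ℂ), t.1 ≠ 0 → t.2 ≠ 0 → γ₁ t.1 = γ₂ t.2 →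
      ε = 1 ∧ t.1 = t.2) :
    ∃ H : ℂ × ℂ → ℂ, AnalyticAt ℂ H (0, 0) ∧
      ∀ᶠ t in 𝓝 ((0, 0) : ℂ × ℂ), t.1 ≠ 0 → t.2 ≠ 0 → Generic (γ₁ t.1) (γ₂ t.2) →
        pull₂ (omega nuII) γ₁ γ₂ t = ε / (t.1 - t.2) ^ 2 + H t := by
  obtain ⟨ρ, hρ, hgood, hxc, hinj⟩ : ∃ ρ : ℝ, 0 < ρ ∧
      (∀ w : ℂ, ‖w‖ ≤ ρ → w ≠ 0 → GoodAt nuII γ₂ w) ∧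
      (∀ w : ℂ, ‖w‖ ≤ ρ → w ≠ 0 → ¬ IsXCoord p (γ₂ w).x) ∧
      (∀ t w : ℂ, ‖t‖ ≤ ρ → ‖w‖ ≤ ρ → t ≠ 0 → w ≠ 0 → γ₁ t = γ₂ w → ε = 1 ∧ t = w) := by
    have h1 := (h.eventually_goodAt hb hγ₂).and (hγ₂.eventually_not_isXCoord hb p)
    rw [eventually_nhdsWithin_iff] at h1
    obtain ⟨ρ₁, hρ₁, h1⟩ := Metric.eventually_nhds_iff_ball.1 h1
    obtain ⟨ρ₂, hρ₂, h2⟩ := Metric.eventually_nhds_iff_ball.1 hsep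
    have hρ : 0 < min ρ₁ ρ₂ := lt_min hρ₁ hρ₂
    have l1 : ∀ w : ℂ, ‖w‖ ≤ min ρ₁ ρ₂ / 2 → ‖w‖ < ρ₁ := fun w hw =>
      hw.trans_lt ((half_lt_self hρ).trans_le (min_le_left _ _))
    have l2 : ∀ w : ℂ, ‖w‖ ≤ min ρ₁ ρ₂ / 2 → ‖w‖ < ρ₂ := fun w hw =>
      hw.trans_lt ((half_lt_self hρ).trans_le (min_le_right _ _))
    refine ⟨min ρ₁ ρ₂ / 2, half_pos hρ, fun w hw n => (h1 w (by simpa using l1 w hw) n).1,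
      fun w hw n => (h1 w (by simpa using l1 w hw) n).2, fun t w ht hw => h2 (t, w) ?_⟩
    rw [Metric.mem_ball, Prod.dist_eq]
    simpa using ⟨l2 t ht, l2 w hw⟩
  have hs : ∀ w : Metric.sphere (0 : ℂ) ρ, ‖(w : ℂ)‖ = ρ := fun w => by simp
  have hgs : ∀ w : Metric.sphere (0 : ℂ) ρ, GoodAt nuII γ₂ w := fun w =>
    hgood w (hs w).le (norm_pos_iff.1 (hρ.trans_eq (hs w).symm))
  have hxs : ∀ w : Metric.sphere (0 : ℂ) ρ, ¬ IsXCoord p (γ₂ w).x := fun w =>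
    hxc w (hs w).le (norm_pos_iff.1 (hρ.trans_eq (hs w).symm))
  have cont : ∀ f : ℂ → ℂ, (∀ w : Metric.sphere (0 : ℂ) ρ, AnalyticAt ℂ f w) →
      Continuous fun w : Metric.sphere (0 : ℂ) ρ => f w := fun f hf =>
    continuous_iff_continuousAt.2 fun w =>
      ContinuousAt.comp' (g := f) (hf w).continuousAt continuous_subtype_val.continuousAt
  have hQ : Continuous fun w : Metric.sphere (0 : ℂ) ρ => γ₂ w :=
    Topology.IsInducing.subtypeVal.continuous_iff.2
      ((cont _ fun w => (hgs w).x).prodMk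
        ((cont _ fun w => (hgs w).yr).prodMk (cont _ fun w => (hgs w).ys)))
  let D : C(Metric.sphere (0 : ℂ) ρ, ℂ) := ⟨_, cont _ fun w => (hgs w).x.deriv⟩
  obtain ⟨F₀, hF₀, eF₀⟩ := exists_analytic_family hrs h3 hb hγ₁ hQ (fun w => (hgs w).not_branch)
    hxs (fun i => ⟨_, cont _ fun w => (hgs w).nuII i⟩)
  let ι : C(Metric.sphere (0 : ℂ) ρ, ℂ) := ⟨fun w => (w : ℂ), continuous_subtype_val⟩
  -- `ε / (t₁ - t₂)²` as an analytic family of functions of `t₂` on the circle.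
  let T : ℂ → C(Metric.sphere (0 : ℂ) ρ, ℂ) := fun t => algebraMap ℂ _ t - ι
  have hTu : ∀ t : ℂ, ‖t‖ < ρ → IsUnit (T t) := by
    intro t ht
    rw [ContinuousMap.isUnit_iff_forall_ne_zero]
    intro w h0
    have : t = (w : ℂ) := by simpa [T, ι, sub_eq_zero] using h0
    rw [this, hs] at ht
    exact lt_irrefl _ ht
  have hT : AnalyticAt ℂ (fun t => Ring.inverse (T t)) 0 := by
    have h0 : AnalyticAt ℂ Ring.inverse (T 0) := by
      obtain ⟨z, hz⟩ := hTu 0 (by simpa using hρ)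
      rw [← hz]
      exact analyticAt_inverse z
    exact h0.fun_comp (((Algebra.linearMap ℂ
      C(Metric.sphere (0 : ℂ) ρ, ℂ)).toContinuousLinearMap.analyticAt _).sub analyticAt_const)
  obtain ⟨H, hH, eH⟩ := exists_analyticAt_cauchyIntegral hρ
    (F := fun t => F₀ t * D - ε • Ring.inverse (T t) ^ 2) (by fun_prop)
  refine ⟨H, hH, ?_⟩
  have hball : Metric.ball (0 : ℂ) ρ ∈ 𝓝 (0 : ℂ) := Metric.ball_mem_nhds _ hρ
  have hball' : ∀ᶠ t in 𝓝[≠] (0 : ℂ), t ∈ Metric.ball (0 : ℂ) ρ := nhdsWithin_le_nhds hball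
  have ev1 := hball'.and ((hγ₁.eventually_not_isXCoord hb q).and eF₀)
  rw [eventually_nhdsWithin_iff] at ev1
  filter_upwards [(continuous_fst.tendsto ((0, 0) : ℂ × ℂ)).eventually ev1,
    (continuous_snd.tendsto ((0, 0) : ℂ × ℂ)).eventually hball] with ⟨t₁, t₂⟩ ev hb₂ n₁ n₂ hgen
  dsimp only at ev hb₂ n₁ n₂ hgen ⊢
  obtain ⟨hb₁, hxq, eF⟩ := ev n₁
  rw [mem_ball_zero_iff] at hb₁
  rw [dist_zero_right] at hb₂
  set κ := deriv (fun t => (γ₁ t).x) t₁ with hκ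
  let m : ℂ → ℂ := fun τ => κ * (omega nuII (γ₁ t₁) (γ₂ τ) * deriv (fun t => (γ₂ t).x) τ) -
    ε / (t₁ - τ) ^ 2
  -- Off the diagonal the subtracted term is holomorphic.
  have hpole : ∀ τ, γ₁ t₁ ≠ γ₂ τ → AnalyticAt ℂ (fun τ => ε / (t₁ - τ) ^ 2) τ := by
    intro τ hτ
    rcases hε with rfl | rfl
    · simpa using analyticAt_const
    · refine AnalyticAt.fun_div analyticAt_const (by fun_prop) (pow_ne_zero _ (sub_ne_zero.2 ?_))
      rintro rfl
      exact hτ rfl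
  have hman : ∀ τ, ‖τ‖ ≤ ρ → τ ≠ 0 → (γ₁ t₁).x ≠ (γ₂ τ).x → AnalyticAt ℂ m τ := by
    intro τ hτ hτ0 hx
    exact (analyticAt_const.mul ((hgood τ hτ hτ0).analyticAt_omega hgen.1 hx)).sub
      (hpole τ fun e => hx (by rw [e]))
  have hrem : ∀ τ ∈ Metric.closedBall (0 : ℂ) ρ, Removable m τ := by
    intro τ hτ
    rw [mem_closedBall_zero_iff] at hτ
    by_cases hτ0 : τ = 0
    · -- Here symmetry enters: `Ω(P, Q)` is known to be holomorphic in `P`.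
      subst hτ0
      have a : AnalyticAt ℂ (fun τ => ε / (t₁ - τ) ^ 2) 0 :=
        AnalyticAt.fun_div analyticAt_const (by fun_prop) (pow_ne_zero _ (by simpa using n₁))
      exact (((Removable.const κ).mul (h.removable_omega hrs h3 hb hγ₂ hgen.1 hxq))).sub a.removable
    by_cases hx : (γ₁ t₁).x = (γ₂ τ).x
    swap
    · exact (hman τ hτ hτ0 hx).removable
    have hg := hgood τ hτ hτ0
    have hr := hg.removable_omega_sub hgen.1 hx
    by_cases hPQ : γ₁ t₁ = γ₂ τ
    · -- `Q = P`: this forces `τ = t₁`, and the coefficient of the double pole is `1`.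
      obtain ⟨rfl, rfl⟩ := hinj t₁ τ hb₁.le hτ n₁ hτ0 hPQ
      obtain rfl : γ₁ = γ₂ := hε.resolve_left one_ne_zero
      refine hr.congr (Eventually.of_forall fun t => ?_)
      have h1 := left_ne_zero_of_mul hgen.1
      have h2 := right_ne_zero_of_mul hgen.1
      simp only [m, κ]
      rw [div_self h1, div_self h2, ← neg_sub t₁ t, neg_sq]
      norm_num
    · -- `Q ≠ P` over the same `x`: the coefficient of the double pole vanishes.
      have h0 : (1 + (γ₂ τ).ys / (γ₁ t₁).ys + (γ₂ τ).yr / (γ₁ t₁).yr) = 0 :=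
        one_add_div_add_div_eq_zero hgen.1 hx hPQ
      rw [h0] at hr
      have hr' := ((Removable.const (κ / deriv (fun t => (γ₂ t).x) τ)).mul hr).sub
        (hpole τ hPQ).removable
      refine hr'.congr (Eventually.of_forall fun t => ?_)
      have := hg.deriv_ne
      simp only [m]
      field_simp
      ring
  obtain ⟨G, hG, eG⟩ := exists_analyticAt_of_removable hrem
  have hx₂ : (γ₁ t₁).x ≠ (γ₂ t₂).x := hgen.2.2
  rw [eH t₁ t₂ hb₂ G hG, eG t₂ (by simpa using hb₂.le) (hman t₂ hb₂.le n₂ hx₂).continuousAt]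
  · simp only [m, pull₂]
    ring
  · intro w
    have hw : (w : ℂ) ∈ Metric.closedBall (0 : ℂ) ρ := by simp
    rw [eG w hw (hman w (hs w).le (norm_pos_iff.1 (hρ.trans_eq (hs w).symm))
      (eF w).1).continuousAt]
    have hRw : Ring.inverse (T t₁) w = (t₁ - w)⁻¹ := by
      have h2 := DFunLike.congr_fun (Ring.inverse_mul_cancel _ (hTu t₁ hb₁)) w
      exact eq_inv_of_mul_eq_one_left h2
    simp only [ContinuousMap.sub_apply, ContinuousMap.mul_apply, ContinuousMap.smul_apply,
      ContinuousMap.pow_apply, smul_eq_mul, hRw, (eF w).2, m, D, ContinuousMap.coe_mk, omega]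
    rw [inv_pow, div_eq_mul_inv]
    ring

theorem IsAssociated.isFundamentalSecondKind (hrs : r < s) (h3 : Nat.Coprime 3 (2 * r + s))
    (hb : Function.Injective b) {nuII : Fin (genus r s) → Affine b → ℂ} (h : IsAssociated nuII) :
    IsFundamentalSecondKind (omega nuII) := by
  refine ⟨fun P Q hPQ => h.omega_symm hPQ, fun p q γ₁ γ₂ hpq hγ₁ hγ₂ => ?_, fun p γ hγ => ?_⟩
  · obtain ⟨H, hH, e⟩ := h.exists_pull₂_eq hrs h3 hb hγ₁ hγ₂ (ε := 0) (.inl rfl)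
      ((eventually_ne_of_ne hb hpq hγ₁ hγ₂).mono fun t ht n₁ n₂ e => absurd e (ht n₁ n₂))
    exact ⟨H, hH, by simpa using e⟩
  · exact h.exists_pull₂_eq hrs h3 hb hγ hγ (ε := 1) (.inr rfl)
      ((hγ.eventually_injective h3).mono fun t ht n₁ n₂ e => ⟨rfl, ht n₁ n₂ e⟩)

end TrigonalCurve

end

theorem mainTheorem6 (r s : ℕ) (hrs : r < s) (h3 : Nat.Coprime 3 (2 * r + s))
    (b : Fin (s + r) → ℂ) (hb : Function.Injective b) :
    (∀ P₁ P₂ : TrigonalCurve.Affine b, P₁ ≠ P₂ →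
      TrigonalCurve.IsThirdKind (TrigonalCurve.thirdKind P₁ P₂) ∧
      (∀ p : TrigonalCurve.Curve b, p ≠ (P₁ : TrigonalCurve.Curve b) →
        p ≠ (P₂ : TrigonalCurve.Curve b) →
        TrigonalCurve.IsRegularAt (TrigonalCurve.thirdKind P₁ P₂) p) ∧
      TrigonalCurve.HasSimplePoleAt (TrigonalCurve.thirdKind P₁ P₂) (P₁ : TrigonalCurve.Curve b) ∧
      TrigonalCurve.HasResidueAt (TrigonalCurve.thirdKind P₁ P₂) (P₁ : TrigonalCurve.Curve b) 1 ∧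
      TrigonalCurve.HasSimplePoleAt (TrigonalCurve.thirdKind P₁ P₂) (P₂ : TrigonalCurve.Curve b) ∧
      TrigonalCurve.HasResidueAt (TrigonalCurve.thirdKind P₁ P₂)
        (P₂ : TrigonalCurve.Curve b) (-1)) ∧
    (∀ P Q : TrigonalCurve.Affine b, TrigonalCurve.Generic P Q →
      TrigonalCurve.HasXDerivAt (fun Q' => TrigonalCurve.sigma P Q') Q
        (TrigonalCurve.dSigma P Q)) ∧
    (∃ nuII : Fin (TrigonalCurve.genus r s) → TrigonalCurve.Affine b → ℂ,
      TrigonalCurve.IsAssociated nuII) ∧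
    (∀ nuII : Fin (TrigonalCurve.genus r s) → TrigonalCurve.Affine b → ℂ,
      TrigonalCurve.IsAssociated nuII →
      TrigonalCurve.IsFundamentalSecondKind (TrigonalCurve.omega nuII) ∧
      ∃ F : TrigonalCurve.CoordRing b ⊗[ℂ] TrigonalCurve.CoordRing b,
        ∀ P₁ P₂ : TrigonalCurve.Affine b, TrigonalCurve.Generic P₁ P₂ →
          TrigonalCurve.omega nuII P₁ P₂ =
            TrigonalCurve.evalAt₂ P₁ P₂ F /
              (9 * (P₁.x - P₂.x) ^ 2 * P₁.yr * P₁.ys * P₂.yr * P₂.ys)) :=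
    ⟨fun _ _ h => TrigonalCurve.thirdKind_spec hrs hb h,
      fun _ _ h => TrigonalCurve.hasXDerivAt_dSigma h,
      (TrigonalCurve.exists_associated h3 hb).elim fun _ h => h.elim fun _ h => ⟨_, h⟩,
      fun _ h => ⟨h.isFundamentalSecondKind hrs h3 hb,
        TrigonalCurve.exists_tensor_of_isAssociated h3 hb h⟩⟩
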